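/- Let $q,a_0,a_1,\dots,b_0,b_1,\dots$ be formal variables and $\Bbbk=\mathbb C(q,a_0,a_1,\dots)$; write $\mathcal A=(a_0,a_1,\dots)$, $\mathcal B=(b_0,b_1,\dots)$, $\tau\mathcal A=(a_1,a_2,\dots)$ and $(x;q)_k=\prod_{i=1}^k(1-xq^{i-1})$. Partitions are sequences $\mu_1\ge\mu_2\ge\dots\ge0$ with finitely many nonzero parts, $|\mu|=\sum_i\mu_i$, and $\mathbb Y^n$ is the set of partitions with at most $n$ nonzero parts. *The polynomials.* For nonnegative integers put $$W_{a,x,b}(I,J,K,L)=\delta_{I+J=K+L}\,\delta_{J\ge L}\,(x/b)^{L}\frac{(a/x;q)_L(x/b;q)_{J-L}}{(a/b;q)_J}\,\frac{(q;q)_J}{(q;q)_L(q;q)_{J-L}} .$$ For partitions $\lambda,\mu$ and $r\ge 0$ let $J_s=\mu_s-\mu_{s+1}$, $K_s=\lambda_s-\lambda_{s+1}$, $L_s=r+\sum_{i\le s}(J_i-K_i)$, and let $\langle\lambda|\mathbb T_r(x|\mathcal A,\mathcal B)|\mu\rangle=\prod_{s\ge1}W_{a_{s+1},x,b_s}(L_{s-1},J_s,K_s,L_s)$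 if all $L_s\ge0$ and $L_s=0$ for large $s$, and $0$ otherwise. Let $\mathbb B(x|\mathcal A,\mathcal B)=\sum_{r\ge0}(x/b_0)^r\frac{(a_1/x;q)_r}{(q;q)_r}\mathbb T_r(x|\mathcal A,\mathcal B)$. The inhomogeneous spin $q$-Whittaker polynomial is $$\mathbb F_\lambda(x_1,\dots,x_n|\mathcal A,\mathcal B)=\langle\lambda|\,\mathbb B(x_1|\mathcal A,\mathcal B)\,\mathbb B(x_2|\tau\mathcal A,\mathcal B)\cdots\mathbb B(x_n|\tau^{n-1}\mathcal A,\mathcal B)\,|\varnothing\rangle .$$ For $\lambda\in\mathbb Y^n$, the interpolation $q$-Whittaker polynomial $\widetilde{\mathbb F}_\lambda(x_1,\dots,x_n|\mathcal A,\infty)$ is the result of substituting $b_0^{-1}=b_1^{-1}=\dots=0$ in $\prod_{r=1}^n b_{r-1}^{\lambda_r}\;\mathbb F_\lambda(x_1,\dots,x_n|\mathcal A,\mathcal B)$. For $\mu\in\mathbb Y^n$ put $\mathbf x^n_{\mathcal A}(\mu)=(a_1q^{\mu_1-\mu_2},\dots,a_{n-1}q^{\mu_{n-1}-\mu_n},a_nq^{\mu_n})$.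 Let $P_\lambda(x_1,\dots,x_n;q,0)$ be the $q$-Whittaker polynomial, that is, the Macdonald polynomial $P_\lambda(x_1,\dots,x_n;q,t)$ (normalized so that the coefficient of $x^\lambda$ is $1$) at $t=0$. **Proposition.** Let $n\ge0$ and $\lambda\in\mathbb Y^n$. Then $\widetilde{\mathbb F}_\lambda(x_1,\dots,x_n|\mathcal A,\infty)$ is the unique polynomial $f\in\Bbbk[x_1,\dots,x_n]$ such that 1. $f$ is symmetric and $\deg f\le|\lambda|$; 2. $f(\mathbf x^n_{\mathcal A}(\mu))=0$ for every $\mu\in\mathbb Y^n$ with $|\mu|\le|\lambda|$ and $\mu\ne\lambda$; 3. $\displaystyle f(\mathbf x^n_{\mathcal A}(\lambda))=(-1)^{\lambda_1}q^{\frac{\lambda_1^2-\lambda_1}2}\prod_{i=1}^na_i^{\lambda_i}\prod_{i,j=1}^n\bigl(q^{\lambda_{i+1}-\lambda_i}a_{j+i}/a_i;q\bigr)_{\lambda_{j+i}-\lambda_{j+i+1}}$. It is also the unique polynomial $f\in\Bbbk[x_1,\dots,x_n]$ such that 1'. $f$ is symmetric and $\deg f\le|\lambda|$; 2'. $f(\mathbf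 x^n_{\mathcal A}(\mu))=0$ for every $\mu\in\mathbb Y^n$ with $|\mu|<|\lambda|$; 3'. the top degree homogeneous component of $f$ has degree $|\lambda|$ and is equal to $$\prod_{i=1}^n\frac1{(q;q)_{\lambda_i-\lambda_{i+1}}}\;P_\lambda(x_1,\dots,x_n;q,0)$$ (this is the dual $q$-Whittaker polynomial $Q_\lambda(x_1,\dots,x_n;q,0)$ in Macdonald's notation). -/

import Mathlib

/-!  Interpolation `q`-Whittaker polynomials as the `b → ∞` degeneration of the inhomogeneous
spin `q`-Whittaker polynomials, and Macdonald symmetric functions. -/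

namespace InterpWhittaker

/-! ### Partitions -/

/-- A partition: a weakly decreasing, finitely supported sequence of nonnegative integers.
Indices start from `0`, so `parts r` is the part usually written `μ_{r+1}`. -/
@[ext]
structure Partn where
  parts : ℕ →₀ ℕ
  antitone : Antitone parts

namespace Partn

instance : CoeFun Partn (fun _ => ℕ → ℕ) := ⟨fun μ => μ.parts⟩

/-- The empty partition `∅ = (0, 0, …)`. -/
def empty : Partn := ⟨0, fun _ _ _ => le_rfl⟩

/-- The weight `|μ| = μ₁ + μ₂ + ⋯`. -/
def weight (μ : Partn) : ℕ := ∑ i ∈ μ.parts.support, μ i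

/-- The length: the number of nonzero parts. -/
def length (μ : Partn) : ℕ := μ.parts.support.card

/-- The difference `μ_{r+1} - μ_{r+2}` of consecutive parts (nonnegative as the parts decrease). -/
def diff (μ : Partn) (r : ℕ) : ℕ := μ r - μ (r + 1)

/-- The dominance order `μ ≤ ν` on partitions of the same weight. -/
def DomLE (μ ν : Partn) : Prop :=
  μ.weight = ν.weight ∧ ∀ k, ∑ i ∈ Finset.range k, μ i ≤ ∑ i ∈ Finset.range k, ν i

end Partn

/-! ### Vertex weights, row operators and spin `q`-Whittaker polynomials -/

section SpinWhittaker

variable {K : Type*} [Field K] {R : Type*} [CommRing R] [Algebra K R]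

/-- The `q`-Pochhammer symbol `(x;q)_k = ∏_{i=1}^{k} (1 - x q^{i-1})`, `k ≥ 0`. -/
def qPoch (q : K) (x : K) (k : ℕ) : K := ∏ i ∈ Finset.range k, (1 - x * q ^ i)

/-- The polynomial `x^k (a/x;q)_k = ∏_{i=1}^{k} (x - a q^{i-1})` in `x`. -/
def xPoch (q a : K) (x : R) (k : ℕ) : R :=
  ∏ i ∈ Finset.range k, (x - algebraMap K R (a * q ^ i))

theorem xPoch_eq (q a x : K) (hx : x ≠ 0) (k : ℕ) :
    xPoch q a x k = x ^ k * qPoch q (a / x) k := by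
  unfold xPoch qPoch
  rw [Finset.pow_eq_prod_const, ← Finset.prod_mul_distrib]
  refine Finset.prod_congr rfl fun i _ => ?_
  simp only [Algebra.algebraMap_self, RingHom.id_apply]
  field_simp

open Classical in
/-- The `q`-Hahn vertex weight
`W^b_{a,x,b}(I,J,K,L) = δ_{I+J=K+L} δ_{J≥L} (x/b)^L (a/x;q)_L (x/b;q)_{J-L} / (a/b;q)_J
  · (q;q)_J / ((q;q)_L (q;q)_{J-L})`,
as a polynomial in the spectral parameter `x`
(with `(x/b)^L (a/x;q)_L` written as `b^{-L} · x^L (a/x;q)_L`). -/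
noncomputable def vertexW (q a : K) (x : R) (b : K) (i j k l : ℕ) : R :=
  if i + j = k + l ∧ l ≤ j then
    algebraMap K R ((b⁻¹) ^ l / qPoch q (a / b) j
        * (qPoch q q j / (qPoch q q l * qPoch q q (j - l))))
      * xPoch q a x l
      * ∏ s ∈ Finset.range (j - l), (1 - algebraMap K R (b⁻¹ * q ^ s) * x)
  else 0

open Classical in
/-- The matrix coefficient `⟨K₁, …, K_N| T^{b,N}_{I,L}(x | A, B) |J₁, …, J_N⟩` of the row-to-row
transfer matrix. The labels of the horizontal edges are
`L_r = I + (J₁ + ⋯ + J_r) - (K₁ + ⋯ + K_r)`, and the coefficient is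
`∏_{r=1}^{N} W^b_{a_{r+1},x,b_r}(L_{r-1}, J_r, K_r, L_r)` if all `L_r ≥ 0` and `L_N = L`, and
zero otherwise. (`J r`, `K r` stand for `J_{r+1}`, `K_{r+1}`.) -/
noncomputable def rowT (q : K) (a b : ℕ → K) (x : R) (N I L : ℕ) (Kt Jt : ℕ → ℕ) : R :=
  let edge : ℕ → ℤ := fun r =>
    (I : ℤ) + ∑ i ∈ Finset.range r, (Jt i : ℤ) - ∑ i ∈ Finset.range r, (Kt i : ℤ)
  if (∀ r ≤ N, 0 ≤ edge r) ∧ edge N = L then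
    ∏ r ∈ Finset.range N,
      vertexW q (a (r + 2)) x (b (r + 1)) (edge r).toNat (Jt r) (Kt r) (edge (r + 1)).toNat
  else 0

open Classical in
/-- The matrix coefficient `⟨ν| 𝕋^b_I(x | A, B) |μ⟩`, where `𝕋^b_I = T^{b,N+1}_{I,0}` on the
span of the `|μ⟩` with `l(μ) ≤ N`, and `|μ⟩ = |μ₁ - μ₂, μ₂ - μ₃, …⟩`. -/
noncomputable def opT (q : K) (a b : ℕ → K) (x : R) (I : ℕ) (ν μ : Partn) : R :=
  if ν.length ≤ μ.length + 1 then rowT q a b x (μ.length + 1) I 0 ν.diff μ.diff else 0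

/-- The matrix coefficient `⟨ν| 𝔹(x | A, B) |μ⟩` of
`𝔹(x | A, B) = ∑_{r ≥ 0} (x/b₀)^r (a₁/x;q)_r / (q;q)_r · 𝕋^b_r(x | A, B)`. At most one summand
(`r = ν₁ - μ₁`) is nonzero. -/
noncomputable def opB (q : K) (a b : ℕ → K) (x : R) (ν μ : Partn) : R :=
  ∑ᶠ r : ℕ, algebraMap K R ((b 0)⁻¹ ^ r / qPoch q q r) * xPoch q (a 1) x r * opT q a b x r ν μ

open Classical in
/-- The inhomogeneous spin `q`-Whittaker polynomial
`𝔽_{ν/μ}(x₁, …, x_n | A, B) = ⟨ν| 𝔹(x₁ | A, B) 𝔹(x₂ | τA, B) ⋯ 𝔹(x_n | τ^{n-1}A, B) |μ⟩`, where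
`τ(a₀, a₁, …) = (a₁, a₂, …)`. The operators are multiplied by summing over intermediate
partitions; only finitely many of them contribute. -/
noncomputable def spinWhittaker (q : K) (b : ℕ → K) :
    (n : ℕ) → (ℕ → K) → (Fin n → R) → Partn → Partn → R
  | 0, _, _, ν, μ => if ν = μ then 1 else 0
  | n + 1, a, x, ν, μ =>
      ∑ᶠ κ : Partn, opB q a b (x 0) ν κ
        * spinWhittaker q b n (fun i => a (i + 1)) (fun i => x i.succ) κ μ

end SpinWhittaker

/-! ### The degeneration `b → ∞` -/

section Degeneration

variable {k : Type*} [Field k]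

/-- The field `k(b₀⁻¹, b₁⁻¹, …) = k(b₀, b₁, …)`; the polynomial variables are the `b_i⁻¹`. -/
abbrev WithB (k : Type*) [Field k] : Type _ := FractionRing (MvPolynomial ℕ k)

/-- The embedding of the constants `k` into `k(b₀, b₁, …)`. -/
noncomputable def constB : k →+* WithB k :=
  (algebraMap (MvPolynomial ℕ k) (WithB k)).comp MvPolynomial.C

/-- The formal variable `b_i`. -/
noncomputable def bVar (i : ℕ) : WithB k :=
  (algebraMap (MvPolynomial ℕ k) (WithB k) (MvPolynomial.X i))⁻¹

/-- The substitution `b₀⁻¹ = b₁⁻¹ = ⋯ = 0` in a rational function of the `b_i⁻¹`, computed from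
its reduced fraction (used for rational functions regular at that point). -/
noncomputable def setBInfty (f : WithB k) : k :=
  MvPolynomial.eval (fun _ => 0) (IsFractionRing.num (MvPolynomial ℕ k) f)
    / MvPolynomial.eval (fun _ => 0)
        (IsFractionRing.den (MvPolynomial ℕ k) f : MvPolynomial ℕ k)

/-- The renormalized polynomial
`𝔽̃_ν(x₁, …, x_n | A, B) = ∏_{r=1}^{n} b_{r-1}^{ν_r} · 𝔽_ν(x₁, …, x_n | A, B)`, with formal
`b₀, b₁, …`. -/
noncomputable def renormSpinWhittaker (q : k) (a : ℕ → k) (n : ℕ) (ν : Partn) :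
    MvPolynomial (Fin n) (WithB k) :=
  MvPolynomial.C (∏ r ∈ Finset.range n, bVar r ^ ν r)
    * spinWhittaker (constB q) bVar n (fun i => constB (a i)) MvPolynomial.X ν Partn.empty

/-- The interpolation `q`-Whittaker polynomial `𝔽̃_ν(x₁, …, x_n | A, ∞)`: the substitution
`b₀⁻¹ = b₁⁻¹ = ⋯ = 0` in (every coefficient of) `𝔽̃_ν(x₁, …, x_n | A, B)`. -/
noncomputable def interpWhittaker (q : k) (a : ℕ → k) (n : ℕ) (ν : Partn) :
    MvPolynomial (Fin n) k :=
  ∑ m ∈ (renormSpinWhittaker q a n ν).support,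
    MvPolynomial.monomial m (setBInfty (MvPolynomial.coeff m (renormSpinWhittaker q a n ν)))

/-- The interpolation point `x_A^n(μ) = (a₁ q^{μ₁-μ₂}, a₂ q^{μ₂-μ₃}, …, a_n q^{μ_n-μ_{n+1}})`
(with `μ_{n+1} = 0` for partitions of length at most `n`). -/
def interpPoint (q : k) (a : ℕ → k) (n : ℕ) (μ : Partn) : Fin n → k :=
  fun i => a (i + 1) * q ^ μ.diff i

/-- The constant `(-1)^{ν₁} q^{(ν₁² - ν₁)/2} ∏_{i=1}^n a_i^{ν_i}
  ∏_{i,j=1}^n (q^{ν_{i+1}-ν_i} a_{j+i}/a_i; q)_{ν_{j+i}-ν_{j+i+1}}`. -/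
noncomputable def interpValue (q : k) (a : ℕ → k) (n : ℕ) (ν : Partn) : k :=
  (-1) ^ ν 0 * q ^ (((ν 0) ^ 2 - ν 0) / 2) * (∏ i ∈ Finset.range n, a (i + 1) ^ ν i)
    * ∏ i ∈ Finset.range n, ∏ j ∈ Finset.range n,
        qPoch q (q ^ ((ν (i + 1) : ℤ) - (ν i : ℤ)) * a (i + j + 2) / a (i + 1))
          (ν.diff (i + j + 1))

end Degeneration

/-! ### Macdonald symmetric functions -/

section Macdonald

variable {K : Type*} [Field K]

/-- The ring of symmetric functions over a field of characteristic zero, as the polynomial ring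
`K[p₁, p₂, …]` in the power sums; the variable with index `r` is `p_{r+1}`. -/
abbrev SymFun (K : Type*) [Field K] : Type _ := MvPolynomial ℕ K

/-- The symmetric polynomial `f(x₁, …, x_n)`: the substitution `p_r = x₁^r + ⋯ + x_n^r`. -/
noncomputable def SymFun.inVars (n : ℕ) (f : SymFun K) : MvPolynomial (Fin n) K :=
  MvPolynomial.aeval (fun r : ℕ => MvPolynomial.psum (Fin n) K (r + 1)) f

/-- The coefficient of the monomial symmetric function `m_μ` in `f`, that is, the coefficient of
`x₁^{μ₁} x₂^{μ₂} ⋯ x_l^{μ_l}`, where `l` is the length of `μ`. -/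
noncomputable def SymFun.mCoeff (μ : Partn) (f : SymFun K) : K :=
  MvPolynomial.coeff (Finsupp.equivFunOnFinite.symm fun i : Fin μ.length => μ i)
    (f.inVars μ.length)

/-- Macdonald's scalar product: the products of power sums are orthogonal, and
`⟨p_ρ, p_ρ⟩_{q,t} = z_ρ ∏_i (1 - q^{ρ_i}) / (1 - t^{ρ_i})`, where
`z_ρ = ∏_r r^{m_r} m_r!` if `ρ` has `m_r` parts equal to `r`. -/
noncomputable def SymFun.scalar (q t : K) (f g : SymFun K) : K :=
  ∑ m ∈ f.support, f.coeff m * g.coeff m *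
    ∏ r ∈ m.support, (((r + 1 : ℕ) : K) ^ m r * ((m r).factorial : K)
      * ((1 - q ^ (r + 1)) / (1 - t ^ (r + 1))) ^ m r)

/-- `P` is the Macdonald symmetric function `P_ν(q,t)`: it is `m_ν` plus a linear combination of
the `m_μ` with `μ < ν` in the dominance order, and it is orthogonal to all linear combinations of
the `m_μ` with `μ < ν`. -/
def IsMacdonald (q t : K) (ν : Partn) (P : SymFun K) : Prop :=
  P.mCoeff ν = 1 ∧
  (∀ μ, P.mCoeff μ ≠ 0 → μ.DomLE ν) ∧
  ∀ g : SymFun K, (∀ μ, g.mCoeff μ ≠ 0 → μ.DomLE ν ∧ μ ≠ ν) → SymFun.scalar q t P g = 0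

open Classical in
/-- The Macdonald symmetric function `P_ν(q,t)` (with value `0` if there were none). -/
noncomputable def macdonaldP (q t : K) (ν : Partn) : SymFun K :=
  if h : ∃ P : SymFun K, IsMacdonald q t ν P then h.choose else 0

/-- The `q`-Whittaker polynomial `P_ν(x₁, …, x_n; q, 0)`. -/
noncomputable def qWhittaker (q : K) (n : ℕ) (ν : Partn) : MvPolynomial (Fin n) K :=
  (macdonaldP q 0 ν).inVars n

end Macdonald

/-! ### The coefficient field -/

/-- The field `ℂ(q, a₀, a₁, a₂, …)` of rational functions: the variable `none` is `q`, the
variable `some i` is `a_i`. -/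
abbrev QA : Type := FractionRing (MvPolynomial (Option ℕ) ℂ)

/-- The formal variable `q`. -/
noncomputable def qVar : QA := algebraMap (MvPolynomial (Option ℕ) ℂ) QA (MvPolynomial.X none)

/-- The formal variables `a₀, a₁, a₂, …`. -/
noncomputable def aVar (i : ℕ) : QA :=
  algebraMap (MvPolynomial (Option ℕ) ℂ) QA (MvPolynomial.X (some i))

end InterpWhittaker

open InterpWhittaker

/-! At `b = ∞` the operator product becomes a branching rule (`interpWhittaker_eq`): the polynomial
of ν is a sum, over κ interlacing with ν, of a row weight in the first variable times the polynomial
of κ in the other variables, with the parameters shifted by one. The row weight is a product of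
q-binomials and shifted powers (x - a)(x - aq)⋯, one for each row of ν/κ. Everything is read off
from this rule, formalized as `branchPoly`; its bound `B` only keeps the sums finite.

Symmetry is the commutation of two consecutive rows, `rowWt_exchange`. It follows from a refined
statement in which the first entry of the middle row is prescribed; the inductive step of that
statement is the q-binomial identity `exchange_identity`.

Vanishing: at the point of μ the first variable is a₁q^{μ₁-μ₂}, which kills every shifted power
based at a₁ and longer than μ₁-μ₂. By induction the polynomial of ν survives at μ only if ν ⊆ μ. For
μ = ν a single κ contributes, and this gives the product formula for the value. Hence evaluation at
the points with |μ| ≤ d is triangular, with non-zero diagonal, on the polynomials with |ν| ≤ d.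
There are as many of these as dominant exponents of degree at most d, so they form a basis of the
symmetric polynomials of degree at most d, and such a polynomial is determined by its values
(`interpolation_unique`). Both characterizations apply this to a difference: with d = |λ| for the
first, and with d = |λ| - 1 for the second, where the top components cancel.

The top component is the same branching sum with all a_i = 0, and it has to be recognized as
Q_λ(q,0). It lifts to a symmetric function `symQ`. Rescaling one variable by q removes vertical
strips (`rowWt_vertical`); in plethystic form this says that the adjoint of multiplication by e_r,
for the scalar product at t = 0, removes vertical strips of size r. So Q_ν pairs non-trivially with
a product of elementary functions only if ν is dominated by the partition whose columns are the
degrees, and the pairing is 1 in the case of equality. Since that product is m_μ plus lower terms,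
Q_ν is orthogonal to everything strictly below ν. Together with the triangularity of Q_ν itself this
makes it Macdonald's function up to a scalar; the same pairing shows that Macdonald's conditions
have only one solution (`IsMacdonald.unique`). -/

namespace InterpWhittaker

/-! ### Gaussian binomial coefficients -/

section QBinomial

variable {K : Type*} [Field K]

theorem qPoch_zero (q x : K) : qPoch q x 0 = 1 := by simp [qPoch]

theorem qPoch_succ (q x : K) (n : ℕ) : qPoch q x (n + 1) = qPoch q x n * (1 - x * q ^ n) := by
  simp [qPoch, Finset.prod_range_succ]

theorem qPoch_self_succ (q : K) (n : ℕ) :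
    qPoch q q (n + 1) = qPoch q q n * (1 - q ^ (n + 1)) := by
  rw [qPoch_succ, pow_succ']

theorem one_sub_pow_ne_zero {q : K} (hq : ∀ n, qPoch q q n ≠ 0) (n : ℕ) :
    1 - q ^ (n + 1) ≠ 0 := by
  have h := hq (n + 1)
  rw [qPoch_self_succ] at h
  exact right_ne_zero_of_mul h

/-- The Gaussian binomial coefficient. -/
noncomputable def qBinom (q : K) (n k : ℕ) : K :=
  if k ≤ n then qPoch q q n / (qPoch q q k * qPoch q q (n - k)) else 0

theorem qBinom_of_lt (q : K) {n k : ℕ} (h : n < k) : qBinom q n k = 0 := by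
  simp [qBinom, h]

theorem qBinom_add (q : K) (k m : ℕ) :
    qBinom q (k + m) k = qPoch q q (k + m) / (qPoch q q k * qPoch q q m) := by
  simp [qBinom]

theorem qBinom_zero_right {q : K} (hq : ∀ n, qPoch q q n ≠ 0) (n : ℕ) : qBinom q n 0 = 1 := by
  simp [qBinom, qPoch_zero, div_self (hq n)]

theorem qBinom_self {q : K} (hq : ∀ n, qPoch q q n ≠ 0) (n : ℕ) : qBinom q n n = 1 := by
  simp [qBinom, qPoch_zero, div_self (hq n)]

theorem qBinom_succ_succ {q : K} (hq : ∀ n, qPoch q q n ≠ 0) (n k : ℕ) :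
    qBinom q (n + 1) (k + 1) = q ^ (k + 1) * qBinom q n (k + 1) + qBinom q n k := by
  rcases lt_trichotomy n k with h | rfl | h
  · simp [qBinom_of_lt q h, qBinom_of_lt q (Nat.succ_lt_succ h),
      qBinom_of_lt q (Nat.lt_succ_of_lt h)]
  · simp [qBinom_self hq, qBinom_of_lt q (Nat.lt_succ_self n)]
  · obtain ⟨m, rfl⟩ : ∃ m, n = k + 1 + m := ⟨n - (k + 1), by omega⟩
    have e1 : k + 1 + m + 1 = k + 1 + (m + 1) := by ring
    have e2 : qBinom q (k + 1 + m) k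
        = qPoch q q (k + 1 + m) / (qPoch q q k * qPoch q q (m + 1)) := by
      rw [show k + 1 + m = k + (m + 1) by ring, qBinom_add]
    rw [e1, qBinom_add, qBinom_add, e2, ← e1, qPoch_self_succ q (k + 1 + m),
      qPoch_self_succ q k, qPoch_self_succ q m]
    have := hq (k + 1 + m); have := hq k; have := hq m
    have := one_sub_pow_ne_zero hq k; have := one_sub_pow_ne_zero hq m
    field_simp
    ring

theorem qBinom_succ_succ' {q : K} (hq : ∀ n, qPoch q q n ≠ 0) (n k : ℕ) (hk : k ≤ n) :
    qBinom q (n + 1) (k + 1) = qBinom q n (k + 1) + q ^ (n - k) * qBinom q n k := by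
  rcases hk.lt_or_eq with h | rfl
  · obtain ⟨m, rfl⟩ : ∃ m, n = k + 1 + m := ⟨n - (k + 1), by omega⟩
    have e1 : k + 1 + m + 1 = k + 1 + (m + 1) := by ring
    have e2 : qBinom q (k + 1 + m) k
        = qPoch q q (k + 1 + m) / (qPoch q q k * qPoch q q (m + 1)) := by
      rw [show k + 1 + m = k + (m + 1) by ring, qBinom_add]
    rw [e1, qBinom_add, qBinom_add, e2, ← e1, qPoch_self_succ q (k + 1 + m),
      qPoch_self_succ q k, qPoch_self_succ q m, show k + 1 + m - k = m + 1 by omega]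
    have := hq (k + 1 + m); have := hq k; have := hq m
    have := one_sub_pow_ne_zero hq k; have := one_sub_pow_ne_zero hq m
    field_simp
    ring
  · simp [qBinom_self hq, qBinom_of_lt q (Nat.lt_succ_self k)]

theorem qBinom_mul_qBinom {q : K} (hq : ∀ n, qPoch q q n ≠ 0) (n k j : ℕ) :
    qBinom q n (j + k) * qBinom q (j + k) j = qBinom q n j * qBinom q (n - j) k := by
  by_cases h : j + k ≤ n
  · obtain ⟨m, rfl⟩ : ∃ m, n = j + k + m := ⟨n - (j + k), by omega⟩
    rw [qBinom_add, qBinom_add, show j + k + m - j = k + m by omega, qBinom_add,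
      show j + k + m = j + (k + m) by ring, qBinom_add]
    have := hq (j + k); have := hq (k + m); have := hq j; have := hq k; have := hq m
    field_simp
  · rw [qBinom_of_lt q (by omega : n < j + k)]
    by_cases h' : j ≤ n
    · rw [qBinom_of_lt q (by omega : n - j < k)]; ring
    · rw [qBinom_of_lt q (by omega : n < j)]; ring

end QBinomial

/-! ### Shifted powers, the q-Vandermonde sum and the exchange identity -/

section ShiftedPower

variable {K : Type*} [Field K] {R : Type*} [CommRing R] [Algebra K R]

/-- The product `∏_{i<k} (x - a q^i)` with both `a` and `x` in an algebra over the field of `q`. -/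
def shiftPow (q : K) (a x : R) (k : ℕ) : R :=
  ∏ i ∈ Finset.range k, (x - a * algebraMap K R q ^ i)

theorem xPoch_eq_shiftPow (q a : K) (x : R) (k : ℕ) :
    xPoch q a x k = shiftPow q (algebraMap K R a) x k := by
  simp [xPoch, shiftPow]

theorem shiftPow_zero (q : K) (a x : R) : shiftPow q a x 0 = 1 := by simp [shiftPow]

theorem shiftPow_succ (q : K) (a x : R) (k : ℕ) :
    shiftPow q a x (k + 1) = shiftPow q a x k * (x - a * algebraMap K R q ^ k) := by
  simp [shiftPow, Finset.prod_range_succ]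

theorem shiftPow_add (q : K) (a x : R) (k l : ℕ) :
    shiftPow q a x (k + l)
      = shiftPow q a x k * shiftPow q (a * algebraMap K R q ^ k) x l := by
  simp only [shiftPow, Finset.prod_range_add]
  congr 1
  refine Finset.prod_congr rfl fun i _ => ?_
  rw [pow_add]; ring

/-- The Gaussian binomial coefficient, as an element of an algebra. -/
noncomputable def qBin (R : Type*) [CommRing R] [Algebra K R] (q : K) (n k : ℕ) : R :=
  algebraMap K R (qBinom q n k)

theorem qBin_of_lt (q : K) {n k : ℕ} (h : n < k) : qBin R q n k = 0 := by
  simp [qBin, qBinom_of_lt q h]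

variable {q : K} (hq : ∀ n, qPoch q q n ≠ 0)
include hq

theorem qBin_zero_right (n : ℕ) : qBin R q n 0 = 1 := by simp [qBin, qBinom_zero_right hq]

theorem qBin_self (n : ℕ) : qBin R q n n = 1 := by simp [qBin, qBinom_self hq]

theorem qBin_succ_succ (n k : ℕ) :
    qBin R q (n + 1) (k + 1) = algebraMap K R q ^ (k + 1) * qBin R q n (k + 1) + qBin R q n k := by
  simp [qBin, qBinom_succ_succ hq]

theorem qBin_mul_qBin (n k j : ℕ) :
    qBin R q n (j + k) * qBin R q (j + k) j = qBin R q n j * qBin R q (n - j) k := by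
  simp only [qBin, ← map_mul, qBinom_mul_qBinom hq]

theorem qBin_succ_succ' (n k : ℕ) (hk : k ≤ n) :
    qBin R q (n + 1) (k + 1) = qBin R q n (k + 1) + algebraMap K R q ^ (n - k) * qBin R q n k := by
  simp [qBin, qBinom_succ_succ' hq n k hk]

/-- Induction on r: the Pascal rule matches the splitting y - aq^r = (y - xq^{r-m}) + q^{r-m}(x -
aq^m) of the new factor. -/
theorem qVandermonde (a x y : R) (r : ℕ) :
    ∑ m ∈ Finset.range (r + 1), qBin R q r m * shiftPow q x y (r - m) * shiftPow q a x m
      = shiftPow q a y r := by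
  induction r with
  | zero => simp [shiftPow_zero, qBin_self hq]
  | succ r ih =>
    set Q := algebraMap K R q
    rw [Finset.sum_range_succ']
    have h1 : ∀ m ∈ Finset.range (r + 1),
        qBin R q (r + 1) (m + 1) * shiftPow q x y (r + 1 - (m + 1)) * shiftPow q a x (m + 1)
        = qBin R q r (m + 1) * shiftPow q x y (r - m) * shiftPow q a x (m + 1)
          + Q ^ (r - m) * qBin R q r m * shiftPow q x y (r - m) * shiftPow q a x m
            * (x - a * Q ^ m) := by
      intro m hm
      rw [qBin_succ_succ' hq _ _ (Nat.lt_succ_iff.mp (Finset.mem_range.mp hm)),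
        Nat.add_sub_add_right, shiftPow_succ]
      ring
    rw [Finset.sum_congr rfl h1, Finset.sum_add_distrib, shiftPow_succ, ← ih]
    have h2 : ∑ m ∈ Finset.range (r + 1),
          qBin R q r (m + 1) * shiftPow q x y (r - m) * shiftPow q a x (m + 1)
        + qBin R q (r + 1) 0 * shiftPow q x y (r + 1 - 0) * shiftPow q a x 0
        = ∑ m ∈ Finset.range (r + 1),
          qBin R q r m * shiftPow q x y (r + 1 - m) * shiftPow q a x m := by
      rw [Finset.sum_range_succ, qBin_of_lt q (Nat.lt_succ_self r), Finset.sum_range_succ' _ r]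
      simp [qBin_zero_right hq]
    rw [add_right_comm, h2, Finset.sum_mul, ← Finset.sum_add_distrib]
    refine Finset.sum_congr rfl fun m hm => ?_
    have hm' : m ≤ r := Nat.lt_succ_iff.mp (Finset.mem_range.mp hm)
    rw [Nat.succ_sub hm', shiftPow_succ]
    have : Q ^ r = Q ^ m * Q ^ (r - m) := by rw [← pow_add]; congr 1; omega
    rw [this]
    ring

/-- The sum on the left of `exchange_identity`. -/
theorem exchange_left_succ (a x y : R) (j r n : ℕ) :
    ∑ k ∈ Finset.range (n + 2), qBin R q (j + 1) k * qBin R q (j + 1 + r - k) (n + 1 - k)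
        * shiftPow q x y k * shiftPow q a x (n + 1 - k)
      = algebraMap K R q ^ (n + 1) * ∑ k ∈ Finset.range (n + 2),
          qBin R q j k * qBin R q (j + r - k) (n + 1 - k)
            * shiftPow q x y k * shiftPow q a x (n + 1 - k)
        + (y - a * algebraMap K R q ^ n) * ∑ k ∈ Finset.range (n + 1),
          qBin R q j k * qBin R q (j + r - k) (n - k)
            * shiftPow q x y k * shiftPow q a x (n - k) := by
  set Q := algebraMap K R q
  have pascal : ∀ k ∈ Finset.range (n + 1),
      qBin R q j k * qBin R q (j + 1 + r - k) (n + 1 - k)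
        = Q ^ (n + 1 - k) * (qBin R q j k * qBin R q (j + r - k) (n + 1 - k))
          + qBin R q j k * qBin R q (j + r - k) (n - k) := by
    intro k hk
    have hk' : k ≤ n := Nat.lt_succ_iff.mp (Finset.mem_range.mp hk)
    by_cases hj : k ≤ j
    · rw [show j + 1 + r - k = (j + r - k) + 1 by omega, show n + 1 - k = n - k + 1 by omega,
        qBin_succ_succ hq]
      ring
    · simp [qBin_of_lt q (not_le.mp hj)]
  -- Pascal in the second binomial; the extra term k = n + 1 has trivial second binomial and joins
  -- the first sum only.
  have first : ∑ k ∈ Finset.range (n + 2), Q ^ k * qBin R q j k *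
        qBin R q (j + 1 + r - k) (n + 1 - k) * shiftPow q x y k * shiftPow q a x (n + 1 - k)
      = Q ^ (n + 1) * ∑ k ∈ Finset.range (n + 2),
          qBin R q j k * qBin R q (j + r - k) (n + 1 - k)
            * shiftPow q x y k * shiftPow q a x (n + 1 - k)
        + ∑ k ∈ Finset.range (n + 1), Q ^ k * (x - a * Q ^ (n - k)) *
          (qBin R q j k * qBin R q (j + r - k) (n - k)
            * shiftPow q x y k * shiftPow q a x (n - k)) := by
    rw [Finset.sum_range_succ _ (n + 1), Finset.sum_range_succ _ (n + 1), mul_add, Finset.mul_sum,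
      add_right_comm (Finset.sum _ _), ← Finset.sum_add_distrib]
    congr 1
    · refine Finset.sum_congr rfl fun k hk => ?_
      have hk' : k ≤ n := Nat.lt_succ_iff.mp (Finset.mem_range.mp hk)
      have e := pascal k hk
      have e2 : Q ^ (n + 1) = Q ^ k * Q ^ (n + 1 - k) := by rw [← pow_add]; congr 1; omega
      rw [mul_assoc (Q ^ k), e, e2]
      have e3 : shiftPow q a x (n + 1 - k) = shiftPow q a x (n - k) * (x - a * Q ^ (n - k)) := by
        rw [Nat.succ_sub hk', shiftPow_succ]
      rw [e3]
      ring
    · simp [qBin_zero_right hq, mul_assoc]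
  have second : ∑ k ∈ Finset.range (n + 1), qBin R q j k * qBin R q (j + r - k) (n - k)
        * shiftPow q x y (k + 1) * shiftPow q a x (n - k)
      = ∑ k ∈ Finset.range (n + 1), (y - x * Q ^ k) *
          (qBin R q j k * qBin R q (j + r - k) (n - k)
            * shiftPow q x y k * shiftPow q a x (n - k)) := by
    refine Finset.sum_congr rfl fun k _ => ?_
    rw [shiftPow_succ]; ring
  have split : ∑ k ∈ Finset.range (n + 2),
        qBin R q (j + 1) k * qBin R q (j + 1 + r - k) (n + 1 - k)
          * shiftPow q x y k * shiftPow q a x (n + 1 - k)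
      = ∑ k ∈ Finset.range (n + 2), Q ^ k * qBin R q j k *
          qBin R q (j + 1 + r - k) (n + 1 - k) * shiftPow q x y k * shiftPow q a x (n + 1 - k)
        + ∑ k ∈ Finset.range (n + 1), qBin R q j k * qBin R q (j + r - k) (n - k)
          * shiftPow q x y (k + 1) * shiftPow q a x (n - k) := by
    rw [Finset.sum_range_succ' _ (n + 1), Finset.sum_range_succ' _ (n + 1),
      add_right_comm (Finset.sum _ _),
      ← Finset.sum_add_distrib]
    congr 1
    · refine Finset.sum_congr rfl fun k _ => ?_
      rw [qBin_succ_succ hq, Nat.add_sub_add_right, show j + 1 + r - (k + 1) = j + r - k by omega]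
      ring
    · simp [qBin_zero_right hq]
  -- The two remaining sums combine because q^k(x - aq^{n-k}) + (y - xq^k) = y - aq^n does not
  -- depend on k.
  rw [split, first, second, add_assoc, ← Finset.sum_add_distrib, Finset.mul_sum (Finset.range (n + 1))]
  congr 1
  refine Finset.sum_congr rfl fun k hk => ?_
  have e2 : Q ^ n = Q ^ k * Q ^ (n - k) := by
    rw [← pow_add]; congr 1; have := Finset.mem_range.mp hk; omega
  rw [e2]; ring

/-- Both sides obey S(j+1, n+1) = q^{n+1} S(j, n+1) + (y - aq^n) S(j, n): the left one by
`exchange_left_succ`, the right one by the Pascal rule alone. The boundary cases j = 0 and n = 0 are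
q-Vandermonde sums. -/
theorem exchange_identity (a x y : R) (j r n : ℕ) :
    shiftPow q a y r * ∑ k ∈ Finset.range (n + 1), qBin R q j k * qBin R q (j + r - k) (n - k)
        * shiftPow q x y k * shiftPow q a x (n - k)
      = shiftPow q a y n * ∑ m ∈ Finset.range (r + 1), qBin R q r m * qBin R q (j + m) n
        * shiftPow q x y (r - m) * shiftPow q a x m := by
  induction j generalizing n with
  | zero =>
    rw [Finset.sum_range_succ', Finset.sum_eq_zero, zero_add]
    · by_cases hn : n ≤ r
      · obtain ⟨s, rfl⟩ := Nat.exists_eq_add_of_le hn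
        -- For j = 0 the right-hand sum starts at m = n; pulling out the first n factors of the
        -- shifted power leaves a q-Vandermonde sum of order s based at aq^n.
        have h1 : ∀ m ∈ Finset.range (n + s + 1), qBin R q (n + s) m * qBin R q (0 + m) n
            * shiftPow q x y (n + s - m) * shiftPow q a x m
            = if n ≤ m then qBin R q (n + s) n * shiftPow q a x n * (qBin R q s (m - n)
              * shiftPow q x y (s - (m - n))
              * shiftPow q (a * algebraMap K R q ^ n) x (m - n)) else 0 := by
          intro m _
          split_ifs with h
          · obtain ⟨t, rfl⟩ := Nat.exists_eq_add_of_le h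
            rw [zero_add, qBin_mul_qBin hq, shiftPow_add, Nat.add_sub_cancel_left,
              Nat.add_sub_cancel_left, Nat.add_sub_add_left]
            ring
          · rw [zero_add, qBin_of_lt q (not_le.mp h)]; ring
        rw [Finset.sum_congr rfl h1, add_assoc, Finset.sum_range_add, Finset.sum_eq_zero, zero_add]
        · simp only [le_add_iff_nonneg_right, zero_le, if_true, Nat.add_sub_cancel_left]
          rw [← Finset.mul_sum, qVandermonde hq, shiftPow_add]
          simp [qBin_zero_right hq, shiftPow_zero]
          ring
        · intro m hm
          rw [if_neg (not_le.mpr (Finset.mem_range.mp hm))]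
      · rw [Finset.sum_eq_zero]
        · simp [qBin_of_lt q (not_le.mp hn)]
        · intro m hm
          have := Finset.mem_range.mp hm
          rw [zero_add, qBin_of_lt q (by omega : m < n)]; ring
    · intro k _
      rw [qBin_of_lt q (Nat.succ_pos k)]; ring
  | succ j ih =>
    cases n with
    | zero => simp [qBin_zero_right hq, shiftPow_zero, qVandermonde hq]
    | succ n =>
      rw [exchange_left_succ hq, mul_add, mul_left_comm, ih, mul_left_comm _ (y - _), ih]
      simp only [Finset.mul_sum, ← Finset.sum_add_distrib]
      refine Finset.sum_congr rfl fun m _ => ?_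
      rw [show j + 1 + m = j + m + 1 by ring, qBin_succ_succ hq, shiftPow_succ]
      ring

end ShiftedPower

/-! ### Finite boxes of integer sequences -/

/-- The sequence `c, f 0, f 1, …`. -/
def consSeq (c : ℕ) (f : ℕ → ℕ) : ℕ → ℕ
  | 0 => c
  | i + 1 => f i

/-- The sequence `f 1, f 2, …`. -/
def tailSeq {α : Type*} (f : ℕ → α) : ℕ → α := fun i => f (i + 1)

@[simp] theorem consSeq_zero (c : ℕ) (f : ℕ → ℕ) : consSeq c f 0 = c := rfl
@[simp] theorem consSeq_succ (c : ℕ) (f : ℕ → ℕ) (i : ℕ) : consSeq c f (i + 1) = f i := rfl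
@[simp] theorem tailSeq_apply {α : Type*} (f : ℕ → α) (i : ℕ) : tailSeq f i = f (i + 1) := rfl

theorem consSeq_injective :
    Function.Injective (fun p : ℕ × (ℕ → ℕ) => consSeq p.1 p.2) := by
  rintro ⟨c, f⟩ ⟨d, g⟩ h
  have h0 := congrFun h 0
  simp only [consSeq_zero] at h0
  have h1 : f = g := funext fun i => congrFun h (i + 1)
  rw [h0, h1]

/-- The sequences with entries at most `B` which vanish from the index `m` on. -/
def seqBox (B : ℕ) : ℕ → Finset (ℕ → ℕ)
  | 0 => {fun _ => 0}
  | m + 1 => (Finset.range (B + 1) ×ˢ seqBox B m).map ⟨_, consSeq_injective⟩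

theorem mem_seqBox {B m : ℕ} {f : ℕ → ℕ} :
    f ∈ seqBox B m ↔ (∀ i, f i ≤ B) ∧ ∀ i, m ≤ i → f i = 0 := by
  induction m generalizing f with
  | zero =>
    simp only [seqBox, Finset.mem_singleton, zero_le, true_imp_iff]
    constructor
    · rintro rfl; simp
    · exact fun h => funext h.2
  | succ m ih =>
    simp only [seqBox, Finset.mem_map, Finset.mem_product, Finset.mem_range,
      Function.Embedding.coeFn_mk, Prod.exists]
    constructor
    · rintro ⟨c, g, ⟨hc, hg⟩, rfl⟩
      rw [ih] at hg
      refine ⟨fun i => ?_, fun i hi => ?_⟩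
      · cases i with
        | zero => simp only [consSeq_zero]; omega
        | succ i => exact hg.1 i
      · cases i with
        | zero => omega
        | succ i => exact hg.2 i (by omega)
    · intro h
      refine ⟨f 0, tailSeq f, ⟨Nat.lt_succ_of_le (h.1 0), ?_⟩, ?_⟩
      · rw [ih]
        exact ⟨fun i => h.1 _, fun i hi => h.2 _ (by omega)⟩
      · funext i; cases i <;> rfl

theorem sum_seqBox_succ {M : Type*} [AddCommMonoid M] (B m : ℕ) (F : (ℕ → ℕ) → M) :
    ∑ κ ∈ seqBox B (m + 1), F κ
      = ∑ c ∈ Finset.range (B + 1), ∑ κ ∈ seqBox B m, F (consSeq c κ) := by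
  rw [seqBox, Finset.sum_map, Finset.sum_product]
  rfl

theorem sum_range_triangle {M : Type*} [AddCommMonoid M] (N : ℕ) (g : ℕ → ℕ → M) :
    ∑ i ∈ Finset.range (N + 1), ∑ j ∈ Finset.range (i + 1), g i j
      = ∑ j ∈ Finset.range (N + 1), ∑ k ∈ Finset.range (N - j + 1), g (j + k) j := by
  have h1 : ∀ i ∈ Finset.range (N + 1), ∑ j ∈ Finset.range (i + 1), g i j
      = ∑ j ∈ Finset.range (N + 1), if j ≤ i then g i j else 0 := by
    intro i hi
    have hi' := Finset.mem_range.mp hi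
    rw [← Finset.sum_filter]
    refine Finset.sum_congr ?_ fun _ _ => rfl
    ext j; simp only [Finset.mem_range, Finset.mem_filter]; omega
  rw [Finset.sum_congr rfl h1, Finset.sum_comm]
  refine Finset.sum_congr rfl fun j hj => ?_
  have hj' := Finset.mem_range.mp hj
  rw [show N + 1 = j + (N - j + 1) by omega, Finset.sum_range_add, Finset.sum_eq_zero, zero_add]
  · exact Finset.sum_congr rfl fun k _ => if_pos (Nat.le_add_right _ _)
  · intro i hi
    exact if_neg (not_le.mpr (Finset.mem_range.mp hi))

theorem sum_range_window {M : Type*} [AddCommMonoid M] {B p N : ℕ} (h : p + N ≤ B) (f : ℕ → M)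
    (hf : ∀ c, f c ≠ 0 → p ≤ c ∧ c ≤ p + N) :
    ∑ c ∈ Finset.range (B + 1), f c = ∑ r ∈ Finset.range (N + 1), f (p + r) := by
  rw [show B + 1 = p + ((N + 1) + (B - p - N)) by omega, Finset.sum_range_add,
    Finset.sum_eq_zero, zero_add, Finset.sum_range_add,
    Finset.sum_eq_zero (s := Finset.range (B - p - N)), add_zero]
  · intro i _
    by_contra hne
    have := hf _ hne; omega
  · intro i hi
    by_contra hne
    have := hf _ hne; have := Finset.mem_range.mp hi; omega

/-! ### Row weights and the interpolation polynomials -/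

section RowWeights

variable {K : Type*} [Field K] {R : Type*} [CommRing R] [Algebra K R]

/-- The weight `binom(κ_s - κ_{s+1}, ν_{s+1} - κ_{s+1})_q ∏_{i < ν_{s+1} - κ_{s+1}} (x - a q^i)` if
`κ_s ≥ ν_{s+1} ≥ κ_{s+1}`, and `0` otherwise. -/
noncomputable def edgeWt (q : K) (a x : R) (k₀ n₁ k₁ : ℕ) : R :=
  if k₁ ≤ n₁ ∧ n₁ ≤ k₀ then qBin R q (k₀ - k₁) (n₁ - k₁) * shiftPow q a x (n₁ - k₁) else 0

theorem edgeWt_of_le (q : K) (a x : R) {k₀ n₁ k₁ : ℕ} (h : k₁ ≤ n₁) (h' : k₁ ≤ k₀) :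
    edgeWt q a x k₀ n₁ k₁ = qBin R q (k₀ - k₁) (n₁ - k₁) * shiftPow q a x (n₁ - k₁) := by
  unfold edgeWt
  split_ifs with h1
  · rfl
  · rw [qBin_of_lt q (by omega), zero_mul]

theorem edgeWt_ne_zero {q : K} {a x : R} {k₀ n₁ k₁ : ℕ} (h : edgeWt q a x k₀ n₁ k₁ ≠ 0) :
    k₁ ≤ n₁ ∧ n₁ ≤ k₀ := by
  by_contra h1
  exact h (if_neg h1)

/-- The weight of the leftmost edge of a row. -/
noncomputable def headWt (q : K) (a x : R) (n₀ k₀ : ℕ) : R :=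
  if k₀ ≤ n₀ then algebraMap K R (qPoch q q (n₀ - k₀))⁻¹ * shiftPow q a x (n₀ - k₀) else 0

theorem headWt_ne_zero {q : K} {a x : R} {n₀ k₀ : ℕ} (h : headWt q a x n₀ k₀ ≠ 0) :
    k₀ ≤ n₀ := by
  by_contra h1
  exact h (if_neg h1)

noncomputable def tailWt (q : K) (m : ℕ) (a : ℕ → R) (x : R) (ν κ : ℕ → ℕ) : R :=
  ∏ s ∈ Finset.range m, edgeWt q (a (s + 2)) x (κ s) (ν (s + 1)) (κ (s + 1))

/-- The branching coefficient of the interpolation `q`-Whittaker polynomials. -/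
noncomputable def rowWt (q : K) (m : ℕ) (a : ℕ → R) (x : R) (ν κ : ℕ → ℕ) : R :=
  headWt q (a 1) x (ν 0) (κ 0) * tailWt q m a x ν κ

/-- The interpolation `q`-Whittaker polynomial of the partition `ν` with `ν i ≤ B`, by the branching
rule. -/
noncomputable def branchPoly (q : K) (B : ℕ) : (m : ℕ) → (ℕ → R) → (Fin m → R) → (ℕ → ℕ) → R
  | 0, _, _, _ => 1
  | m + 1, a, x, ν => ∑ κ ∈ seqBox B m,
      rowWt q m a (x 0) ν κ * branchPoly q B m (tailSeq a) (fun i => x i.succ) κ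

theorem tailWt_succ (q : K) (m : ℕ) (a : ℕ → R) (x : R) (ν κ : ℕ → ℕ) :
    tailWt q (m + 1) a x ν κ
      = edgeWt q (a 2) x (κ 0) (ν 1) (κ 1) * tailWt q m (tailSeq a) x (tailSeq ν) (tailSeq κ) := by
  simp only [tailWt, Finset.prod_range_succ' _ m]
  rw [mul_comm]
  rfl

/-- The sum over the middle row of a two-row configuration, given its first entry `c`. -/
noncomputable def twoRowTail (q : K) (B m : ℕ) (a : ℕ → R) (x y : R) (ν μ : ℕ → ℕ) (c : ℕ) : R :=
  ∑ κ ∈ seqBox B m,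
    tailWt q (m + 1) a x ν (consSeq c κ) * tailWt q m (tailSeq a) y (consSeq c κ) μ

theorem twoRowTail_zero (q : K) (B : ℕ) (a : ℕ → R) (x y : R) (ν μ : ℕ → ℕ) (c : ℕ) :
    twoRowTail q B 0 a x y ν μ c = edgeWt q (a 2) x c (ν 1) 0 := by
  simp [twoRowTail, seqBox, tailWt]

theorem twoRowTail_succ (q : K) (B m : ℕ) (a : ℕ → R) (x y : R) (ν μ : ℕ → ℕ) (c : ℕ) :
    twoRowTail q B (m + 1) a x y ν μ c
      = ∑ d ∈ Finset.range (B + 1), edgeWt q (a 2) x c (ν 1) d * edgeWt q (a 3) y (μ 0) d (μ 1)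
        * twoRowTail q B m (tailSeq a) x y (tailSeq ν) (tailSeq μ) d := by
  rw [twoRowTail, sum_seqBox_succ]
  refine Finset.sum_congr rfl fun d _ => ?_
  rw [twoRowTail, Finset.mul_sum]
  refine Finset.sum_congr rfl fun κ _ => ?_
  rw [tailWt_succ q (m + 1), tailWt_succ q m (tailSeq a) y]
  simp only [consSeq_zero, consSeq_succ, tailSeq_apply]
  have e : tailSeq (consSeq c (consSeq d κ)) = consSeq d κ := rfl
  rw [e]
  ring

theorem edgeWt_mul_edgeWt (q : K) (a a' x y : R) (μ₀ μ₁ r s N : ℕ) (h : μ₁ ≤ μ₀) (hs : s ≤ N) :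
    edgeWt q a x (μ₀ + r) (μ₁ + N) (μ₁ + s) * edgeWt q a' y μ₀ (μ₁ + s) μ₁
      = qBin R q (μ₀ - μ₁ + r - s) (N - s) * shiftPow q a x (N - s)
        * (qBin R q (μ₀ - μ₁) s * shiftPow q a' y s) := by
  rw [edgeWt_of_le q a' y (Nat.le_add_right _ _) h, Nat.add_sub_cancel_left]
  by_cases hJ : s ≤ μ₀ - μ₁
  · rw [edgeWt_of_le q a x (by omega) (by omega), Nat.add_sub_add_left,
      show μ₀ + r - (μ₁ + s) = μ₀ - μ₁ + r - s by omega]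
  · rw [qBin_of_lt q (not_le.mp hJ)]; ring

variable {q : K} (hq : ∀ n, qPoch q q n ≠ 0)
include hq

/-- With its first entry fixed, the two-row sum is not symmetric in x and y. Exchanging them costs a
triangular transition kernel, stated here with its denominator cleared. Peeling off one entry of the
middle row, the induction hypothesis yields the kernel based at `a 3`, and `exchange_identity`
carries it to the one based at `a 2`. -/
theorem twoRowTail_exchange (B m : ℕ) (a : ℕ → R) (x y : R) (ν μ : ℕ → ℕ) (hν : ∀ i, ν i ≤ B)
    (hμ : μ m = 0) (r : ℕ) :
    shiftPow q (a 2) y r * twoRowTail q B m a x y ν μ (μ 0 + r)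
      = ∑ s ∈ Finset.range (r + 1), qBin R q r s * shiftPow q x y (r - s) * shiftPow q (a 2) x s
        * twoRowTail q B m a y x ν μ (μ 0 + s) := by
  induction m generalizing a ν μ r with
  | zero =>
    simp only [twoRowTail_zero, hμ, zero_add]
    have h := exchange_identity hq (a 2) x y 0 r (ν 1)
    rw [Finset.sum_range_succ', Finset.sum_eq_zero, zero_add] at h
    · rw [edgeWt_of_le q _ _ (Nat.zero_le _) (Nat.zero_le _), Nat.sub_zero, Nat.sub_zero]
      simp only [qBin_zero_right hq, zero_add, Nat.sub_zero, one_mul, shiftPow_zero, mul_one] at h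
      rw [h, Finset.mul_sum]
      refine Finset.sum_congr rfl fun s _ => ?_
      rw [edgeWt_of_le q _ _ (Nat.zero_le _) (Nat.zero_le _), Nat.sub_zero, Nat.sub_zero]
      ring
    · intro k _
      rw [qBin_of_lt q (Nat.succ_pos k)]; ring
  | succ m ih =>
    by_cases h10 : μ 1 ≤ μ 0 ∧ μ 1 ≤ ν 1
    swap
    · have hz : ∀ x y c, twoRowTail q B (m + 1) a x y ν μ c = 0 := by
        intro x y c
        rw [twoRowTail_succ]
        refine Finset.sum_eq_zero fun d _ => ?_
        by_contra hne
        have h1 := edgeWt_ne_zero (left_ne_zero_of_mul (left_ne_zero_of_mul hne))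
        have h2 := edgeWt_ne_zero (right_ne_zero_of_mul (left_ne_zero_of_mul hne))
        omega
      simp [hz]
    obtain ⟨h10, h1ν⟩ := h10
    obtain ⟨N, hN⟩ := Nat.exists_eq_add_of_le h1ν
    set J := μ 0 - μ 1 with hJ
    -- The edge weights confine the next middle entry to the interval from μ 1 to ν 1 = μ 1 + N.
    have expand : ∀ x y r, twoRowTail q B (m + 1) a x y ν μ (μ 0 + r)
        = ∑ s ∈ Finset.range (N + 1), qBin R q (J + r - s) (N - s) * shiftPow q (a 2) x (N - s)
          * qBin R q J s * (shiftPow q (a 3) y s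
          * twoRowTail q B m (tailSeq a) x y (tailSeq ν) (tailSeq μ) (μ 1 + s)) := by
      intro x y r
      rw [twoRowTail_succ, sum_range_window (p := μ 1) (N := N) (by have := hν 1; omega)]
      · refine Finset.sum_congr rfl fun s hs => ?_
        rw [hN, edgeWt_mul_edgeWt q _ _ _ _ _ _ _ _ _ h10
          (Nat.lt_succ_iff.mp (Finset.mem_range.mp hs))]
        ring
      · intro c hne
        have h1 := edgeWt_ne_zero (left_ne_zero_of_mul (left_ne_zero_of_mul hne))
        have h2 := edgeWt_ne_zero (right_ne_zero_of_mul (left_ne_zero_of_mul hne))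
        omega
    have ih' := fun s => ih (tailSeq a) (tailSeq ν) (tailSeq μ) (fun i => hν _) hμ s
    simp only [tailSeq_apply] at ih'
    simp only [zero_add, Nat.reduceAdd] at ih'
    simp only [expand]
    simp only [ih', Finset.mul_sum]
    -- Compare the coefficients of the swapped tail at μ 1 + t: with s = t + k, the sum over k is
    -- the exchange identity with (j, n) = (J - t, N - t).
    rw [sum_range_triangle, Finset.sum_comm]
    refine Finset.sum_congr rfl fun t ht => ?_
    have ht' := Nat.lt_succ_iff.mp (Finset.mem_range.mp ht)
    have key := exchange_identity hq (a 2) x y (J - t) r (N - t)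
    by_cases hJt : t ≤ J
    · have key2 := congrArg (fun z => z * (qBin R q J t * (shiftPow q (a 3) x t *
        twoRowTail q B m (tailSeq a) y x (tailSeq ν) (tailSeq μ) (μ 1 + t)))) key
      simp only [Finset.mul_sum, Finset.sum_mul] at key2
      convert key2 using 1
      · refine Finset.sum_congr rfl fun k _ => ?_
        have e := qBin_mul_qBin (R := R) hq J k t
        rw [Nat.add_sub_cancel_left, show J + r - (t + k) = J - t + r - k by omega,
          show N - (t + k) = N - t - k by omega]
        linear_combination (shiftPow q (a 2) y r * qBin R q (J - t + r - k) (N - t - k)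
          * shiftPow q (a 2) x (N - t - k) * shiftPow q x y k * shiftPow q (a 3) x t *
          twoRowTail q B m (tailSeq a) y x (tailSeq ν) (tailSeq μ) (μ 1 + t)) * e
      · refine Finset.sum_congr rfl fun k _ => ?_
        rw [show J + k - t = J - t + k by omega]
        ring
    · rw [Finset.sum_eq_zero, Finset.sum_eq_zero]
      · intro k _
        rw [qBin_of_lt q (not_le.mp hJt)]; ring
      · intro k _
        rw [qBin_of_lt q (show J < t + k by omega)]; ring

/-- The q-Vandermonde sum divided by (q;q)_M and read backwards. It absorbs the transition kernel of
`twoRowTail_exchange` at the leftmost edge. -/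
theorem headWt_convolution (a x y : R) (M : ℕ) :
    ∑ k ∈ Finset.range (M + 1), algebraMap K R ((qPoch q q (M - k))⁻¹ * (qPoch q q k)⁻¹)
        * shiftPow q x y k * shiftPow q a x (M - k)
      = algebraMap K R (qPoch q q M)⁻¹ * shiftPow q a y M := by
  rw [← qVandermonde hq a x y M, Finset.mul_sum,
    ← Finset.sum_range_reflect (fun m => algebraMap K R (qPoch q q M)⁻¹ * _)]
  refine Finset.sum_congr rfl fun k hk => ?_
  have hk' := Nat.lt_succ_iff.mp (Finset.mem_range.mp hk)
  rw [show M + 1 - 1 - k = M - k by omega, Nat.sub_sub_self hk']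
  have : algebraMap K R ((qPoch q q (M - k))⁻¹ * (qPoch q q k)⁻¹)
      = algebraMap K R (qPoch q q M)⁻¹ * qBin R q M (M - k) := by
    rw [qBin, ← map_mul]
    congr 1
    rw [qBinom, if_pos (Nat.sub_le _ _), Nat.sub_sub_self hk']
    have := hq M; have := hq k; have := hq (M - k)
    field_simp
  rw [this]; ring

/-- The head weight of the lower row supplies exactly the factor (y - a₂)(y - a₂q)⋯ that
`twoRowTail_exchange` needs; the kernel so produced is then summed against the upper head weight by
`headWt_convolution`. -/
theorem rowWt_exchange (B m : ℕ) (a : ℕ → R) (x y : R) (ν μ : ℕ → ℕ) (hν : ∀ i, ν i ≤ B)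
    (hμ : μ m = 0) :
    ∑ κ ∈ seqBox B (m + 1), rowWt q (m + 1) a x ν κ * rowWt q m (tailSeq a) y κ μ
      = ∑ κ ∈ seqBox B (m + 1), rowWt q (m + 1) a y ν κ * rowWt q m (tailSeq a) x κ μ := by
  have expand : ∀ x y, ∑ κ ∈ seqBox B (m + 1), rowWt q (m + 1) a x ν κ * rowWt q m (tailSeq a) y κ μ
      = ∑ c ∈ Finset.range (B + 1), headWt q (a 1) x (ν 0) c * headWt q (a 2) y c (μ 0)
        * twoRowTail q B m a x y ν μ c := by
    intro x y
    rw [sum_seqBox_succ]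
    refine Finset.sum_congr rfl fun c _ => ?_
    rw [twoRowTail, Finset.mul_sum]
    refine Finset.sum_congr rfl fun κ _ => ?_
    simp only [rowWt, consSeq_zero, tailSeq_apply, Nat.reduceAdd]
    ring
  rw [expand, expand]
  by_cases h0 : μ 0 ≤ ν 0
  swap
  · rw [Finset.sum_eq_zero, Finset.sum_eq_zero] <;>
    · intro c _
      by_contra hne
      have h1 := headWt_ne_zero (left_ne_zero_of_mul (left_ne_zero_of_mul hne))
      have h2 := headWt_ne_zero (right_ne_zero_of_mul (left_ne_zero_of_mul hne))
      omega
  obtain ⟨N, hN⟩ := Nat.exists_eq_add_of_le h0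
  have expand2 : ∀ x y, ∑ c ∈ Finset.range (B + 1),
        headWt q (a 1) x (ν 0) c * headWt q (a 2) y c (μ 0) * twoRowTail q B m a x y ν μ c
      = ∑ r ∈ Finset.range (N + 1), algebraMap K R ((qPoch q q (N - r))⁻¹ * (qPoch q q r)⁻¹)
        * shiftPow q (a 1) x (N - r)
        * (shiftPow q (a 2) y r * twoRowTail q B m a x y ν μ (μ 0 + r)) := by
    intro x y
    rw [sum_range_window (p := μ 0) (N := N) (by have := hν 0; omega)]
    · refine Finset.sum_congr rfl fun r hr => ?_
      have hr' := Nat.lt_succ_iff.mp (Finset.mem_range.mp hr)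
      rw [headWt, headWt, if_pos (by omega), if_pos (by omega), hN, Nat.add_sub_add_left,
        Nat.add_sub_cancel_left, map_mul]
      ring
    · intro c hne
      have h1 := headWt_ne_zero (left_ne_zero_of_mul (left_ne_zero_of_mul hne))
      have h2 := headWt_ne_zero (right_ne_zero_of_mul (left_ne_zero_of_mul hne))
      omega
  rw [expand2, expand2]
  simp only [twoRowTail_exchange hq B m a x y ν μ hν hμ, Finset.mul_sum]
  rw [sum_range_triangle]
  refine Finset.sum_congr rfl fun t ht => ?_
  have key := congrArg (fun z => z * (algebraMap K R (qPoch q q t)⁻¹ * (shiftPow q (a 2) x t *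
        twoRowTail q B m a y x ν μ (μ 0 + t)))) (headWt_convolution hq (a 1) x y (N - t))
  simp only [Finset.sum_mul] at key
  convert key using 1
  · refine Finset.sum_congr rfl fun k _ => ?_
    have e : algebraMap K R ((qPoch q q (N - (t + k)))⁻¹ * (qPoch q q (t + k))⁻¹)
        * qBin R q (t + k) t
        = algebraMap K R ((qPoch q q (N - t - k))⁻¹ * (qPoch q q k)⁻¹)
          * algebraMap K R (qPoch q q t)⁻¹ := by
      rw [qBin, ← map_mul, ← map_mul, qBinom_add, show N - (t + k) = N - t - k by omega]
      congr 1
      have := hq (t + k); have := hq k; have := hq t; have := hq (N - t - k)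
      field_simp
    rw [Nat.add_sub_cancel_left]
    rw [show N - (t + k) = N - t - k by omega] at e ⊢
    linear_combination (shiftPow q (a 1) x (N - t - k) * shiftPow q x y k * shiftPow q (a 2) x t *
        twoRowTail q B m a y x ν μ (μ 0 + t)) * e
  · rw [map_mul]; ring

theorem branchPoly_swap (B m : ℕ) (a : ℕ → R) (x : Fin (m + 1) → R) (ν : ℕ → ℕ)
    (hν : ∀ i, ν i ≤ B) (i : Fin m) :
    branchPoly q B (m + 1) a (x ∘ Equiv.swap i.castSucc i.succ) ν = branchPoly q B (m + 1) a x ν := by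
  induction m generalizing a ν with
  | zero => exact i.elim0
  | succ m ih =>
    -- The first transposition exchanges the two outer rows; any other one acts inside the inner
    -- polynomial.
    rcases Fin.eq_zero_or_eq_succ i with rfl | ⟨j, rfl⟩
    · have expand : ∀ x : Fin (m + 2) → R, branchPoly q B (m + 2) a x ν
          = ∑ μ ∈ seqBox B m, (∑ κ ∈ seqBox B (m + 1),
            rowWt q (m + 1) a (x 0) ν κ * rowWt q m (tailSeq a) (x 1) κ μ)
            * branchPoly q B m (tailSeq (tailSeq a)) (fun i => x i.succ.succ) μ := by
        intro x
        simp only [branchPoly, Finset.mul_sum, Finset.sum_mul]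
        rw [Finset.sum_comm]
        simp only [mul_assoc]
        rfl
      rw [expand, expand]
      refine Finset.sum_congr rfl fun μ hμ => ?_
      have e1 : (x ∘ Equiv.swap (0 : Fin (m + 1)).castSucc (0 : Fin (m + 1)).succ) 0 = x 1 := by
        simp
      have e2 : (x ∘ Equiv.swap (0 : Fin (m + 1)).castSucc (0 : Fin (m + 1)).succ) 1 = x 0 := by
        simp
      rw [e1, e2, rowWt_exchange hq B m a (x 1) (x 0) ν μ hν ((mem_seqBox.mp hμ).2 m le_rfl)]
      congr 2
    · rw [branchPoly, branchPoly]
      refine Finset.sum_congr rfl fun κ hκ => ?_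
      rw [← ih (tailSeq a) (fun i => x i.succ) κ (mem_seqBox.mp hκ).1 j]
      congr 2
      funext t
      simp only [Function.comp_apply]
      rw [← Fin.succ_castSucc]
      congr 1
      exact ((Fin.succ_injective _).swap_apply _ _ _)

theorem branchPoly_perm (B m : ℕ) (a : ℕ → R) (x : Fin m → R) (ν : ℕ → ℕ)
    (hν : ∀ i, ν i ≤ B) (σ : Equiv.Perm (Fin m)) :
    branchPoly q B m a (x ∘ σ) ν = branchPoly q B m a x ν := by
  cases m with
  | zero => rfl
  | succ m =>
    have hσ : σ ∈ Submonoid.closure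
        (Set.range fun i : Fin m => Equiv.swap i.castSucc i.succ) := by
      rw [Equiv.Perm.mclosure_swap_castSucc_succ]; trivial
    induction hσ using Submonoid.closure_induction generalizing x with
    | mem σ h =>
      obtain ⟨i, rfl⟩ := h
      exact branchPoly_swap hq B m a x ν hν i
    | one => rfl
    | mul σ τ _ _ h1 h2 =>
      rw [Equiv.Perm.coe_mul, ← Function.comp_assoc, h2, h1]

end RowWeights

open MvPolynomial

/-! ### Top degree components -/

section TopPart

variable {K : Type*} [Field K] {σ : Type*}

/-- `G` is homogeneous of degree `d`, and all monomials of `F - G` have degree less than `d`. -/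
def TopPart (d : ℕ) (F G : MvPolynomial σ K) : Prop :=
  G.IsHomogeneous d ∧ ∀ m, coeff m (F - G) ≠ 0 → m.degree < d

theorem TopPart.zero (d : ℕ) : TopPart d (0 : MvPolynomial σ K) 0 :=
  ⟨isHomogeneous_zero _ _ _, by simp⟩

theorem TopPart.of_isHomogeneous {d : ℕ} {F : MvPolynomial σ K} (h : F.IsHomogeneous d) :
    TopPart d F F :=
  ⟨h, by simp⟩

theorem TopPart.congr_degree {d e : ℕ} {F G : MvPolynomial σ K} (h : TopPart d F G)
    (hde : d = e) : TopPart e F G := hde ▸ h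

theorem TopPart.one : TopPart 0 (1 : MvPolynomial σ K) 1 :=
  .of_isHomogeneous (isHomogeneous_one _ _)

theorem TopPart.C (c : K) : TopPart 0 (C c : MvPolynomial σ K) (C c) :=
  .of_isHomogeneous (isHomogeneous_C _ _)

theorem TopPart.add {d : ℕ} {F G F' G' : MvPolynomial σ K} (h : TopPart d F G)
    (h' : TopPart d F' G') : TopPart d (F + F') (G + G') := by
  refine ⟨h.1.add h'.1, fun m hm => ?_⟩
  rw [add_sub_add_comm, coeff_add] at hm
  by_cases h1 : coeff m (F - G) = 0
  · rw [h1, zero_add] at hm; exact h'.2 m hm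
  · exact h.2 m h1

theorem TopPart.sum {ι : Type*} {d : ℕ} (s : Finset ι) {F G : ι → MvPolynomial σ K}
    (h : ∀ i ∈ s, TopPart d (F i) (G i)) : TopPart d (∑ i ∈ s, F i) (∑ i ∈ s, G i) := by
  classical
  induction s using Finset.induction_on with
  | empty => simpa using TopPart.zero d
  | insert i s hi ih =>
    rw [Finset.sum_insert hi, Finset.sum_insert hi]
    exact (h i (Finset.mem_insert_self _ _)).add
      (ih fun j hj => h j (Finset.mem_insert_of_mem hj))

theorem TopPart.mul {d e : ℕ} {F G F' G' : MvPolynomial σ K} (h : TopPart d F G)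
    (h' : TopPart e F' G') : TopPart (d + e) (F * F') (G * G') := by
  classical
  refine ⟨h.1.mul h'.1, fun m hm => ?_⟩
  have e1 : F * F' - G * G' = (F - G) * (F' - G') + (F - G) * G' + G * (F' - G') := by ring
  have hG : ∀ m, coeff m G ≠ 0 → m.degree ≤ d := fun m hm =>
    (not_imp_comm.mp (h.1.coeff_eq_zero) hm).le
  have hG' : ∀ m, coeff m G' ≠ 0 → m.degree ≤ e := fun m hm =>
    (not_imp_comm.mp (h'.1.coeff_eq_zero) hm).le
  have prod : ∀ P Q : MvPolynomial σ K, coeff m (P * Q) ≠ 0 →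
      ∃ a b, a + b = m ∧ coeff a P ≠ 0 ∧ coeff b Q ≠ 0 := by
    intro P Q hne
    rw [coeff_mul] at hne
    obtain ⟨p, hp, hpq⟩ := Finset.exists_ne_zero_of_sum_ne_zero hne
    exact ⟨p.1, p.2, Finset.HasAntidiagonal.mem_antidiagonal.mp hp, left_ne_zero_of_mul hpq,
      right_ne_zero_of_mul hpq⟩
  rw [e1, coeff_add, coeff_add] at hm
  by_cases h1 : coeff m ((F - G) * (F' - G')) = 0
  · by_cases h2 : coeff m ((F - G) * G') = 0
    · rw [h1, h2, zero_add, zero_add] at hm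
      obtain ⟨a, b, rfl, ha, hb⟩ := prod _ _ hm
      have := hG a ha; have := h'.2 b hb
      rw [map_add]; omega
    · obtain ⟨a, b, rfl, ha, hb⟩ := prod _ _ h2
      have := h.2 a ha; have := hG' b hb
      rw [map_add]; omega
  · obtain ⟨a, b, rfl, ha, hb⟩ := prod _ _ h1
    have := h.2 a ha; have := h'.2 b hb
    rw [map_add]; omega

theorem TopPart.prod {ι : Type*} (s : Finset ι) {d : ι → ℕ} {F G : ι → MvPolynomial σ K}
    (h : ∀ i ∈ s, TopPart (d i) (F i) (G i)) :
    TopPart (∑ i ∈ s, d i) (∏ i ∈ s, F i) (∏ i ∈ s, G i) := by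
  classical
  induction s using Finset.induction_on with
  | empty => simpa using TopPart.one
  | insert i s hi ih =>
    rw [Finset.prod_insert hi, Finset.prod_insert hi, Finset.sum_insert hi]
    exact (h i (Finset.mem_insert_self _ _)).mul
      (ih fun j hj => h j (Finset.mem_insert_of_mem hj))

theorem TopPart.totalDegree_le {d : ℕ} {F G : MvPolynomial σ K} (h : TopPart d F G) :
    F.totalDegree ≤ d := by
  refine Finset.sup_le fun m hm => ?_
  change m.degree ≤ d
  by_cases h1 : coeff m (F - G) = 0
  · rw [coeff_sub, sub_eq_zero] at h1
    by_contra h2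
    exact (mem_support_iff.mp hm) (h1.trans (h.1.coeff_eq_zero (fun h3 => h2 h3.le)))
  · exact (h.2 m h1).le

theorem TopPart.homogeneousComponent {d : ℕ} {F G : MvPolynomial σ K} (h : TopPart d F G) :
    homogeneousComponent d F = G := by
  ext m
  rw [coeff_homogeneousComponent]
  split_ifs with h1
  · by_contra h2
    have := h.2 m (by rw [coeff_sub]; exact sub_ne_zero.mpr h2)
    omega
  · exact (h.1.coeff_eq_zero h1).symm

theorem shiftPow_zero_left {R : Type*} [CommRing R] [Algebra K R] (q : K) (x : R) (k : ℕ) :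
    shiftPow q 0 x k = x ^ k := by simp [shiftPow]

theorem TopPart.shiftPow (q a : K) {x : MvPolynomial σ K} (hx : x.IsHomogeneous 1) (k : ℕ) :
    TopPart k (shiftPow q (MvPolynomial.C a) x k) (InterpWhittaker.shiftPow q 0 x k) := by
  have := TopPart.prod (Finset.range k) (d := fun _ => 1)
    (F := fun i => x - MvPolynomial.C a * algebraMap K (MvPolynomial σ K) q ^ i)
    (G := fun i => x - 0 * algebraMap K (MvPolynomial σ K) q ^ i) (fun i _ => by
      refine ⟨by simpa using hx, fun m hm => ?_⟩
      classical
      have e : x - MvPolynomial.C a * algebraMap K (MvPolynomial σ K) q ^ i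
          - (x - 0 * algebraMap K (MvPolynomial σ K) q ^ i) = MvPolynomial.C (-(a * q ^ i)) := by
        simp [MvPolynomial.algebraMap_eq]
      rw [e, coeff_C] at hm
      split_ifs at hm with h0
      · rw [← h0]; simp
      · exact absurd rfl hm)
  simpa [InterpWhittaker.shiftPow] using this

theorem TopPart.edgeWt (q a : K) {x : MvPolynomial σ K} (hx : x.IsHomogeneous 1)
    (k₀ n₁ k₁ : ℕ) :
    TopPart (n₁ - k₁) (edgeWt q (MvPolynomial.C a) x k₀ n₁ k₁)
      (InterpWhittaker.edgeWt q 0 x k₀ n₁ k₁) := by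
  unfold InterpWhittaker.edgeWt
  split_ifs
  · have := (TopPart.C (qBinom q (k₀ - k₁) (n₁ - k₁))).mul (TopPart.shiftPow q a hx (n₁ - k₁))
    rwa [zero_add] at this
  · exact .zero _

theorem TopPart.headWt (q a : K) {x : MvPolynomial σ K} (hx : x.IsHomogeneous 1) (n₀ k₀ : ℕ) :
    TopPart (n₀ - k₀) (headWt q (MvPolynomial.C a) x n₀ k₀)
      (InterpWhittaker.headWt q 0 x n₀ k₀) := by
  unfold InterpWhittaker.headWt
  split_ifs
  · have := (TopPart.C (qPoch q q (n₀ - k₀))⁻¹).mul (TopPart.shiftPow q a hx (n₀ - k₀))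
    rwa [zero_add] at this
  · exact .zero _

theorem rowWt_ne_zero {R : Type*} [CommRing R] [Algebra K R] {q : K} {m : ℕ} {a : ℕ → R} {x : R}
    {ν κ : ℕ → ℕ} (h : rowWt q m a x ν κ ≠ 0) :
    (∀ i ≤ m, κ i ≤ ν i) ∧ ∀ i < m, ν (i + 1) ≤ κ i := by
  have h0 := headWt_ne_zero (left_ne_zero_of_mul h)
  have h1 : ∀ i < m, κ (i + 1) ≤ ν (i + 1) ∧ ν (i + 1) ≤ κ i := by
    intro i hi
    by_contra hne
    exact right_ne_zero_of_mul h (Finset.prod_eq_zero (Finset.mem_range.mpr hi) (if_neg hne))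
  refine ⟨fun i hi => ?_, fun i hi => (h1 i hi).2⟩
  cases i with
  | zero => exact h0
  | succ i => exact (h1 i hi).1

theorem rowWt_eq_zero {R : Type*} [CommRing R] [Algebra K R] (q : K) {m : ℕ} (a : ℕ → R) (x : R)
    {ν κ : ℕ → ℕ} (h : ¬ ((∀ i ≤ m, κ i ≤ ν i) ∧ ∀ i < m, ν (i + 1) ≤ κ i)) :
    rowWt q m a x ν κ = 0 := by
  by_contra hne
  exact h (rowWt_ne_zero hne)

theorem TopPart.rowWt (q : K) (m : ℕ) (a : ℕ → K) {x : MvPolynomial σ K} (hx : x.IsHomogeneous 1)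
    (ν κ : ℕ → ℕ) :
    TopPart (∑ i ∈ Finset.range (m + 1), (ν i - κ i))
      (rowWt q m (fun i => MvPolynomial.C (a i)) x ν κ)
      (InterpWhittaker.rowWt q m (fun _ => 0) x ν κ) := by
  rw [Finset.sum_range_succ', add_comm]
  exact (TopPart.headWt q _ hx _ _).mul
    (TopPart.prod _ fun i _ => TopPart.edgeWt q _ hx _ _ _)

theorem TopPart.branchPoly (q : K) (B m : ℕ) (a : ℕ → K) {x : Fin m → MvPolynomial σ K}
    (hx : ∀ i, (x i).IsHomogeneous 1) (ν : ℕ → ℕ) :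
    TopPart (∑ i ∈ Finset.range m, ν i)
      (branchPoly q B m (fun i => MvPolynomial.C (a i)) x ν)
      (InterpWhittaker.branchPoly q B m (fun _ => 0) x ν) := by
  induction m generalizing a ν with
  | zero => exact .one
  | succ m ih =>
    refine TopPart.sum _ fun κ hκ => ?_
    have ih' := ih (tailSeq a) (fun i => hx i.succ) κ
    have hr := TopPart.rowWt q m a (hx 0) ν κ
    -- The degrees |ν| - |κ| and |κ| add up only if no subtraction is truncated; when interlacing
    -- fails, both row weights are zero.
    by_cases h : (∀ i ≤ m, κ i ≤ ν i) ∧ ∀ i < m, ν (i + 1) ≤ κ i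
    · refine (hr.mul ih').congr_degree ?_
      have hκm := (mem_seqBox.mp hκ).2 m le_rfl
      have : ∑ i ∈ Finset.range m, κ i = ∑ i ∈ Finset.range (m + 1), κ i := by
        rw [Finset.sum_range_succ, hκm, add_zero]
      rw [this, ← Finset.sum_add_distrib]
      refine Finset.sum_congr rfl fun i hi => ?_
      have := h.1 i (Nat.lt_succ_iff.mp (Finset.mem_range.mp hi)); omega
    · rw [rowWt_eq_zero _ _ _ h, rowWt_eq_zero _ _ _ h, zero_mul, zero_mul]
      exact .zero _

end TopPart

/-! ### Functoriality -/

section Functoriality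

variable {K : Type*} [Field K] {R S : Type*} [CommRing R] [Algebra K R] [CommRing S] [Algebra K S]

theorem map_shiftPow (φ : R →ₐ[K] S) (q : K) (a x : R) (k : ℕ) :
    φ (shiftPow q a x k) = shiftPow q (φ a) (φ x) k := by
  simp [shiftPow]

theorem map_qBin (φ : R →ₐ[K] S) (q : K) (n k : ℕ) : φ (qBin R q n k) = qBin S q n k := by
  simp [qBin]

theorem map_edgeWt (φ : R →ₐ[K] S) (q : K) (a x : R) (k₀ n₁ k₁ : ℕ) :
    φ (edgeWt q a x k₀ n₁ k₁) = edgeWt q (φ a) (φ x) k₀ n₁ k₁ := by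
  unfold edgeWt
  split_ifs
  · rw [map_mul, map_qBin, map_shiftPow]
  · exact map_zero φ

theorem map_headWt (φ : R →ₐ[K] S) (q : K) (a x : R) (n₀ k₀ : ℕ) :
    φ (headWt q a x n₀ k₀) = headWt q (φ a) (φ x) n₀ k₀ := by
  unfold headWt
  split_ifs
  · rw [map_mul, map_shiftPow, AlgHom.commutes]
  · exact map_zero φ

theorem map_rowWt (φ : R →ₐ[K] S) (q : K) (m : ℕ) (a : ℕ → R) (x : R) (ν κ : ℕ → ℕ) :
    φ (rowWt q m a x ν κ) = rowWt q m (fun i => φ (a i)) (φ x) ν κ := by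
  simp only [rowWt, tailWt, map_mul, map_prod, map_headWt, map_edgeWt]

theorem map_branchPoly (φ : R →ₐ[K] S) (q : K) (B m : ℕ) (a : ℕ → R) (x : Fin m → R)
    (ν : ℕ → ℕ) :
    φ (branchPoly q B m a x ν) = branchPoly q B m (fun i => φ (a i)) (fun i => φ (x i)) ν := by
  induction m generalizing a ν with
  | zero => exact map_one φ
  | succ m ih =>
    simp only [branchPoly, map_sum, map_mul, ih, map_rowWt]
    rfl

end Functoriality

/-! ### Evaluation at the interpolation points -/

section Evaluation

variable {K : Type*} [Field K]

/-- The interpolation point of a sequence. -/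
def seqPoint (q : K) (a : ℕ → K) (n : ℕ) (μ : ℕ → ℕ) : Fin n → K :=
  fun i => a (i + 1) * q ^ (μ i - μ (i + 1))

/-- Genericity of the parameters. -/
structure GenericParams (q : K) (a : ℕ → K) : Prop where
  qPoch_ne : ∀ n, qPoch q q n ≠ 0
  q_ne : q ≠ 0
  a_ne : ∀ i, a i ≠ 0
  sep : ∀ i j, i ≠ j → ∀ d e : ℕ, a i * q ^ d ≠ a j * q ^ e

theorem GenericParams.tail {q : K} {a : ℕ → K} (h : GenericParams q a) :
    GenericParams q (tailSeq a) :=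
  ⟨h.qPoch_ne, h.q_ne, fun i => h.a_ne _, fun i j hij => h.sep _ _ (by omega)⟩

theorem shiftPow_self_eq_zero (q a : K) {d k : ℕ} (h : d < k) : shiftPow q a (a * q ^ d) k = 0 :=
  Finset.prod_eq_zero (Finset.mem_range.mpr h) (by simp)

theorem shiftPow_ne_zero {q a x : K} {k : ℕ} (h : ∀ i < k, x ≠ a * q ^ i) :
    shiftPow q a x k ≠ 0 :=
  Finset.prod_ne_zero_iff.mpr fun i hi => sub_ne_zero.mpr (h i (Finset.mem_range.mp hi))

/-- In a surviving term the head factor at a₁q^{μ₀-μ₁} forces ν₀ - κ₀ ≤ μ₀ - μ₁. The remaining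
coordinates are the point of the tail of μ for the shifted parameters, so κ_i ≤ μ_{i+1} by
induction, while ν_{i+1} ≤ κ_i by interlacing. -/
theorem le_of_branchPoly_ne_zero (q : K) (B m : ℕ) (a : ℕ → K) (μ ν : ℕ → ℕ) (hμ : Antitone μ)
    (h : branchPoly q B m a (seqPoint q a m μ) ν ≠ 0) : ∀ i < m, ν i ≤ μ i := by
  induction m generalizing a μ ν with
  | zero => intro i hi; omega
  | succ m ih =>
    obtain ⟨κ, hκ, hne⟩ := Finset.exists_ne_zero_of_sum_ne_zero h
    have hr := rowWt_ne_zero (left_ne_zero_of_mul hne)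
    have hκμ := ih (tailSeq a) (tailSeq μ) κ (fun i j hij => hμ (by omega))
      (right_ne_zero_of_mul hne)
    have h0 : ν 0 ≤ κ 0 + (μ 0 - μ 1) := by
      have := hr.1 0 (Nat.zero_le _)
      have hh := left_ne_zero_of_mul (left_ne_zero_of_mul hne)
      by_contra hlt
      refine hh ?_
      rw [headWt, if_pos this, seqPoint]
      have := shiftPow_self_eq_zero q (a 1) (d := μ 0 - μ 1) (k := ν 0 - κ 0) (by omega)
      simp [this]
    intro i hi
    cases i with
    | zero =>
      have := hμ (Nat.zero_le 1)
      rcases Nat.eq_zero_or_pos m with rfl | hm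
      · have := (mem_seqBox.mp hκ).2 0 le_rfl
        omega
      · have := hκμ 0 hm
        simp only [tailSeq_apply, zero_add] at this
        omega
    | succ i =>
      have h1 := hr.2 i (by omega)
      have h2 := hκμ i (by omega)
      exact h1.trans h2

/-- A contributing κ is squeezed: interlacing gives κ_i ≥ ν_{i+1}, and the vanishing property of the
inner polynomial gives κ_i ≤ ν_{i+1}. -/
theorem branchPoly_seqPoint_self_succ (q : K) (B m : ℕ) (a : ℕ → K) (ν : ℕ → ℕ) (hν : Antitone ν)
    (hB : ∀ i, ν i ≤ B) (hm : ∀ i, m + 1 ≤ i → ν i = 0) :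
    branchPoly q B (m + 1) a (seqPoint q a (m + 1) ν) ν
      = rowWt q m a (a 1 * q ^ (ν 0 - ν 1)) ν (tailSeq ν)
        * branchPoly q B m (tailSeq a) (seqPoint q (tailSeq a) m (tailSeq ν)) (tailSeq ν) := by
  rw [branchPoly]
  refine (Finset.sum_eq_single (tailSeq ν) ?_ ?_).trans rfl
  · intro κ hκ hne
    by_contra h0
    apply hne
    have h1 := (rowWt_ne_zero (left_ne_zero_of_mul h0)).2
    have h2 := le_of_branchPoly_ne_zero q B m (tailSeq a) (tailSeq ν) κ
      (fun i j hij => hν (by omega)) (right_ne_zero_of_mul h0)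
    funext i
    by_cases hi : i < m
    · exact le_antisymm (h2 i hi) (h1 i hi)
    · rw [(mem_seqBox.mp hκ).2 i (by omega), tailSeq_apply, hm _ (by omega)]
  · intro h
    exact absurd (mem_seqBox.mpr ⟨fun i => hB _, fun i hi => hm _ (by omega)⟩) h

theorem rowWt_tailSeq {R : Type*} [CommRing R] [Algebra K R] {q : K} (hq : ∀ n, qPoch q q n ≠ 0)
    (m : ℕ) (a : ℕ → R) (x : R) (ν : ℕ → ℕ) (hν : Antitone ν) :
    rowWt q m a x ν (tailSeq ν) = algebraMap K R (qPoch q q (ν 0 - ν 1))⁻¹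
      * shiftPow q (a 1) x (ν 0 - ν 1)
      * ∏ s ∈ Finset.range m, shiftPow q (a (s + 2)) x (ν (s + 1) - ν (s + 2)) := by
  rw [rowWt, headWt, if_pos (by exact hν (Nat.zero_le 1)), tailWt]
  congr 1
  refine Finset.prod_congr rfl fun s _ => ?_
  rw [edgeWt, if_pos ⟨hν (by omega), le_rfl⟩]
  simp [qBin_self hq]

theorem branchPoly_seqPoint_self_ne_zero {q : K} {a : ℕ → K} (hg : GenericParams q a) (B m : ℕ)
    (ν : ℕ → ℕ) (hν : Antitone ν) (hB : ∀ i, ν i ≤ B) (hm : ∀ i, m ≤ i → ν i = 0) :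
    branchPoly q B m a (seqPoint q a m ν) ν ≠ 0 := by
  induction m generalizing a ν with
  | zero => exact one_ne_zero
  | succ m ih =>
    rw [branchPoly_seqPoint_self_succ q B m a ν hν hB hm, rowWt_tailSeq hg.qPoch_ne m a _ ν hν]
    refine mul_ne_zero (mul_ne_zero (mul_ne_zero ?_ ?_) (Finset.prod_ne_zero_iff.mpr ?_))
      (ih hg.tail _ (fun i j hij => hν (by omega)) (fun i => hB _) (fun i hi => hm _ (by omega)))
    · simpa using hg.qPoch_ne _
    -- A zero of the head factor would make some q^{t+1} equal to 1, against the non-vanishing of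
    -- (q;q)_{t+1}.
    · refine shiftPow_ne_zero fun i hi h => ?_
      obtain ⟨t, ht⟩ := Nat.exists_eq_add_of_lt hi
      have h1 := mul_left_cancel₀ (hg.a_ne 1) h
      rw [ht, add_assoc, pow_add] at h1
      have h2 : q ^ i * q ^ (t + 1) = q ^ i * 1 := by rw [h1, mul_one]
      have h3 := mul_left_cancel₀ (pow_ne_zero i hg.q_ne) h2
      exact one_sub_pow_ne_zero hg.qPoch_ne t (by rw [h3, sub_self])
    · intro s _
      exact shiftPow_ne_zero fun i _ => hg.sep _ _ (by omega) _ _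

end Evaluation

/-! ### Symmetric polynomials are determined by their values at the interpolation points -/

section Uniqueness

variable {K : Type*} [Field K]

/-- The exponent `(μ 0, …, μ (n-1))`. -/
noncomputable def seqExponent (n : ℕ) (μ : ℕ → ℕ) : Fin n →₀ ℕ :=
  Finsupp.equivFunOnFinite.symm fun i => μ i

@[simp] theorem seqExponent_apply (n : ℕ) (μ : ℕ → ℕ) (i : Fin n) : seqExponent n μ i = μ i := rfl

theorem degree_seqExponent (n : ℕ) (μ : ℕ → ℕ) :
    (seqExponent n μ).degree = ∑ i ∈ Finset.range n, μ i := by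
  rw [Finsupp.degree_eq_sum, Finset.sum_range]
  rfl

theorem exists_seqExponent_eq {n : ℕ} (m : Fin n →₀ ℕ) (hm : Antitone m) :
    ∃ μ : ℕ → ℕ, Antitone μ ∧ (∀ i, n ≤ i → μ i = 0) ∧ seqExponent n μ = m := by
  refine ⟨fun i => if h : i < n then m ⟨i, h⟩ else 0, ?_, ?_, ?_⟩
  · intro i j hij
    dsimp only
    by_cases hj : j < n
    · rw [dif_pos hj, dif_pos (lt_of_le_of_lt hij hj)]
      exact hm hij
    · rw [dif_neg hj]; exact Nat.zero_le _
  · intro i hi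
    exact dif_neg (not_lt.mpr hi)
  · ext i
    simp

theorem coeff_equivMapDomain_of_isSymmetric {n : ℕ} {f : MvPolynomial (Fin n) K}
    (hf : f.IsSymmetric) (σ : Equiv.Perm (Fin n)) (m : Fin n →₀ ℕ) :
    coeff (m.mapDomain σ) f = coeff m f := by
  conv_lhs => rw [← hf σ]
  exact coeff_rename_mapDomain _ σ.injective _ _

theorem exists_perm_antitone {n : ℕ} (m : Fin n →₀ ℕ) :
    ∃ σ : Equiv.Perm (Fin n), Antitone (m.mapDomain σ) := by
  obtain ⟨τ, hτ⟩ : ∃ τ : Equiv.Perm (Fin n), Antitone (m ∘ τ) :=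
    ⟨Tuple.sort (OrderDual.toDual ∘ m), Tuple.monotone_sort (OrderDual.toDual ∘ m)⟩
  refine ⟨τ.symm, ?_⟩
  have : ⇑(m.mapDomain τ.symm) = m ∘ τ := by
    funext i
    rw [← Finsupp.equivMapDomain_eq_mapDomain]
    simp [Finsupp.equivMapDomain_apply]
  rw [this]
  exact hτ

theorem isSymmetric_eq_zero {n : ℕ} {f : MvPolynomial (Fin n) K} (hf : f.IsSymmetric)
    (h : ∀ μ : ℕ → ℕ, Antitone μ → (∀ i, n ≤ i → μ i = 0) → coeff (seqExponent n μ) f = 0) :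
    f = 0 := by
  ext m
  obtain ⟨σ, hσ⟩ := exists_perm_antitone m
  obtain ⟨μ, h1, h2, h3⟩ := exists_seqExponent_eq _ hσ
  rw [← coeff_equivMapDomain_of_isSymmetric hf σ, ← h3, h μ h1 h2, coeff_zero]

/-- The interpolation polynomial with indeterminate arguments. -/
noncomputable def interpPoly (q : K) (a : ℕ → K) (B n : ℕ) (ν : ℕ → ℕ) : MvPolynomial (Fin n) K :=
  branchPoly q B n (fun i => C (a i)) X ν

theorem interpPoly_isSymmetric {q : K} (hq : ∀ n, qPoch q q n ≠ 0) (a : ℕ → K) {B : ℕ} (n : ℕ)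
    {ν : ℕ → ℕ} (hν : ∀ i, ν i ≤ B) : (interpPoly q a B n ν).IsSymmetric := by
  intro σ
  rw [interpPoly, map_branchPoly (rename σ)]
  conv_rhs => rw [← branchPoly_perm hq B n _ X ν hν σ]
  congr 1
  · funext i; exact rename_C _ _
  · funext i; exact rename_X _ _

theorem eval_interpPoly (q : K) (a : ℕ → K) (B n : ℕ) (ν : ℕ → ℕ) (x : Fin n → K) :
    eval x (interpPoly q a B n ν) = branchPoly q B n a x ν := by
  rw [← coe_aeval_eq_eval, RingHom.coe_coe, interpPoly, map_branchPoly (aeval x)]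
  congr 1
  · funext i; simp
  · funext i; simp

theorem topPart_interpPoly (q : K) (a : ℕ → K) (B n : ℕ) (ν : ℕ → ℕ) :
    TopPart (∑ i ∈ Finset.range n, ν i) (interpPoly q a B n ν) (interpPoly q 0 B n ν) := by
  have := TopPart.branchPoly q B n a (x := X) (fun i => isHomogeneous_X _ _) ν
  simpa [interpPoly] using this

/-- A dimension count. The interpolation polynomials and the dominant exponents of degree at most d
are indexed by the same finite set P, so taking dominant coefficients of linear combinations is an
endomorphism `co ∘ₗ T` of K^P. It is injective because evaluation is triangular, hence surjective,
and f is itself a combination of the interpolation polynomials; the vanishing of its values then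
kills its coefficients. -/
theorem interpolation_unique {q : K} {a : ℕ → K} (hg : GenericParams q a) {n d : ℕ}
    {f : MvPolynomial (Fin n) K} (hf : f.IsSymmetric) (hd : f.totalDegree ≤ d)
    (hv : ∀ μ : ℕ → ℕ, Antitone μ → (∀ i, n ≤ i → μ i = 0) → ∑ i ∈ Finset.range n, μ i ≤ d →
      eval (seqPoint q a n μ) f = 0) : f = 0 := by
  classical
  set P : Finset (ℕ → ℕ) :=
    (seqBox d n).filter fun μ => Antitone μ ∧ ∑ i ∈ Finset.range n, μ i ≤ d with hP
  have memP : ∀ μ : ℕ → ℕ, Antitone μ → (∀ i, n ≤ i → μ i = 0) →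
      ∑ i ∈ Finset.range n, μ i ≤ d → μ ∈ P := by
    intro μ h1 h2 h3
    rw [hP, Finset.mem_filter, mem_seqBox]
    refine ⟨⟨fun i => ?_, h2⟩, h1, h3⟩
    by_cases hi : i < n
    · exact (Finset.single_le_sum (f := μ) (fun _ _ => Nat.zero_le _)
        (Finset.mem_range.mpr hi)).trans h3
    · rw [h2 i (not_lt.mp hi)]; exact Nat.zero_le _
  have propP : ∀ ν : P, (∀ i, ν.1 i ≤ d) ∧ (∀ i, n ≤ i → ν.1 i = 0) ∧ Antitone ν.1 ∧
      ∑ i ∈ Finset.range n, ν.1 i ≤ d := by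
    intro ν
    have h := Finset.mem_filter.mp ν.2
    have h' := mem_seqBox.mp h.1
    exact ⟨h'.1, h'.2, h.2⟩
  let T : (P → K) →ₗ[K] MvPolynomial (Fin n) K :=
    Fintype.linearCombination K fun ν : P => interpPoly q a d n ν.1
  let co : MvPolynomial (Fin n) K →ₗ[K] (P → K) :=
    LinearMap.pi fun μ => lcoeff K (seqExponent n μ.1)
  have hTapply : ∀ c, T c = ∑ ν, c ν • interpPoly q a d n ν.1 := fun c => rfl
  have hTsymm : ∀ c, (T c).IsSymmetric := by
    intro c
    rw [hTapply]
    have : ∑ ν, c ν • interpPoly q a d n ν.1 ∈ symmetricSubalgebra (Fin n) K :=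
      Subalgebra.sum_mem _ fun ν _ => Subalgebra.smul_mem _
        (interpPoly_isSymmetric hg.qPoch_ne a n (propP ν).1) _
    exact this
  have hTdeg : ∀ c, (T c).totalDegree ≤ d := by
    intro c
    rw [hTapply]
    refine totalDegree_finsetSum_le fun ν _ => ?_
    exact (totalDegree_smul_le _ _).trans
      ((topPart_interpPoly q a d n ν.1).totalDegree_le.trans (propP ν).2.2.2)
  have co_zero : ∀ g : MvPolynomial (Fin n) K, g.IsSymmetric → g.totalDegree ≤ d → co g = 0 →
      g = 0 := by
    intro g hgs hgd hg0
    refine isSymmetric_eq_zero hgs fun μ h1 h2 => ?_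
    by_cases h3 : ∑ i ∈ Finset.range n, μ i ≤ d
    · exact congrFun hg0 ⟨μ, memP μ h1 h2 h3⟩
    · refine coeff_eq_zero_of_totalDegree_lt ?_
      change g.totalDegree < (seqExponent n μ).degree
      rw [degree_seqExponent]; omega
  have ev_zero : ∀ c, (∀ μ ∈ P, eval (seqPoint q a n μ) (T c) = 0) → c = 0 := by
    intro c hc
    by_contra hne
    obtain ⟨ν₁, hν₁⟩ := Function.ne_iff.mp hne
    -- Evaluate at the point of an index ν of least weight in the support of c. Another surviving
    -- term κ would satisfy κ ⊆ ν, and |κ| ≥ |ν| by minimality, so κ = ν.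
    obtain ⟨ν, hν, hmin⟩ := (Finset.univ.filter fun ν : P => c ν ≠ 0).exists_min_image
      (fun ν => ∑ i ∈ Finset.range n, ν.1 i) ⟨ν₁, by simpa using hν₁⟩
    have hcν : c ν ≠ 0 := (Finset.mem_filter.mp hν).2
    have h := hc ν.1 ν.2
    rw [hTapply, map_sum, Finset.sum_eq_single ν] at h
    · rw [smul_eval, eval_interpPoly] at h
      exact mul_ne_zero hcν (branchPoly_seqPoint_self_ne_zero hg d n ν.1 (propP ν).2.2.1
        (propP ν).1 (propP ν).2.1) h
    · intro κ _ hκ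
      rw [smul_eval, eval_interpPoly]
      by_contra h0
      have h1 := le_of_branchPoly_ne_zero q d n a ν.1 κ.1 (propP ν).2.2.1 (right_ne_zero_of_mul h0)
      have h2 := hmin κ (Finset.mem_filter.mpr ⟨Finset.mem_univ _, left_ne_zero_of_mul h0⟩)
      have h3 := (Finset.sum_eq_sum_iff_of_le (s := Finset.range n) (f := κ.1) (g := ν.1)
        (fun i hi => h1 i (Finset.mem_range.mp hi))).mp
        (le_antisymm (Finset.sum_le_sum fun i hi => h1 i (Finset.mem_range.mp hi)) h2)
      refine hκ (Subtype.ext (funext fun i => ?_))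
      by_cases hi : i < n
      · exact h3 i (Finset.mem_range.mpr hi)
      · rw [(propP κ).2.1 i (not_lt.mp hi), (propP ν).2.1 i (not_lt.mp hi)]
    · intro h; exact absurd (Finset.mem_univ _) h
  have hinj : Function.Injective (co ∘ₗ T) := by
    rw [← LinearMap.ker_eq_bot, LinearMap.ker_eq_bot']
    intro c hc
    refine ev_zero c fun μ _ => ?_
    rw [co_zero (T c) (hTsymm c) (hTdeg c) hc, map_zero]
  obtain ⟨c, hc⟩ := (LinearMap.injective_iff_surjective.mp hinj) (co f)
  have hfc : T c - f = 0 := by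
    refine co_zero _ ?_ ?_ (by rw [map_sub]; exact sub_eq_zero.mpr hc)
    · exact (symmetricSubalgebra (Fin n) K).sub_mem (hTsymm c) hf
    · exact (totalDegree_sub _ _).trans (max_le (hTdeg c) hd)
  have hfT := sub_eq_zero.mp hfc
  rw [← hfT, ev_zero c, map_zero]
  intro μ hμ
  have := propP ⟨μ, hμ⟩
  rw [hfT]
  exact hv μ this.2.2.1 this.2.1 this.2.2.2

end Uniqueness

/-! ### The value of an interpolation polynomial at its own point -/

section Value

variable {K : Type*} [Field K]

/-- The normalizing value of the interpolation polynomial, for a sequence. -/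
noncomputable def seqValue (q : K) (a : ℕ → K) (n : ℕ) (ν : ℕ → ℕ) : K :=
  (-1) ^ ν 0 * q ^ (((ν 0) ^ 2 - ν 0) / 2) * (∏ i ∈ Finset.range n, a (i + 1) ^ ν i)
    * ∏ i ∈ Finset.range n, ∏ j ∈ Finset.range n,
        qPoch q (q ^ ((ν (i + 1) : ℤ) - (ν i : ℤ)) * a (i + j + 2) / a (i + 1))
          (ν (i + j + 1) - ν (i + j + 2))

theorem shiftPow_eq_qPoch {q a x : K} (hx : x ≠ 0) (k : ℕ) :
    shiftPow q a x k = x ^ k * qPoch q (a / x) k := by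
  rw [← xPoch_eq q a x hx, xPoch_eq_shiftPow]; rfl

theorem shiftPow_self_top (q a : K) (d : ℕ) :
    shiftPow q a (a * q ^ d) d = (-1) ^ d * q ^ (d.choose 2) * a ^ d * qPoch q q d := by
  induction d with
  | zero => simp [shiftPow_zero, qPoch_zero]
  | succ d ih =>
    have h1 : shiftPow q a (a * q ^ (d + 1)) (d + 1)
        = (a * q ^ (d + 1) - a) * (q ^ d * shiftPow q a (a * q ^ d) d) := by
      simp only [shiftPow, Finset.prod_range_succ', Algebra.algebraMap_self, RingHom.id_apply]
      have h2 : ∏ i ∈ Finset.range d, (a * q ^ (d + 1) - a * q ^ (i + 1))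
          = q ^ d * ∏ i ∈ Finset.range d, (a * q ^ d - a * q ^ i) := by
        have h3 : ∀ i ∈ Finset.range d, a * q ^ (d + 1) - a * q ^ (i + 1)
            = q * (a * q ^ d - a * q ^ i) := fun i _ => by ring
        rw [Finset.prod_congr rfl h3, Finset.prod_mul_distrib, Finset.prod_const,
          Finset.card_range]
      rw [h2]; ring
    rw [h1, ih, qPoch_self_succ, Nat.choose_succ_succ' d 1, Nat.choose_one_right]
    ring

theorem sq_sub_div_two (k : ℕ) : (k ^ 2 - k) / 2 = k.choose 2 := by
  rw [Nat.choose_two_right, Nat.mul_sub_one, sq]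

theorem choose_two_add (k l : ℕ) : (k + l).choose 2 = k.choose 2 + l.choose 2 + k * l := by
  induction l with
  | zero => simp
  | succ l ih =>
    rw [← add_assoc, Nat.choose_succ_succ' (k + l) 1, Nat.choose_succ_succ' l 1, ih,
      Nat.choose_one_right, Nat.choose_one_right]
    ring

theorem sum_range_sub_add_of_antitone {g : ℕ → ℕ} (hg : Antitone g) (m : ℕ) :
    ∑ s ∈ Finset.range m, (g s - g (s + 1)) + g m = g 0 := by
  induction m with
  | zero => simp
  | succ m ih =>
    have := hg (Nat.le_add_right m 1)
    rw [Finset.sum_range_succ]; omega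

theorem tailSeq_antitone {ν : ℕ → ℕ} (hν : Antitone ν) : Antitone (tailSeq ν) :=
  fun _ _ hij => hν (Nat.succ_le_succ hij)

/-- The factors with i = 0 belong to the removed row. In the other rows the last column j = m is
empty because ν vanishes there, which restores the shape of the product for m. -/
theorem seqValue_succ {q : K} {a : ℕ → K} (m : ℕ) (ν : ℕ → ℕ)
    (hm : ∀ i, m + 1 ≤ i → ν i = 0) (d : ℕ) (hd : ν 0 = ν 1 + d) :
    seqValue q a (m + 1) ν = (-1) ^ d * q ^ (d.choose 2) * q ^ (ν 1 * d) * a 1 ^ ν 0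
      * (∏ s ∈ Finset.range m, qPoch q (a (s + 2) / (a 1 * q ^ d)) (ν (s + 1) - ν (s + 2)))
      * seqValue q (tailSeq a) m (tailSeq ν) := by
  have e1 : q ^ ((ν 1 : ℤ) - (ν 0 : ℤ)) = (q ^ d)⁻¹ := by
    rw [hd, ← zpow_natCast, ← zpow_neg]; congr 1; push_cast; ring
  have inner : ∀ i ∈ Finset.range m, (∏ j ∈ Finset.range (m + 1),
        qPoch q (q ^ ((ν (i + 1 + 1) : ℤ) - (ν (i + 1) : ℤ)) * a (i + 1 + j + 2) / a (i + 1 + 1))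
          (ν (i + 1 + j + 1) - ν (i + 1 + j + 2)))
      = ∏ j ∈ Finset.range m,
        qPoch q (q ^ ((ν (i + 1 + 1) : ℤ) - (ν (i + 1) : ℤ)) * a (i + j + 2 + 1) / a (i + 1 + 1))
          (ν (i + j + 1 + 1) - ν (i + j + 2 + 1)) := by
    intro i _
    rw [Finset.prod_range_succ, hm (i + 1 + m + 1) (by omega), Nat.zero_sub, qPoch_zero, mul_one]
    refine Finset.prod_congr rfl fun j _ => ?_
    rw [show i + 1 + j + 2 = i + j + 2 + 1 by ring, show i + 1 + j + 1 = i + j + 1 + 1 by ring]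
  have outer : (∏ j ∈ Finset.range (m + 1),
        qPoch q (q ^ ((ν 1 : ℤ) - (ν 0 : ℤ)) * a (j + 2) / a 1) (ν (j + 1) - ν (j + 2)))
      = ∏ s ∈ Finset.range m, qPoch q (a (s + 2) / (a 1 * q ^ d)) (ν (s + 1) - ν (s + 2)) := by
    rw [Finset.prod_range_succ, hm (m + 1) le_rfl, Nat.zero_sub, qPoch_zero, mul_one]
    refine Finset.prod_congr rfl fun j _ => ?_
    rw [e1]
    congr 1
    rw [div_eq_mul_inv, div_eq_mul_inv, mul_inv]; ring
  have h2 := Finset.prod_range_succ' (fun i => ∏ j ∈ Finset.range (m + 1),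
    qPoch q (q ^ ((ν (i + 1) : ℤ) - (ν i : ℤ)) * a (i + j + 2) / a (i + 1))
          (ν (i + j + 1) - ν (i + j + 2))) m
  simp only [zero_add] at h2
  rw [Finset.prod_congr rfl inner, outer] at h2
  rw [seqValue, seqValue, h2, Finset.prod_range_succ' (fun i => a (i + 1) ^ ν i)]
  simp only [sq_sub_div_two, tailSeq_apply, zero_add, hd, choose_two_add, pow_add]
  ring

theorem branchPoly_seqPoint_self {q : K} {a : ℕ → K} (hg : GenericParams q a) (B m : ℕ)
    (ν : ℕ → ℕ) (hν : Antitone ν) (hB : ∀ i, ν i ≤ B) (hm : ∀ i, m ≤ i → ν i = 0) :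
    branchPoly q B m a (seqPoint q a m ν) ν = seqValue q a m ν := by
  induction m generalizing a ν with
  | zero => simp [branchPoly, seqValue, hm 0 le_rfl]
  | succ m ih =>
    obtain ⟨d, hd⟩ := Nat.exists_eq_add_of_le (hν (Nat.zero_le 1))
    rw [branchPoly_seqPoint_self_succ q B m a ν hν hB hm, rowWt_tailSeq hg.qPoch_ne m a _ ν hν,
      ih hg.tail _ (tailSeq_antitone hν) (fun i => hB _) (fun i hi => hm _ (Nat.succ_le_succ hi)),
      shiftPow_self_top, seqValue_succ m ν hm d hd]
    have ha := hg.a_ne 1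
    have hqd : q ^ d ≠ 0 := pow_ne_zero _ hg.q_ne
    have hx : a 1 * q ^ d ≠ 0 := mul_ne_zero ha hqd
    have e1 : ν 0 - ν 1 = d := by omega
    -- Writing each shifted power as x^k (a/x;q)_k with x = a₁q^d leaves powers of x whose exponents
    -- telescope to ν 1; they supply the factors a₁^{ν 1} and q^{ν 1 · d}.
    have tele : ∏ s ∈ Finset.range m, (a 1 * q ^ d) ^ (ν (s + 1) - ν (s + 2))
        = (a 1 * q ^ d) ^ ν 1 := by
      rw [Finset.prod_pow_eq_pow_sum]
      congr 1
      have := sum_range_sub_add_of_antitone (tailSeq_antitone hν) m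
      simp only [tailSeq_apply, hm (m + 1) le_rfl, add_zero, zero_add] at this
      exact this
    rw [e1]
    simp only [shiftPow_eq_qPoch hx, Finset.prod_mul_distrib, tele]
    simp only [Algebra.algebraMap_self, RingHom.id_apply]
    have := hg.qPoch_ne d
    rw [hd, mul_pow, ← pow_mul, pow_add (a 1), mul_comm d (ν 1)]
    field_simp

end Value

/-! ### Partitions and sequences -/

namespace Partn

theorem length_le_iff (μ : Partn) (n : ℕ) : μ.length ≤ n ↔ ∀ i, n ≤ i → μ i = 0 := by
  have hsupp : ∀ k, μ k ≠ 0 → Finset.range (k + 1) ⊆ μ.parts.support := by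
    intro k hk i hi
    have := μ.antitone (Nat.lt_succ_iff.mp (Finset.mem_range.mp hi))
    rw [Finsupp.mem_support_iff]
    exact fun h => hk (Nat.le_zero.mp (h ▸ this))
  constructor
  · intro h i hi
    by_contra hne
    have := Finset.card_le_card (hsupp i hne)
    rw [Finset.card_range] at this
    exact absurd (this.trans h) (by omega)
  · intro h
    have : μ.parts.support ⊆ Finset.range n := by
      intro i hi
      rw [Finset.mem_range]
      by_contra hni
      exact (Finsupp.mem_support_iff.mp hi) (h i (not_lt.mp hni))
    exact (Finset.card_le_card this).trans (Finset.card_range n).le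

theorem eq_zero_of_length_le {μ : Partn} {n i : ℕ} (h : μ.length ≤ n) (hi : n ≤ i) : μ i = 0 :=
  (μ.length_le_iff n).mp h i hi

theorem weight_eq_sum {μ : Partn} {n : ℕ} (h : μ.length ≤ n) :
    μ.weight = ∑ i ∈ Finset.range n, μ i := by
  refine Finset.sum_subset ?_ fun i _ hi => by simpa using hi
  intro i hi
  rw [Finset.mem_range]
  by_contra hni
  exact (Finsupp.mem_support_iff.mp hi) (eq_zero_of_length_le h (not_lt.mp hni))

theorem coe_injective : Function.Injective (fun μ : Partn => (μ : ℕ → ℕ)) := by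
  intro μ ν h
  ext i
  exact congrFun h i

/-- The partition with given parts. -/
noncomputable def ofSeq (f : ℕ → ℕ) (hf : Antitone f) (n : ℕ) (hn : ∀ i, n ≤ i → f i = 0) : Partn where
  parts := Finsupp.onFinset (Finset.range n) f fun i hi => by
    rw [Finset.mem_range]; by_contra h; exact hi (hn i (not_lt.mp h))
  antitone := hf

theorem length_ofSeq_le (f : ℕ → ℕ) (hf : Antitone f) (n : ℕ) (hn : ∀ i, n ≤ i → f i = 0) :
    (ofSeq f hf n hn).length ≤ n := (length_le_iff _ _).mpr hn

theorem sum_diff_add (μ : Partn) (r : ℕ) : ∑ i ∈ Finset.range r, μ.diff i + μ r = μ 0 :=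
  sum_range_sub_add_of_antitone μ.antitone r

theorem sum_diff_cast (μ : Partn) (r : ℕ) :
    ∑ i ∈ Finset.range r, (μ.diff i : ℤ) = (μ 0 : ℤ) - μ r := by
  have := μ.sum_diff_add r
  rw [← this]; push_cast; ring

theorem length_empty : empty.length = 0 := by simp [length, empty]

theorem length_le_zero_iff (μ : Partn) : μ.length ≤ 0 ↔ μ = empty := by
  rw [length_le_iff]
  constructor
  · intro h; ext i; exact h i (Nat.zero_le i)
  · rintro rfl i _; rfl

end Partn

/-! ### The spin `q`-Whittaker polynomials as sums over sequences -/

section SpinBranching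

variable {K : Type*} [Field K] {R : Type*} [CommRing R] [Algebra K R]

noncomputable def spinHeadWt (q a : K) (x : R) (b : K) (n₀ k₀ : ℕ) : R :=
  if k₀ ≤ n₀ then algebraMap K R (b⁻¹ ^ (n₀ - k₀) / qPoch q q (n₀ - k₀)) * xPoch q a x (n₀ - k₀)
  else 0

noncomputable def spinEdgeWt (q a : K) (x : R) (b : K) (k₀ n₁ k₁ : ℕ) : R :=
  if k₁ ≤ n₁ ∧ n₁ ≤ k₀ then
    algebraMap K R (b⁻¹ ^ (n₁ - k₁) / qPoch q (a / b) (k₀ - k₁) * qBinom q (k₀ - k₁) (n₁ - k₁))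
      * xPoch q a x (n₁ - k₁)
      * ∏ s ∈ Finset.range (k₀ - k₁ - (n₁ - k₁)), (1 - algebraMap K R (b⁻¹ * q ^ s) * x)
  else 0

noncomputable def spinRowWt (q : K) (m : ℕ) (a b : ℕ → K) (x : R) (ν κ : ℕ → ℕ) : R :=
  spinHeadWt q (a 1) x (b 0) (ν 0) (κ 0) * ∏ s ∈ Finset.range m,
    spinEdgeWt q (a (s + 2)) x (b (s + 1)) (κ s) (ν (s + 1)) (κ (s + 1))

noncomputable def spinBranchPoly (q : K) (b : ℕ → K) (B : ℕ) :
    (m : ℕ) → (ℕ → K) → (Fin m → R) → (ℕ → ℕ) → R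
  | 0, _, _, _ => 1
  | m + 1, a, x, ν => ∑ κ ∈ seqBox B m,
      spinRowWt q m a b (x 0) ν κ * spinBranchPoly q b B m (tailSeq a) (fun i => x i.succ) κ

theorem spinRowWt_ne_zero {q : K} {m : ℕ} {a b : ℕ → K} {x : R} {ν κ : ℕ → ℕ}
    (h : spinRowWt q m a b x ν κ ≠ 0) :
    (∀ i ≤ m, κ i ≤ ν i) ∧ ∀ i < m, ν (i + 1) ≤ κ i := by
  have h0 : κ 0 ≤ ν 0 := by
    by_contra hne
    exact left_ne_zero_of_mul h (if_neg hne)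
  have h1 : ∀ i < m, κ (i + 1) ≤ ν (i + 1) ∧ ν (i + 1) ≤ κ i := by
    intro i hi
    by_contra hne
    exact right_ne_zero_of_mul h (Finset.prod_eq_zero (Finset.mem_range.mpr hi) (if_neg hne))
  refine ⟨fun i hi => ?_, fun i hi => (h1 i hi).2⟩
  cases i with
  | zero => exact h0
  | succ i => exact (h1 i hi).1

theorem vertexW_eq_spinEdgeWt (q a : K) (x : R) (b : K) {n₀ k₀ n₁ k₁ : ℕ} (h0 : k₀ ≤ n₀)
    (h1 : k₁ ≤ n₁) (hk : k₁ ≤ k₀) (hn : n₁ ≤ n₀) :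
    vertexW q a x b (n₀ - k₀) (k₀ - k₁) (n₀ - n₁) (n₁ - k₁) = spinEdgeWt q a x b k₀ n₁ k₁ := by
  unfold vertexW spinEdgeWt
  by_cases h : n₁ ≤ k₀
  · have hle : n₁ - k₁ ≤ k₀ - k₁ := by omega
    rw [if_pos ⟨by omega, by omega⟩, if_pos ⟨h1, h⟩, qBinom, if_pos hle]
  · rw [if_neg (by omega), if_neg (by omega)]

/-- The horizontal labels telescope to I + κ₀ - ν₀ + (ν_r - κ_r). The empty right boundary forces I
= ν₀ - κ₀, after which the label is ν_r - κ_r and the vertex condition J ≥ L is the interlacing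
ν_{s+1} ≤ κ_s. -/
theorem opB_eq_spinRowWt (q : K) (hq : ∀ n, qPoch q q n ≠ 0) (a b : ℕ → K) (x : R) (ν κ : Partn)
    {m : ℕ} (hν : ν.length ≤ m + 1) (hκ : κ.length ≤ m) :
    opB q a b x ν κ = spinRowWt q m a b x ν κ := by
  classical
  set N := κ.length + 1 with hN
  have hκN : ∀ i, κ.length ≤ i → κ i = 0 := fun i hi => Partn.eq_zero_of_length_le le_rfl hi
  have edge : ∀ I r : ℕ, (I : ℤ) + ∑ i ∈ Finset.range r, (κ.diff i : ℤ)
      - ∑ i ∈ Finset.range r, (ν.diff i : ℤ) = I + κ 0 - ν 0 + (ν r - κ r) := by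
    intro I r
    rw [Partn.sum_diff_cast, Partn.sum_diff_cast]; ring
  -- the value of the row operator when the outer partition is short enough
  have row : ∀ I : ℕ, ν.length ≤ N → opT q a b x I ν κ =
      if I + κ 0 = ν 0 ∧ ∀ r ≤ N, κ r ≤ ν r then
        ∏ s ∈ Finset.range N, spinEdgeWt q (a (s + 2)) x (b (s + 1)) (κ s) (ν (s + 1)) (κ (s + 1))
      else 0 := by
    intro I hlen
    have hνN : ν N = 0 := Partn.eq_zero_of_length_le hlen le_rfl
    rw [opT, if_pos hlen, rowT]
    simp only [edge]
    have hcond : ((∀ r ≤ κ.length + 1, (0 : ℤ) ≤ I + κ 0 - ν 0 + (ν r - κ r)) ∧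
        (I : ℤ) + κ 0 - ν 0 + (ν (κ.length + 1) - κ (κ.length + 1)) = ((0 : ℕ) : ℤ))
        ↔ (I + κ 0 = ν 0 ∧ ∀ r ≤ N, κ r ≤ ν r) := by
      rw [← hN, hνN, hκN N (by omega)]
      constructor
      · rintro ⟨h1, h2⟩
        refine ⟨by omega, fun r hr => ?_⟩
        have := h1 r hr
        omega
      · rintro ⟨h1, h2⟩
        refine ⟨fun r hr => ?_, by omega⟩
        have := h2 r hr
        omega
    by_cases hc : I + κ 0 = ν 0 ∧ ∀ r ≤ N, κ r ≤ ν r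
    · rw [if_pos (hcond.mpr hc), if_pos hc]
      refine Finset.prod_congr rfl fun s hs => ?_
      have hs' := Finset.mem_range.mp hs
      have e : ∀ r, ((I : ℤ) + κ 0 - ν 0 + (ν r - κ r)).toNat = ν r - κ r := by
        intro r; omega
      rw [e, e]
      exact vertexW_eq_spinEdgeWt q _ x _ (hc.2 s (by omega)) (hc.2 (s + 1) (by omega))
        (κ.antitone (Nat.le_succ s)) (ν.antitone (Nat.le_succ s))
    · rw [if_neg (fun h => hc (hcond.mp h)), if_neg hc]
  by_cases hlen : ν.length ≤ N
  swap
  · have h1 : ∀ r : ℕ, opT q a b x r ν κ = 0 := fun r => if_neg hlen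
    have h2 : spinRowWt q m a b x ν κ = 0 := by
      by_contra hne
      have h := (spinRowWt_ne_zero hne).2
      refine hlen ((Partn.length_le_iff _ _).mpr fun i hi => ?_)
      by_cases him : i ≤ m
      · have := h (i - 1) (by omega)
        rw [hκN (i - 1) (by omega), show i - 1 + 1 = i by omega] at this
        exact Nat.le_zero.mp this
      · exact Partn.eq_zero_of_length_le hν (by omega)
    rw [h2, opB]
    simp [h1]
  have hνN : ∀ i, N ≤ i → ν i = 0 := fun i hi => Partn.eq_zero_of_length_le hlen hi
  by_cases h0 : κ 0 ≤ ν 0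
  swap
  · have h1 : ∀ r : ℕ, opT q a b x r ν κ = 0 := fun r => by
      rw [row r hlen, if_neg (by omega)]
    rw [opB, spinRowWt, spinHeadWt, if_neg h0, zero_mul]
    simp [h1]
  rw [opB, finsum_eq_single _ (ν 0 - κ 0)]
  · rw [row _ hlen, spinRowWt, spinHeadWt, if_pos h0]
    congr 1
    -- the weight of a vertex outside the diagrams
    have triv : ∀ s, κ.length ≤ s →
        spinEdgeWt q (a (s + 2)) x (b (s + 1)) (κ s) (ν (s + 1)) (κ (s + 1)) = 1 := by
      intro s hs
      rw [hκN s hs, hκN (s + 1) (by omega), hνN (s + 1) (by omega)]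
      simp [spinEdgeWt, qBinom_zero_right hq, qPoch_zero, xPoch]
    have hprod : ∀ M, κ.length ≤ M →
        ∏ s ∈ Finset.range M, spinEdgeWt q (a (s + 2)) x (b (s + 1)) (κ s) (ν (s + 1)) (κ (s + 1))
        = ∏ s ∈ Finset.range κ.length,
          spinEdgeWt q (a (s + 2)) x (b (s + 1)) (κ s) (ν (s + 1)) (κ (s + 1)) := by
      intro M hM
      refine (Finset.prod_subset (Finset.range_mono hM) fun s _ hs => triv s ?_).symm
      simpa using hs
    rw [hprod N (by omega), hprod m hκ]
    split_ifs with hc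
    · rfl
    -- A negative label in row r makes the edge weight with s = r - 1 vanish; r ≠ 0 because κ 0 ≤ ν
    -- 0.
    · have : ∃ r ≤ N, ν r < κ r := by
        by_contra hne
        push Not at hne
        exact hc ⟨by omega, hne⟩
      obtain ⟨r, hr, hlt⟩ := this
      symm
      obtain ⟨s, rfl⟩ : ∃ s, r = s + 1 := ⟨r - 1, by
        have : r ≠ 0 := by rintro rfl; omega
        omega⟩
      refine Finset.prod_eq_zero (i := s) (Finset.mem_range.mpr ?_) (if_neg (by omega))
      by_contra hs
      rw [hκN (s + 1) (by omega)] at hlt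
      omega
  · intro r hr
    rw [row r hlen, if_neg (by omega), mul_zero]

/-- Each row operator lengthens a partition by at most one part. -/
theorem spinWhittaker_eq_zero (q : K) (b : ℕ → K) (m : ℕ) (a : ℕ → K) (x : Fin m → R) (ν : Partn)
    (hν : m < ν.length) : spinWhittaker q b m a x ν Partn.empty = 0 := by
  classical
  induction m generalizing a ν with
  | zero =>
    rw [spinWhittaker, if_neg]
    rintro rfl
    rw [Partn.length_empty] at hν
    omega
  | succ m ih =>
    rw [spinWhittaker]
    have : ∀ κ : Partn, opB q a b (x 0) ν κ *
        spinWhittaker q b m (fun i => a (i + 1)) (fun i => x i.succ) κ Partn.empty = 0 := by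
      intro κ
      by_cases h : m < κ.length
      · rw [ih _ _ κ h, mul_zero]
      · have h1 : ∀ r : ℕ, opT q a b (x 0) r ν κ = 0 := fun r => if_neg (by omega)
        simp [opB, h1]
    simp [this]

/-- A sequence with non-zero row weight interlaces with ν, hence decreases and is bounded by B. So
the sum over partitions and the sum over the box have the same non-zero terms. -/
theorem spinWhittaker_eq_spinBranchPoly (q : K) (hq : ∀ n, qPoch q q n ≠ 0) (b : ℕ → K) (B m : ℕ)
    (a : ℕ → K) (x : Fin m → R) (ν : Partn) (hν : ν.length ≤ m) (hB : ν 0 ≤ B) :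
    spinWhittaker q b m a x ν Partn.empty = spinBranchPoly q b B m a x ν := by
  classical
  induction m generalizing a ν with
  | zero =>
    rw [spinWhittaker, if_pos ((Partn.length_le_zero_iff ν).mp hν), spinBranchPoly]
  | succ m ih =>
    set H : (ℕ → ℕ) → R := fun f => if ∀ i, m ≤ i → f i = 0 then
      spinRowWt q m a b (x 0) ν f * spinBranchPoly q b B m (tailSeq a) (fun i => x i.succ) f
      else 0 with hH
    have hterm : ∀ κ : Partn, opB q a b (x 0) ν κ *
        spinWhittaker q b m (fun i => a (i + 1)) (fun i => x i.succ) κ Partn.empty = H κ := by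
      intro κ
      simp only [hH]
      by_cases h : κ.length ≤ m
      · rw [if_pos ((Partn.length_le_iff κ m).mp h), opB_eq_spinRowWt q hq a b (x 0) ν κ hν h]
        by_cases hr : spinRowWt q m a b (x 0) ν κ = 0
        · rw [hr, zero_mul, zero_mul]
        · rw [ih (fun i => a (i + 1)) _ κ h (((spinRowWt_ne_zero hr).1 0 (Nat.zero_le _)).trans hB)]
          rfl
      · rw [if_neg (fun h' => h ((Partn.length_le_iff κ m).mpr h')),
          spinWhittaker_eq_zero _ _ _ _ _ _ (not_le.mp h), mul_zero]
    rw [spinWhittaker, finsum_congr hterm, spinBranchPoly]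
    have hsum : ∑ κ ∈ seqBox B m, spinRowWt q m a b (x 0) ν κ *
        spinBranchPoly q b B m (tailSeq a) (fun i => x i.succ) κ = ∑ κ ∈ seqBox B m, H κ :=
      Finset.sum_congr rfl fun κ hκ => (if_pos (mem_seqBox.mp hκ).2).symm
    rw [hsum, ← finsum_mem_range Partn.coe_injective]
    refine finsum_mem_eq_sum_of_inter_support_eq _ (Set.ext fun f => ?_)
    simp only [Set.mem_inter_iff, Set.mem_range, Finset.mem_coe, Function.mem_support]
    refine and_congr_left fun hne => ?_
    simp only [hH] at hne
    have hz : ∀ i, m ≤ i → f i = 0 := by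
      by_contra hc; exact hne (if_neg hc)
    rw [if_pos hz] at hne
    have hi := spinRowWt_ne_zero (left_ne_zero_of_mul hne)
    constructor
    · intro _
      refine mem_seqBox.mpr ⟨fun i => ?_, hz⟩
      by_cases him : i ≤ m
      · exact (hi.1 i him).trans ((ν.antitone (Nat.zero_le i)).trans hB)
      · rw [hz i (by omega)]; exact Nat.zero_le _
    · intro _
      have hanti : Antitone f := antitone_nat_of_succ_le fun i => by
        by_cases him : i < m
        · exact (hi.1 (i + 1) him).trans (hi.2 i him)
        · rw [hz (i + 1) (by omega)]; exact Nat.zero_le _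
      exact ⟨Partn.ofSeq f hanti m hz, rfl⟩

end SpinBranching

/-! ### The degeneration -/

section Regular

variable {k : Type*} [Field k]

/-- The evaluation at `b₀⁻¹ = b₁⁻¹ = ⋯ = 0`. -/
noncomputable def evalZero : MvPolynomial ℕ k →+* k := eval fun _ => 0

/-- The rational function `f` is regular at `b₀⁻¹ = b₁⁻¹ = ⋯ = 0`, with value `c`. -/
def RegVal (f : WithB k) (c : k) : Prop :=
  ∃ N D : MvPolynomial ℕ k, evalZero D ≠ 0 ∧
    f * algebraMap _ (WithB k) D = algebraMap _ (WithB k) N ∧ c * evalZero D = evalZero N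

theorem algebraMap_withB_injective :
    Function.Injective (algebraMap (MvPolynomial ℕ k) (WithB k)) :=
  IsFractionRing.injective _ _

namespace RegVal

theorem mul {f g : WithB k} {c d : k} (hf : RegVal f c) (hg : RegVal g d) :
    RegVal (f * g) (c * d) := by
  obtain ⟨N, D, h1, h2, h3⟩ := hf
  obtain ⟨N', D', h1', h2', h3'⟩ := hg
  refine ⟨N * N', D * D', by rw [map_mul]; exact mul_ne_zero h1 h1', ?_, ?_⟩
  · rw [map_mul, map_mul, ← h2, ← h2']; ring
  · rw [map_mul, map_mul, ← h3, ← h3']; ring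

theorem add {f g : WithB k} {c d : k} (hf : RegVal f c) (hg : RegVal g d) :
    RegVal (f + g) (c + d) := by
  obtain ⟨N, D, h1, h2, h3⟩ := hf
  obtain ⟨N', D', h1', h2', h3'⟩ := hg
  refine ⟨N * D' + N' * D, D * D', by rw [map_mul]; exact mul_ne_zero h1 h1', ?_, ?_⟩
  · rw [map_mul, map_add, map_mul, map_mul, ← h2, ← h2']; ring
  · rw [map_mul, map_add, map_mul, map_mul, ← h3, ← h3']; ring

theorem sub {f g : WithB k} {c d : k} (hf : RegVal f c) (hg : RegVal g d) :
    RegVal (f - g) (c - d) := by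
  obtain ⟨N, D, h1, h2, h3⟩ := hf
  obtain ⟨N', D', h1', h2', h3'⟩ := hg
  refine ⟨N * D' - N' * D, D * D', by rw [map_mul]; exact mul_ne_zero h1 h1', ?_, ?_⟩
  · rw [map_mul, map_sub, map_mul, map_mul, ← h2, ← h2']; ring
  · rw [map_mul, map_sub, map_mul, map_mul, ← h3, ← h3']; ring

theorem zero : RegVal (0 : WithB k) 0 :=
  ⟨0, 1, by rw [map_one]; exact one_ne_zero, by rw [zero_mul, map_zero],
    by rw [zero_mul, map_zero]⟩

theorem one : RegVal (1 : WithB k) 1 :=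
  ⟨1, 1, by rw [map_one]; exact one_ne_zero, by rw [one_mul], by rw [one_mul]⟩

theorem sum {ι : Type*} (s : Finset ι) {f : ι → WithB k} {c : ι → k}
    (h : ∀ i ∈ s, RegVal (f i) (c i)) : RegVal (∑ i ∈ s, f i) (∑ i ∈ s, c i) := by
  classical
  induction s using Finset.induction_on with
  | empty => rw [Finset.sum_empty, Finset.sum_empty]; exact zero
  | insert i s hi ih =>
    rw [Finset.sum_insert hi, Finset.sum_insert hi]
    exact (h i (Finset.mem_insert_self _ _)).add
      (ih fun j hj => h j (Finset.mem_insert_of_mem hj))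

theorem prod {ι : Type*} (s : Finset ι) {f : ι → WithB k} {c : ι → k}
    (h : ∀ i ∈ s, RegVal (f i) (c i)) : RegVal (∏ i ∈ s, f i) (∏ i ∈ s, c i) := by
  classical
  induction s using Finset.induction_on with
  | empty => rw [Finset.prod_empty, Finset.prod_empty]; exact one
  | insert i s hi ih =>
    rw [Finset.prod_insert hi, Finset.prod_insert hi]
    exact (h i (Finset.mem_insert_self _ _)).mul
      (ih fun j hj => h j (Finset.mem_insert_of_mem hj))

theorem inv {f : WithB k} {c : k} (h : RegVal f c) (hc : c ≠ 0) : RegVal f⁻¹ c⁻¹ := by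
  obtain ⟨N, D, h1, h2, h3⟩ := h
  have hN : evalZero N ≠ 0 := h3 ▸ mul_ne_zero hc h1
  refine ⟨D, N, hN, ?_, ?_⟩
  · have hf : f ≠ 0 := by
      rintro rfl
      rw [zero_mul] at h2
      have : N = 0 := algebraMap_withB_injective (by rw [← h2, map_zero])
      exact hN (by rw [this, map_zero])
    rw [← h2, inv_mul_cancel_left₀ hf]
  · rw [← h3, inv_mul_cancel_left₀ hc]

theorem constB (c : k) : RegVal (constB c) c := by
  refine ⟨C c, 1, by rw [map_one]; exact one_ne_zero, ?_, ?_⟩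
  · rw [map_one, mul_one]; rfl
  · rw [map_one, mul_one, evalZero, eval_C]

theorem bVar_inv (i : ℕ) : RegVal (bVar i)⁻¹ (0 : k) := by
  refine ⟨X i, 1, by rw [map_one]; exact one_ne_zero, ?_, ?_⟩
  · rw [map_one, mul_one, bVar, inv_inv]
  · rw [map_one, mul_one, evalZero, eval_X]

theorem unique {f : WithB k} {c d : k} (hc : RegVal f c) (hd : RegVal f d) : c = d := by
  obtain ⟨N, D, h1, h2, h3⟩ := hc
  obtain ⟨N', D', h1', h2', h3'⟩ := hd
  have h : N * D' = N' * D := algebraMap_withB_injective (by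
    rw [map_mul, map_mul, ← h2, ← h2']; ring)
  have h' := congrArg evalZero h
  rw [map_mul, map_mul, ← h3, ← h3'] at h'
  exact mul_right_cancel₀ (mul_ne_zero h1 h1') (by linear_combination h')

end RegVal

theorem bVar_ne_zero (i : ℕ) : (bVar i : WithB k) ≠ 0 := by
  refine inv_ne_zero fun h => ?_
  exact X_ne_zero i (algebraMap_withB_injective (h.trans (map_zero _).symm))

/-- The reduced denominator divides every denominator of f, so it is non-zero at the origin as soon
as one of them is. All such fractions then have the same value there. -/
theorem setBInfty_eq {f : WithB k} {c : k} (h : RegVal f c) : setBInfty f = c := by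
  refine RegVal.unique (f := f) ?_ h
  obtain ⟨N, D, h1, h2, h3⟩ := h
  set n := IsFractionRing.num (MvPolynomial ℕ k) f
  set d : MvPolynomial ℕ k := (IsFractionRing.den (MvPolynomial ℕ k) f : MvPolynomial ℕ k)
  have hd0 : algebraMap _ (WithB k) d ≠ 0 := by
    have := nonZeroDivisors.ne_zero (IsFractionRing.den (MvPolynomial ℕ k) f).2
    exact fun h => this (algebraMap_withB_injective (h.trans (map_zero _).symm))
  have hf : f * algebraMap _ (WithB k) d = algebraMap _ (WithB k) n := by
    have := IsFractionRing.mk'_num_den' (MvPolynomial ℕ k) f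
    exact (eq_div_iff hd0).mp this.symm
  have hcross : N * d = n * D := by
    refine algebraMap_withB_injective ?_
    rw [map_mul, map_mul, ← h2, ← hf]; ring
  have hdvd : d ∣ D :=
    (IsFractionRing.num_den_reduced (MvPolynomial ℕ k) f).symm.dvd_of_dvd_mul_left ⟨N, by
      rw [← hcross]; ring⟩
  have hd : evalZero d ≠ 0 := by
    obtain ⟨E, hE⟩ := hdvd
    intro h
    exact h1 (by rw [hE, map_mul, h, zero_mul])
  exact ⟨n, d, hd, hf, div_mul_cancel₀ _ hd⟩

/-- All coefficients of `P` are regular, and `P'` is the specialization of `P`. -/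
def RegPoly {σ : Type*} (P : MvPolynomial σ (WithB k)) (P' : MvPolynomial σ k) : Prop :=
  ∀ m, RegVal (coeff m P) (coeff m P')

variable {σ : Type*}

namespace RegPoly

theorem C {f : WithB k} {c : k} (h : RegVal f c) :
    RegPoly (C f : MvPolynomial σ (WithB k)) (C c) := by
  classical
  intro m
  rw [coeff_C, coeff_C]
  split_ifs
  · exact h
  · exact .zero

theorem X (i : σ) : RegPoly (X i : MvPolynomial σ (WithB k)) (X i) := by
  classical
  intro m
  rw [coeff_X, coeff_X]
  split_ifs
  · exact .one
  · exact .zero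

theorem zero : RegPoly (0 : MvPolynomial σ (WithB k)) 0 := fun _ => .zero

theorem one : RegPoly (1 : MvPolynomial σ (WithB k)) 1 := by
  have := RegPoly.C (σ := σ) (RegVal.one (k := k))
  rwa [MvPolynomial.C_1, MvPolynomial.C_1] at this

theorem mul {P Q : MvPolynomial σ (WithB k)} {P' Q' : MvPolynomial σ k}
    (h : RegPoly P P') (h' : RegPoly Q Q') : RegPoly (P * Q) (P' * Q') := by
  classical
  intro m
  rw [coeff_mul, coeff_mul]
  exact RegVal.sum _ fun p _ => (h p.1).mul (h' p.2)

theorem sub {P Q : MvPolynomial σ (WithB k)} {P' Q' : MvPolynomial σ k}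
    (h : RegPoly P P') (h' : RegPoly Q Q') : RegPoly (P - Q) (P' - Q') := fun m => by
  rw [coeff_sub, coeff_sub]; exact (h m).sub (h' m)

theorem sum {ι : Type*} (s : Finset ι) {P : ι → MvPolynomial σ (WithB k)}
    {P' : ι → MvPolynomial σ k} (h : ∀ i ∈ s, RegPoly (P i) (P' i)) :
    RegPoly (∑ i ∈ s, P i) (∑ i ∈ s, P' i) := fun m => by
  rw [coeff_sum, coeff_sum]; exact RegVal.sum s fun i hi => h i hi m

theorem prod {ι : Type*} (s : Finset ι) {P : ι → MvPolynomial σ (WithB k)}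
    {P' : ι → MvPolynomial σ k} (h : ∀ i ∈ s, RegPoly (P i) (P' i)) :
    RegPoly (∏ i ∈ s, P i) (∏ i ∈ s, P' i) := by
  classical
  induction s using Finset.induction_on with
  | empty => rw [Finset.prod_empty, Finset.prod_empty]; exact one
  | insert i s hi ih =>
    rw [Finset.prod_insert hi, Finset.prod_insert hi]
    exact (h i (Finset.mem_insert_self _ _)).mul
      (ih fun j hj => h j (Finset.mem_insert_of_mem hj))

end RegPoly

theorem qPoch_constB (q x : k) (n : ℕ) :
    qPoch (constB q) (constB x) n = (constB (qPoch q x n) : WithB k) := by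
  simp [qPoch, map_prod]

theorem qBinom_constB (q : k) (n l : ℕ) :
    qBinom (constB q) n l = (constB (qBinom q n l) : WithB k) := by
  unfold qBinom
  split_ifs
  · simp [qPoch_constB]
  · simp

theorem regPoly_xPoch (q a : k) (i : σ) (n : ℕ) :
    RegPoly (xPoch (constB q) (constB a) (X i : MvPolynomial σ (WithB k)) n)
      (shiftPow q (C a) (X i : MvPolynomial σ k) n) := by
  refine .prod _ fun s _ => (RegPoly.X i).sub ?_
  have := RegPoly.C (σ := σ) (RegVal.constB (a * q ^ s))
  simpa [MvPolynomial.algebraMap_eq] using this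

theorem regPoly_headWt (q a : k) (i : σ) (b n₀ k₀ : ℕ) :
    RegPoly (C (bVar b ^ (n₀ - k₀)) * spinHeadWt (constB q) (constB a) (X i) (bVar b) n₀ k₀)
      (headWt q (C a) (X i) n₀ k₀) := by
  unfold spinHeadWt headWt
  split_ifs with h
  · have h1 : C (bVar b ^ (n₀ - k₀)) * (algebraMap (WithB k) (MvPolynomial σ (WithB k))
        ((bVar b)⁻¹ ^ (n₀ - k₀) / qPoch (constB q) (constB q) (n₀ - k₀))
        * xPoch (constB q) (constB a) (X i) (n₀ - k₀))
        = C (constB (qPoch q q (n₀ - k₀))⁻¹) * xPoch (constB q) (constB a) (X i) (n₀ - k₀) := by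
      rw [MvPolynomial.algebraMap_eq, ← mul_assoc, ← C_mul, qPoch_constB, map_inv₀]
      congr 2
      rw [inv_pow, div_eq_mul_inv, mul_inv_cancel_left₀ (pow_ne_zero _ (bVar_ne_zero b))]
    rw [h1]
    exact (RegPoly.C (.constB _)).mul (regPoly_xPoch _ _ _ _)
  · rw [mul_zero]; exact .zero

theorem regVal_qPoch_div (q a : k) (b n : ℕ) :
    RegVal (qPoch (constB q) (constB a / bVar b) n)⁻¹ (1 : k) := by
  have h : RegVal (qPoch (constB q) (constB a / bVar b) n)
      (∏ i ∈ Finset.range n, (1 - a * 0 * q ^ i)) := by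
    refine RegVal.prod _ fun i _ => RegVal.one.sub ?_
    rw [div_eq_mul_inv, ← map_pow]
    exact ((RegVal.constB a).mul (.bVar_inv b)).mul (.constB _)
  have h1 : ∏ i ∈ Finset.range n, (1 - a * 0 * q ^ i) = 1 := by simp
  rw [h1] at h
  have := h.inv one_ne_zero
  rwa [inv_one] at this

/-- The prefactor cancels the negative powers of b in the weight; the denominator (a/b;q) and the
product of the factors 1 - xq^s/b both specialize to 1. -/
theorem regPoly_edgeWt (q a : k) (i : σ) (b k₀ n₁ k₁ : ℕ) :
    RegPoly (C (bVar b ^ (n₁ - k₁)) * spinEdgeWt (constB q) (constB a) (X i) (bVar b) k₀ n₁ k₁)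
      (edgeWt q (C a) (X i) k₀ n₁ k₁) := by
  unfold spinEdgeWt edgeWt
  split_ifs with h
  · set P := ∏ s ∈ Finset.range (k₀ - k₁ - (n₁ - k₁)),
      (1 - algebraMap (WithB k) (MvPolynomial σ (WithB k)) ((bVar b)⁻¹ * constB q ^ s) * X i)
    have hP : RegPoly P 1 := by
      have h3 : RegPoly P (∏ s ∈ Finset.range (k₀ - k₁ - (n₁ - k₁)),
          (1 - C (0 * q ^ s) * X i)) := by
        refine .prod _ fun s _ => RegPoly.one.sub (RegPoly.mul ?_ (.X i))
        rw [MvPolynomial.algebraMap_eq, ← map_pow]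
        exact .C ((RegVal.bVar_inv b).mul (.constB _))
      have h4 : ∏ s ∈ Finset.range (k₀ - k₁ - (n₁ - k₁)),
          (1 - C (0 * q ^ s) * X i : MvPolynomial σ k) = 1 := by simp
      rwa [h4] at h3
    have h1 : C (bVar b ^ (n₁ - k₁)) * (algebraMap (WithB k) (MvPolynomial σ (WithB k))
        ((bVar b)⁻¹ ^ (n₁ - k₁) / qPoch (constB q) (constB a / bVar b) (k₀ - k₁)
          * qBinom (constB q) (k₀ - k₁) (n₁ - k₁))
        * xPoch (constB q) (constB a) (X i) (n₁ - k₁) * P)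
        = C ((qPoch (constB q) (constB a / bVar b) (k₀ - k₁))⁻¹
          * constB (qBinom q (k₀ - k₁) (n₁ - k₁)))
          * xPoch (constB q) (constB a) (X i) (n₁ - k₁) * P := by
      rw [MvPolynomial.algebraMap_eq, ← mul_assoc, ← mul_assoc, ← C_mul, qBinom_constB]
      congr 3
      rw [inv_pow, div_eq_mul_inv, mul_assoc,
        mul_inv_cancel_left₀ (pow_ne_zero _ (bVar_ne_zero b))]
    rw [h1]
    have h2 := ((RegPoly.C (σ := σ) ((regVal_qPoch_div q a b (k₀ - k₁)).mul
      (.constB (qBinom q (k₀ - k₁) (n₁ - k₁))))).mul (regPoly_xPoch q a i (n₁ - k₁))).mul hP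
    rwa [one_mul, mul_one] at h2
  · rw [mul_zero]; exact .zero

theorem regPoly_rowWt (q : k) (m : ℕ) (a : ℕ → k) (i : σ) (ν κ : ℕ → ℕ) :
    RegPoly (C (∏ r ∈ Finset.range (m + 1), bVar r ^ (ν r - κ r))
        * spinRowWt (constB q) m (fun j => constB (a j)) bVar (X i) ν κ)
      (rowWt q m (fun j => C (a j)) (X i) ν κ) := by
  have h := (regPoly_headWt q (a 1) i 0 (ν 0) (κ 0)).mul
    (RegPoly.prod (Finset.range m) fun s _ =>
      regPoly_edgeWt q (a (s + 2)) i (s + 1) (κ s) (ν (s + 1)) (κ (s + 1)))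
  rw [Finset.prod_mul_distrib, ← map_prod, mul_mul_mul_comm, ← C_mul,
    mul_comm (bVar 0 ^ _), ← Finset.prod_range_succ' (fun r => bVar r ^ (ν r - κ r))] at h
  exact h

/-- The normalization is compatible with branching: for κ ⊆ ν the monomial of ν splits into the part
of ν/κ, which renormalizes the row, and the part of κ, which renormalizes the inner polynomial. -/
theorem regPoly_branchPoly (q : k) (B m : ℕ) (a : ℕ → k) (x : Fin m → σ) (ν : ℕ → ℕ) :
    RegPoly (C (∏ r ∈ Finset.range m, bVar r ^ ν r)
        * spinBranchPoly (constB q) bVar B m (fun j => constB (a j)) (fun i => X (x i)) ν)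
      (branchPoly q B m (fun j => C (a j)) (fun i => X (x i)) ν) := by
  induction m generalizing a ν with
  | zero =>
    rw [Finset.range_zero, Finset.prod_empty, C_1, one_mul]
    exact .one
  | succ m ih =>
    rw [spinBranchPoly, branchPoly, Finset.mul_sum]
    refine .sum _ fun κ hκ => ?_
    by_cases h : (∀ i ≤ m, κ i ≤ ν i) ∧ ∀ i < m, ν (i + 1) ≤ κ i
    · have h1 := (regPoly_rowWt q m a (x 0) ν κ).mul (ih (tailSeq a) (fun i => x i.succ) κ)
      have e : ∏ r ∈ Finset.range (m + 1), bVar r ^ ν r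
          = (∏ r ∈ Finset.range (m + 1), bVar r ^ (ν r - κ r))
            * ∏ r ∈ Finset.range m, (bVar r ^ κ r : WithB k) := by
        have : ∏ r ∈ Finset.range m, (bVar r ^ κ r : WithB k)
            = ∏ r ∈ Finset.range (m + 1), (bVar r ^ κ r : WithB k) := by
          rw [Finset.prod_range_succ, (mem_seqBox.mp hκ).2 m le_rfl, pow_zero, mul_one]
        rw [this, ← Finset.prod_mul_distrib]
        refine Finset.prod_congr rfl fun r hr => ?_
        rw [← pow_add, Nat.sub_add_cancel (h.1 r (Nat.lt_succ_iff.mp (Finset.mem_range.mp hr)))]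
      rw [mul_mul_mul_comm, ← C_mul, ← e] at h1
      exact h1
    · rw [rowWt_eq_zero _ _ _ h]
      have : spinRowWt (constB q) m (fun j => constB (a j)) bVar
          (X (x 0) : MvPolynomial σ (WithB k)) ν κ = 0 := by
        by_contra hne
        exact h (spinRowWt_ne_zero hne)
      rw [this, zero_mul, mul_zero, zero_mul]
      exact .zero

theorem interpWhittaker_eq (q : k) (hq : ∀ n, qPoch q q n ≠ 0) (a : ℕ → k) (B n : ℕ) (ν : Partn)
    (hν : ν.length ≤ n) (hB : ν 0 ≤ B) : interpWhittaker q a n ν = interpPoly q a B n ν := by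
  have hq' : ∀ n, qPoch (constB q) (constB q) n ≠ (0 : WithB k) := by
    intro n h
    rw [qPoch_constB, map_eq_zero] at h
    exact hq n h
  have hreg : RegPoly (renormSpinWhittaker q a n ν) (interpPoly q a B n ν) := by
    rw [renormSpinWhittaker, spinWhittaker_eq_spinBranchPoly _ hq' _ B n _ _ ν hν hB]
    exact regPoly_branchPoly q B n a id ν
  ext m
  rw [interpWhittaker, coeff_sum]
  simp only [coeff_monomial]
  rw [Finset.sum_ite_eq']
  split_ifs with h
  · exact setBInfty_eq (hreg m)
  · have h0 := hreg m
    rw [notMem_support_iff.mp h] at h0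
    exact RegVal.unique .zero h0

end Regular

/-- The kernels of the powers of f stabilize at some n. An element of ker f has the form f^n(y), so
y lies in ker f^{n+1} = ker f^n and the element is zero. -/
theorem injective_of_surjective_ringEnd {A : Type*} [CommRing A] [IsNoetherianRing A] (f : A →+* A)
    (hf : Function.Surjective f) : Function.Injective f := by
  let k : ℕ →o Ideal A :=
    { toFun := fun n => RingHom.ker (f ^ n)
      monotone' := monotone_nat_of_le_succ fun n x hx => by
        rw [RingHom.mem_ker] at hx ⊢
        rw [pow_succ', RingHom.mul_def, RingHom.comp_apply, hx, map_zero] }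
  obtain ⟨n, hn⟩ := monotone_stabilizes_iff_noetherian.mpr ‹IsNoetherianRing A› k
  have hs : Function.Surjective (f ^ n : A →+* A) := by
    rw [RingHom.coe_pow]; exact hf.iterate n
  rw [injective_iff_map_eq_zero]
  intro x hx
  obtain ⟨y, rfl⟩ := hs x
  have h1 : y ∈ k (n + 1) := by
    change y ∈ RingHom.ker (f ^ (n + 1))
    rw [RingHom.mem_ker, pow_succ', RingHom.mul_def, RingHom.comp_apply, hx]
  rw [← hn (n + 1) (Nat.le_succ n)] at h1
  exact RingHom.mem_ker.mp h1

/-! ### Restriction of symmetric functions to finitely many variables -/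

section Field

variable {K : Type*} [Field K]

/-- `f ↦ f(x_1, …, x_n)` as an algebra homomorphism. -/
noncomputable def inVarsHom (K : Type*) [Field K] (n : ℕ) : SymFun K →ₐ[K] MvPolynomial (Fin n) K :=
  aeval fun r : ℕ => psum (Fin n) K (r + 1)

theorem inVarsHom_apply (n : ℕ) (f : SymFun K) : inVarsHom K n f = f.inVars n := rfl

@[simp] theorem inVarsHom_X (n r : ℕ) : inVarsHom K n (X r) = psum (Fin n) K (r + 1) :=
  aeval_X _ _

theorem inVarsHom_isSymmetric (n : ℕ) (f : SymFun K) : (inVarsHom K n f).IsSymmetric := by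
  intro σ
  have : (rename σ : MvPolynomial (Fin n) K →ₐ[K] _).comp (inVarsHom K n) = inVarsHom K n := by
    ext r : 1
    simp only [AlgHom.comp_apply, inVarsHom_X]
    exact psum_isSymmetric _ _ _ σ
  exact DFunLike.congr_fun this f

/-- The degree of a power sum, as a weight on the generators of the ring of symmetric functions. -/
def psumWeight (r : ℕ) : ℕ := r + 1

theorem psum_isHomogeneous (n r : ℕ) : (psum (Fin n) K r).IsHomogeneous r := by
  refine IsHomogeneous.sum _ _ _ fun i _ => ?_
  simpa using (isHomogeneous_X K i).pow r

theorem inVarsHom_monomial_isHomogeneous (n : ℕ) (m : ℕ →₀ ℕ) (c : K) :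
    (inVarsHom K n (monomial m c)).IsHomogeneous (Finsupp.weight psumWeight m) := by
  rw [inVarsHom, aeval_monomial, Finsupp.weight_apply, Finsupp.prod, Finsupp.sum]
  refine IsHomogeneous.C_mul ?_ c
  refine IsHomogeneous.prod _ _ _ fun r _ => ?_
  rw [smul_eq_mul, mul_comm]
  exact (psum_isHomogeneous n (r + 1)).pow _

theorem homogeneousComponent_inVarsHom (n d : ℕ) (f : SymFun K) :
    homogeneousComponent d (inVarsHom K n f) =
      inVarsHom K n (weightedHomogeneousComponent psumWeight d f) := by
  induction f using MvPolynomial.induction_on' with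
  | monomial m c =>
    rw [homogeneousComponent_of_mem (inVarsHom_monomial_isHomogeneous n m c),
      weightedHomogeneousComponent_of_mem (n := Finsupp.weight psumWeight m)
        (isWeightedHomogeneous_monomial _ _ _ rfl)]
    split_ifs <;> simp
  | add p q hp hq => simp only [map_add, hp, hq]

theorem IsWeightedHomogeneous.inVarsHom {d : ℕ} {f : SymFun K}
    (hf : IsWeightedHomogeneous psumWeight f d) (n : ℕ) : (inVarsHom K n f).IsHomogeneous d := by
  rw [← hf.weightedHomogeneousComponent_same, ← homogeneousComponent_inVarsHom]
  exact homogeneousComponent_isHomogeneous _ _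

/-- Setting the first variable to zero. -/
noncomputable def dropFirst (K : Type*) [Field K] (n : ℕ) :
    MvPolynomial (Fin (n + 1)) K →ₐ[K] MvPolynomial (Fin n) K :=
  aeval (Fin.cons 0 X : Fin (n + 1) → MvPolynomial (Fin n) K)

theorem dropFirst_inVarsHom (n : ℕ) (f : SymFun K) :
    dropFirst K n (inVarsHom K (n + 1) f) = inVarsHom K n f := by
  have : (dropFirst K n).comp (inVarsHom K (n + 1)) = inVarsHom K n := by
    ext r : 1
    simp [dropFirst, psum, Fin.sum_univ_succ]
  exact DFunLike.congr_fun this f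

theorem coeff_dropFirst (n : ℕ) (f : MvPolynomial (Fin (n + 1)) K) (m : Fin n →₀ ℕ) :
    coeff m (dropFirst K n f) = coeff (m.cons 0) f := by
  have : (dropFirst K n).toRingHom =
      (Polynomial.constantCoeff).comp (finSuccEquiv K n : MvPolynomial (Fin (n + 1)) K →+* _) := by
    refine MvPolynomial.ringHom_ext (fun c => ?_) fun i => ?_
    · simp [dropFirst, finSuccEquiv_apply]
    · refine Fin.cases ?_ (fun j => ?_) i
      · simp [dropFirst, finSuccEquiv_X_zero]
      · simp [dropFirst, finSuccEquiv_X_succ]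
  rw [← finSuccEquiv_coeff_coeff]
  exact congrArg (coeff m) (DFunLike.congr_fun this f)

/-- `dropFirst` removes the first variable while the zero exponent is the last one; a cyclic
rotation, harmless for symmetric f, brings it to the front. -/
theorem coeff_seqExponent_succ {n : ℕ} {f : MvPolynomial (Fin (n + 1)) K} (hf : f.IsSymmetric)
    {μ : ℕ → ℕ} (hμ : μ n = 0) :
    coeff (seqExponent (n + 1) μ) f = coeff (seqExponent n μ) (dropFirst K n f) := by
  rw [coeff_dropFirst, ← coeff_equivMapDomain_of_isSymmetric hf (finRotate (n + 1))]
  congr 1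
  ext i
  rw [← Finsupp.equivMapDomain_eq_mapDomain, Finsupp.equivMapDomain_apply]
  refine Fin.cases ?_ (fun j => ?_) i
  · have : (finRotate (n + 1)).symm 0 = Fin.last n := by
      rw [Equiv.symm_apply_eq, finRotate_last]
    rw [this]
    simpa using hμ
  · have : (finRotate (n + 1)).symm j.succ = j.castSucc := by
      rw [Equiv.symm_apply_eq, finRotate_apply, Fin.coeSucc_eq_succ]
    rw [this]
    simp

theorem mCoeff_eq (μ : Partn) (f : SymFun K) {N : ℕ} (hN : μ.length ≤ N) :
    f.mCoeff μ = coeff (seqExponent N μ) (inVarsHom K N f) := by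
  induction N, hN using Nat.le_induction with
  | base => rfl
  | succ N hN ih =>
    rw [ih, coeff_seqExponent_succ (inVarsHom_isSymmetric _ _) (Partn.eq_zero_of_length_le hN le_rfl),
      dropFirst_inVarsHom]

theorem vars_subset_of_isWeightedHomogeneous {d : ℕ} {f : SymFun K}
    (hf : IsWeightedHomogeneous psumWeight f d) {n : ℕ} (hn : d ≤ n) :
    (f.vars : Set ℕ) ⊆ Set.range (Fin.val : Fin n → ℕ) := by
  intro r hr
  obtain ⟨m, hm, hrm⟩ := (mem_vars_iff_mem_support r).mp hr
  have h1 := hf (mem_support_iff.mp hm)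
  have h2 : psumWeight r ≤ Finsupp.weight psumWeight m :=
    Finsupp.le_weight_of_ne_zero' psumWeight (Finsupp.mem_support_iff.mp hrm)
  refine ⟨⟨r, ?_⟩, rfl⟩
  unfold psumWeight at h2
  unfold psumWeight at h1
  omega

end Field

/-! ### Power sums generate the symmetric polynomials and are independent -/

section CharZero

variable {K : Type*} [Field K] [CharZero K]

/-- Newton's identity expresses k·e_k through p₁, …, p_k and smaller elementary polynomials; the
division by k needs characteristic zero. For k ≤ n only p₁, …, p_n occur. -/
theorem exists_inVarsHom_eq_esymm (n k : ℕ) (hk : k ≤ n) :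
    ∃ g : MvPolynomial (Fin n) K, inVarsHom K n (rename Fin.val g) = esymm (Fin n) K k := by
  induction k using Nat.strong_induction_on with
  | _ k ih =>
    rcases Nat.eq_zero_or_pos k with rfl | hpos
    · exact ⟨1, by simp⟩
    have key := mul_esymm_eq_sum (Fin n) K k
    choose! g hg using ih
    refine ⟨C ((k : K)⁻¹) * ((-1) ^ (k + 1) *
      ∑ a ∈ (Finset.HasAntidiagonal.antidiagonal k).attach.filter (fun a => a.1.1 < k), (-1) ^ a.1.1 * g a.1.1 *
        (if h : a.1.2 - 1 < n then X ⟨a.1.2 - 1, h⟩ else 0)), ?_⟩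
    have hk0 : (k : K) ≠ 0 := Nat.cast_ne_zero.mpr hpos.ne'
    have hC : (C ((k : K)⁻¹) : MvPolynomial (Fin n) K) * (k : MvPolynomial (Fin n) K) = 1 := by
      rw [← map_natCast (C : K →+* MvPolynomial (Fin n) K) k, ← C_mul, inv_mul_cancel₀ hk0, C_1]
    have he : esymm (Fin n) K k = C ((k : K)⁻¹) * ((k : MvPolynomial (Fin n) K) * esymm (Fin n) K k) := by
      rw [← mul_assoc, hC, one_mul]
    rw [he, key]
    simp only [map_mul, map_pow, map_neg, map_one, map_sum, algHom_C, algebraMap_eq]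
    congr 2
    rw [Finset.sum_filter, Finset.sum_filter, ← Finset.sum_attach (Finset.HasAntidiagonal.antidiagonal k)]
    refine Finset.sum_congr rfl fun a _ => ?_
    split_ifs with h1 h2
    · have ha := Finset.HasAntidiagonal.mem_antidiagonal.mp a.2
      rw [hg _ h1 (by omega), rename_X, inVarsHom_X]
      simp only
      congr 2
      omega
    · have ha := Finset.HasAntidiagonal.mem_antidiagonal.mp a.2
      omega
    · rfl

theorem exists_inVarsHom_eq {n : ℕ} {f : MvPolynomial (Fin n) K} (hf : f.IsSymmetric) :
    ∃ g : MvPolynomial (Fin n) K, inVarsHom K n (rename Fin.val g) = f := by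
  choose! e he using fun k hk => exists_inVarsHom_eq_esymm (K := K) n k hk
  obtain ⟨p, hp⟩ := esymmAlgHom_surjective (σ := Fin n) K (Fintype.card_fin n).le ⟨f, hf⟩
  refine ⟨aeval (fun i : Fin n => e (i + 1)) p, ?_⟩
  have h1 : ((inVarsHom K n).comp (rename Fin.val)).comp (aeval fun i : Fin n => e (i + 1)) =
      (symmetricSubalgebra (Fin n) K).val.comp (esymmAlgHom (Fin n) K n) := by
    ext i : 1
    simp only [AlgHom.comp_apply, aeval_X]
    rw [he _ i.2, esymmAlgHom, aeval_X]
    rfl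
  have h2 := DFunLike.congr_fun h1 p
  simp only [AlgHom.comp_apply, hp] at h2
  exact h2

/-- Independence of p₁, …, p_n. They generate the symmetric polynomials, which form a polynomial
ring in n generators e₁, …, e_n; this gives a surjective endomorphism of a noetherian ring, and such
a map is injective. -/
theorem inVarsHom_rename_injective (n : ℕ) :
    Function.Injective fun g : MvPolynomial (Fin n) K => inVarsHom K n (rename Fin.val g) := by
  let φ : MvPolynomial (Fin n) K →ₐ[K] symmetricSubalgebra (Fin n) K :=
    ((inVarsHom K n).comp (rename Fin.val)).codRestrict _ fun g => inVarsHom_isSymmetric n _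
  have hφ : Function.Surjective φ := fun f => by
    obtain ⟨g, hg⟩ := exists_inVarsHom_eq f.2
    exact ⟨g, Subtype.ext hg⟩
  let E := esymmAlgEquiv (Fin n) K (Fintype.card_fin n)
  have h := injective_of_surjective_ringEnd (E.symm.toAlgHom.comp φ).toRingHom
    (E.symm.surjective.comp hφ)
  intro g g' hgg
  refine h ?_
  change E.symm (φ g) = E.symm (φ g')
  exact congrArg _ (Subtype.ext hgg)

theorem inVarsHom_eq_zero {d : ℕ} {f : SymFun K} (hf : IsWeightedHomogeneous psumWeight f d) {n : ℕ}
    (hn : d ≤ n) (h : inVarsHom K n f = 0) : f = 0 := by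
  obtain ⟨g, rfl⟩ := exists_rename_eq_of_vars_subset_range f _ Fin.val_injective
    (vars_subset_of_isWeightedHomogeneous hf hn)
  have : g = 0 := inVarsHom_rename_injective n (by simpa using h)
  rw [this, map_zero]

theorem eq_zero_of_inVarsHom {f : SymFun K} (N : ℕ) (h : ∀ n, N ≤ n → inVarsHom K n f = 0) :
    f = 0 := by
  rw [← finsum_weightedHomogeneousComponent psumWeight f]
  refine finsum_eq_zero_of_forall_eq_zero fun d => ?_
  refine inVarsHom_eq_zero (weightedHomogeneousComponent_isWeightedHomogeneous d f)
    (le_max_left d N) ?_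
  rw [← homogeneousComponent_inVarsHom, h _ (le_max_right _ _), map_zero]

/-- A stable family of homogeneous symmetric polynomials comes from a symmetric function. -/
theorem exists_symFun_of_stable {d N : ℕ} {F : (n : ℕ) → MvPolynomial (Fin n) K}
    (hs : ∀ n, (F n).IsSymmetric) (hh : ∀ n, N ≤ n → (F n).IsHomogeneous d)
    (hF : ∀ n, N ≤ n → dropFirst K n (F (n + 1)) = F n) :
    ∃ g : SymFun K, IsWeightedHomogeneous psumWeight g d ∧ ∀ n, N ≤ n → inVarsHom K n g = F n := by
  have lift : ∀ n, N ≤ n → ∃ g : SymFun K, IsWeightedHomogeneous psumWeight g d ∧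
      inVarsHom K n g = F n := by
    intro n hn
    obtain ⟨g, hg⟩ := exists_inVarsHom_eq (hs n)
    refine ⟨_, weightedHomogeneousComponent_isWeightedHomogeneous d (rename Fin.val g), ?_⟩
    rw [← homogeneousComponent_inVarsHom, hg, homogeneousComponent_of_mem (hh n hn), if_pos rfl]
  have down : ∀ (g : SymFun K) (n M : ℕ), N ≤ n → n ≤ M → inVarsHom K M g = F M →
      inVarsHom K n g = F n := by
    intro g n M hn hM
    induction M, hM using Nat.le_induction with
    | base => exact id
    | succ M hM ih =>
      intro h
      refine ih ?_
      rw [← dropFirst_inVarsHom, h, hF M (hn.trans hM)]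
  -- At least d variables determine a function of weight d. A lift at this level therefore serves
  -- all others: below it by dropping variables, above it by uniqueness.
  obtain ⟨g, hg, hgM⟩ := lift (max d N) (le_max_right _ _)
  refine ⟨g, hg, fun n hn => ?_⟩
  rcases le_total n (max d N) with h | h
  · exact down g n _ hn h hgM
  · obtain ⟨g', hg', hgn⟩ := lift n hn
    have : g' - g = 0 := by
      refine inVarsHom_eq_zero (hg'.sub hg) (le_max_left d N) ?_
      rw [map_sub, hgM, down g' _ n (le_max_right _ _) h hgn, sub_self]
    rw [← sub_eq_zero.mp this, hgn]

end CharZero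

/-! ### Vertical strips -/

section VerticalStrips

variable {K : Type*} [Field K] {R : Type*} [CommRing R] [Algebra K R]

/-- The local factor of the coefficient of a vertical strip `ν / μ`. -/
noncomputable def vertEdge (q : K) (n₀ m₀ n₁ m₁ : ℕ) : K :=
  if m₁ = n₁ then 1
  else if m₁ + 1 = n₁ then (if m₀ = n₀ then 1 - q ^ (n₀ + 1 - n₁) else 1) else 0

/-- The coefficient of a vertical strip `ν / μ` in the rows `0, …, m`. -/
noncomputable def vertCoeff (q : K) (m : ℕ) (ν μ : ℕ → ℕ) : K :=
  (if μ 0 = ν 0 ∨ μ 0 + 1 = ν 0 then 1 else 0) *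
    ∏ s ∈ Finset.range m, vertEdge q (ν s) (μ s) (ν (s + 1)) (μ (s + 1))

theorem vertEdge_ne_zero {q : K} {n₀ m₀ n₁ m₁ : ℕ} (h : vertEdge q n₀ m₀ n₁ m₁ ≠ 0) :
    m₁ = n₁ ∨ m₁ + 1 = n₁ := by
  unfold vertEdge at h
  split_ifs at h <;> tauto

theorem vertCoeff_ne_zero {q : K} {m : ℕ} {ν μ : ℕ → ℕ} (h : vertCoeff q m ν μ ≠ 0) {i : ℕ}
    (hi : i ≤ m) : μ i = ν i ∨ μ i + 1 = ν i := by
  cases i with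
  | zero =>
    by_contra h0
    exact left_ne_zero_of_mul h (if_neg h0)
  | succ i =>
    exact vertEdge_ne_zero (Finset.prod_ne_zero_iff.mp (right_ne_zero_of_mul h) i
      (Finset.mem_range.mpr hi))

theorem mul_headWt_pred {q : K} (hq : ∀ n, qPoch q q n ≠ 0) (x : R) (d k : ℕ) :
    x * headWt q 0 x d k = (1 - algebraMap K R q ^ (d + 1 - k)) * headWt q 0 x (d + 1) k := by
  unfold headWt
  rcases lt_trichotomy k (d + 1) with h | rfl | h
  · obtain ⟨l, rfl⟩ := Nat.exists_eq_add_of_le (Nat.lt_succ_iff.mp h)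
    rw [if_pos (by omega), if_pos (by omega), show k + l - k = l by omega,
      show k + l + 1 - k = l + 1 by omega, shiftPow_zero_left, shiftPow_zero_left]
    have e : (qPoch q q l)⁻¹ = (1 - q ^ (l + 1)) * (qPoch q q (l + 1))⁻¹ := by
      have h1 := hq (l + 1)
      rw [qPoch_self_succ] at h1 ⊢
      field_simp [left_ne_zero_of_mul h1, right_ne_zero_of_mul h1]
    rw [e, map_mul, map_sub, map_one, map_pow]
    ring
  · simp
  · rw [if_neg (by omega), if_neg (by omega)]; simp

theorem qBin_succ_mul {q : K} (hq : ∀ n, qPoch q q n ≠ 0) (j l : ℕ) (h : l < j) :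
    qBin R q j (l + 1) * (1 - algebraMap K R q ^ (l + 1)) =
      qBin R q j l * (1 - algebraMap K R q ^ (j - l)) := by
  obtain ⟨i, rfl⟩ := Nat.exists_eq_add_of_lt h
  have e : qBinom q (l + i + 1) (l + 1) * (1 - q ^ (l + 1)) =
      qBinom q (l + i + 1) l * (1 - q ^ (i + 1)) := by
    have e1 : qBinom q (l + i + 1) (l + 1) = qBinom q (l + 1 + i) (l + 1) := by congr 1; omega
    rw [e1, qBinom_add, show l + i + 1 = l + (i + 1) by omega, qBinom_add,
      show l + 1 + i = l + (i + 1) by omega]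
    have h1 := hq (l + 1)
    have h2 := hq (i + 1)
    rw [qPoch_self_succ] at h1 h2 ⊢
    rw [qPoch_self_succ q i]
    field_simp [left_ne_zero_of_mul h1, right_ne_zero_of_mul h1, left_ne_zero_of_mul h2,
      right_ne_zero_of_mul h2]
  rw [show l + i + 1 - l = i + 1 by omega]
  have := congrArg (algebraMap K R) e
  simpa [qBin] using this

theorem mul_edgeWt_pred {q : K} (hq : ∀ n, qPoch q q n ≠ 0) (x : R) (k₀ d k₁ : ℕ) :
    x * edgeWt q 0 x k₀ d k₁ * (1 - algebraMap K R q ^ (k₀ - d)) =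
      edgeWt q 0 x k₀ (d + 1) k₁ * (1 - algebraMap K R q ^ (d + 1 - k₁)) := by
  rcases lt_trichotomy k₁ (d + 1) with h | rfl | h
  · rcases lt_trichotomy d k₀ with h' | rfl | h'
    · rw [edgeWt, edgeWt, if_pos (by omega), if_pos (by omega), shiftPow_zero_left,
        shiftPow_zero_left, show d + 1 - k₁ = d - k₁ + 1 by omega]
      have := qBin_succ_mul (R := R) hq (k₀ - k₁) (d - k₁) (by omega)
      rw [show k₀ - k₁ - (d - k₁) = k₀ - d by omega] at this
      linear_combination (-x ^ (d - k₁ + 1)) * this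
    · simp [edgeWt]
    · rw [edgeWt, edgeWt, if_neg (by omega), if_neg (by omega)]; simp
  · rw [edgeWt, if_neg (by omega)]; simp
  · rw [edgeWt, edgeWt, if_neg (by omega), if_neg (by omega)]; simp

theorem edgeWt_zero_mul (q : K) (x : R) (k₀ n₁ k₁ : ℕ) :
    edgeWt q 0 (algebraMap K R q * x) k₀ n₁ k₁ =
      algebraMap K R q ^ (n₁ - k₁) * edgeWt q 0 x k₀ n₁ k₁ := by
  unfold edgeWt
  split_ifs
  · rw [shiftPow_zero_left, shiftPow_zero_left]; ring
  · simp

theorem headWt_zero_mul (q : K) (x : R) (n₀ k₀ : ℕ) :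
    headWt q 0 (algebraMap K R q * x) n₀ k₀ = algebraMap K R q ^ (n₀ - k₀) * headWt q 0 x n₀ k₀ := by
  unfold headWt
  split_ifs
  · rw [shiftPow_zero_left, shiftPow_zero_left]; ring
  · simp

/-- The sum over vertical strips with prescribed first entry `c`. -/
noncomputable def vertSum (q : K) (B m : ℕ) (x : R) (ν κ : ℕ → ℕ) (c : ℕ) : R :=
  ∑ μ ∈ seqBox B m,
    (∏ s ∈ Finset.range m, algebraMap K R
        (vertEdge q (ν s) (consSeq c μ s) (ν (s + 1)) (consSeq c μ (s + 1)))
          * (-x) ^ (ν (s + 1) - consSeq c μ (s + 1)))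
      * tailWt q m 0 x (consSeq c μ) κ

theorem vertSum_succ (q : K) (B m : ℕ) (x : R) (ν κ : ℕ → ℕ) (c : ℕ) :
    vertSum q B (m + 1) x ν κ c = ∑ d ∈ Finset.range (B + 1),
      algebraMap K R (vertEdge q (ν 0) c (ν 1) d) * (-x) ^ (ν 1 - d) *
        edgeWt q 0 x (κ 0) d (κ 1) * vertSum q B m x (tailSeq ν) (tailSeq κ) d := by
  rw [vertSum, sum_seqBox_succ]
  refine Finset.sum_congr rfl fun d _ => ?_
  rw [vertSum, Finset.mul_sum]
  refine Finset.sum_congr rfl fun μ _ => ?_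
  rw [tailWt_succ, Finset.prod_range_succ']
  have e : tailSeq (consSeq c (consSeq d μ)) = consSeq d μ := rfl
  rw [e]
  simp only [consSeq_succ, consSeq_zero, tailSeq_apply, Pi.zero_apply, zero_add]
  have e0 : tailSeq (0 : ℕ → R) = 0 := rfl
  rw [e0]
  ring

theorem sum_range_two {M : Type*} [AddCommMonoid M] {B d : ℕ} (hd : d + 1 ≤ B) {f : ℕ → M}
    (h : ∀ i, i ≠ d + 1 → i ≠ d → f i = 0) :
    ∑ i ∈ Finset.range (B + 1), f i = f (d + 1) + f d := by
  rw [← Finset.sum_subset (s₁ := {d + 1, d})]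
  · rw [Finset.sum_pair (by omega)]
  · intro i hi
    simp only [Finset.mem_insert, Finset.mem_singleton] at hi
    rw [Finset.mem_range]; omega
  · intro i _ hi
    simp only [Finset.mem_insert, Finset.mem_singleton, not_or] at hi
    exact h i hi.1 hi.2

/-- The sum depends on its prescribed entry c only through whether c = ν₀. The combination on the
left is what the head weights at ν₀ and ν₀ - 1 produce; it reproduces itself when one row is
removed, since `mul_edgeWt_pred` relates the two admissible edge weights. -/
theorem vertSum_sub {q : K} (hq : ∀ n, qPoch q q n ≠ 0) (B m : ℕ) (x : R) {ν κ : ℕ → ℕ}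
    (hν : Antitone ν) (hB : ∀ i, ν i ≤ B) (hκ : κ 0 ≤ ν 0) {c : ℕ} (hc : c ≠ ν 0) :
    vertSum q B m x ν κ (ν 0) - (1 - algebraMap K R q ^ (ν 0 - κ 0)) * vertSum q B m x ν κ c =
      algebraMap K R q ^ (ν 0 - κ 0) * tailWt q m 0 (algebraMap K R q * x) ν κ := by
  induction m generalizing ν κ c with
  | zero => simp [vertSum, tailWt, seqBox]
  | succ m ih =>
    have ih' := fun h c hc => ih (ν := tailSeq ν) (κ := tailSeq κ) (tailSeq_antitone hν)
      (fun i => hB _) h (c := c) hc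
    simp only [tailSeq_apply, zero_add] at ih'
    rw [tailWt_succ, vertSum_succ, vertSum_succ]
    have e0 : tailSeq (0 : ℕ → R) = 0 := rfl
    rw [e0, Pi.zero_apply, edgeWt_zero_mul]
    by_cases hk : κ 1 ≤ ν 1 ∧ ν 1 ≤ κ 0 + 1
    swap
    · have z : ∀ d, d = ν 1 ∨ d + 1 = ν 1 → edgeWt q 0 x (κ 0) d (κ 1) = 0 := fun d hd =>
        if_neg (by omega)
      rw [z _ (Or.inl rfl)]
      have z' : ∀ c, ∑ d ∈ Finset.range (B + 1),
          algebraMap K R (vertEdge q (ν 0) c (ν 1) d) * (-x) ^ (ν 1 - d) *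
          edgeWt q 0 x (κ 0) d (κ 1) * vertSum q B m x (tailSeq ν) (tailSeq κ) d = 0 := by
        intro c
        refine Finset.sum_eq_zero fun d _ => ?_
        by_cases hd : vertEdge q (ν 0) c (ν 1) d = 0
        · rw [hd]; simp
        · rw [z _ (vertEdge_ne_zero hd)]; simp
      rw [z', z']
      simp
    obtain ⟨hk1, hk2⟩ := hk
    have hν10 : ν 1 ≤ ν 0 := hν (Nat.zero_le 1)
    rcases hν1 : ν 1 with _ | d
    · have hs : ∀ c, ∑ d ∈ Finset.range (B + 1),
          algebraMap K R (vertEdge q (ν 0) c 0 d) * (-x) ^ (0 - d) *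
          edgeWt q 0 x (κ 0) d (κ 1) * vertSum q B m x (tailSeq ν) (tailSeq κ) d =
          edgeWt q 0 x (κ 0) 0 (κ 1) * vertSum q B m x (tailSeq ν) (tailSeq κ) 0 := by
        intro c
        rw [Finset.sum_eq_single 0]
        · simp [vertEdge]
        · intro d _ hd
          simp [vertEdge, hd]
        · simp
      rw [hs, hs]
      -- As ν 1 = 0, the second term has coefficient 1 - q^0 = 0, and the entry 1 is just some value
      -- different from ν 1.
      have h1 := ih' hk1 1 (by omega)
      rw [hν1, Nat.zero_sub, pow_zero, sub_self, zero_mul, sub_zero, one_mul] at h1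
      rw [h1, Nat.zero_sub]
      ring
    · have hdB : d + 1 ≤ B := hν1 ▸ hB 1
      have hs : ∀ c, ∑ e ∈ Finset.range (B + 1),
          algebraMap K R (vertEdge q (ν 0) c (d + 1) e) * (-x) ^ (d + 1 - e) *
          edgeWt q 0 x (κ 0) e (κ 1) * vertSum q B m x (tailSeq ν) (tailSeq κ) e =
          edgeWt q 0 x (κ 0) (d + 1) (κ 1) * vertSum q B m x (tailSeq ν) (tailSeq κ) (d + 1) +
          algebraMap K R (if c = ν 0 then 1 - q ^ (ν 0 - d) else 1) * (-x) *
            edgeWt q 0 x (κ 0) d (κ 1) * vertSum q B m x (tailSeq ν) (tailSeq κ) d := by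
        intro c
        rw [sum_range_two hdB]
        · simp [vertEdge]
        · intro i h1 h2
          simp [vertEdge, h1, h2]
      rw [hs, hs, if_pos rfl, if_neg hc]
      have h1 := ih' hk1 d (by omega)
      rw [hν1] at h1
      have h2 := mul_edgeWt_pred hq x (κ 0) d (κ 1)
      have h3 : algebraMap K R q ^ (ν 0 - d) =
          algebraMap K R q ^ (ν 0 - κ 0) * algebraMap K R q ^ (κ 0 - d) := by
        rw [← pow_add]; congr 1; omega
      simp only [map_sub, map_one, map_pow, h3]
      linear_combination (algebraMap K R q ^ (ν 0 - κ 0) * edgeWt q 0 x (κ 0) (d + 1) (κ 1)) * h1 -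
        (algebraMap K R q ^ (ν 0 - κ 0) * vertSum q B m x (tailSeq ν) (tailSeq κ) d) * h2

/-- For κ₀ ≤ ν₀ only the first entries ν₀ and ν₀ - 1 occur. By `mul_headWt_pred` their head weights
differ by the factor 1 - q^{ν₀-κ₀}, so the sum is the combination evaluated in `vertSum_sub`. -/
theorem rowWt_vertical {q : K} (hq : ∀ n, qPoch q q n ≠ 0) (B m : ℕ) (x : R) {ν κ : ℕ → ℕ}
    (hν : Antitone ν) (hB : ∀ i, ν i ≤ B) :
    ∑ μ ∈ seqBox B (m + 1), algebraMap K R (vertCoeff q m ν μ) *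
        (-x) ^ (∑ i ∈ Finset.range (m + 1), (ν i - μ i)) * rowWt q m 0 x μ κ =
      rowWt q m 0 (algebraMap K R q * x) ν κ := by
  have hsum : ∑ μ ∈ seqBox B (m + 1), algebraMap K R (vertCoeff q m ν μ) *
        (-x) ^ (∑ i ∈ Finset.range (m + 1), (ν i - μ i)) * rowWt q m 0 x μ κ =
      ∑ c ∈ Finset.range (B + 1), algebraMap K R (if c = ν 0 ∨ c + 1 = ν 0 then 1 else 0) *
        (-x) ^ (ν 0 - c) * headWt q 0 x c (κ 0) * vertSum q B m x ν κ c := by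
    rw [sum_seqBox_succ]
    refine Finset.sum_congr rfl fun c _ => ?_
    rw [vertSum, Finset.mul_sum]
    refine Finset.sum_congr rfl fun μ _ => ?_
    rw [vertCoeff, map_mul, map_prod, Finset.sum_range_succ', pow_add, rowWt,
      Finset.prod_mul_distrib, Finset.prod_pow_eq_pow_sum]
    simp only [consSeq_zero, Pi.zero_apply]
    ring_nf
  rw [hsum, rowWt, Pi.zero_apply, headWt_zero_mul]
  by_cases hκ : κ 0 ≤ ν 0
  · rcases hν0 : ν 0 with _ | d
    · rw [Finset.sum_eq_single 0]
      · have h1 := vertSum_sub hq B m x hν hB hκ (c := 1) (by omega)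
        rw [hν0, Nat.zero_sub, pow_zero, sub_self, zero_mul, sub_zero, one_mul] at h1
        simp [h1]
      · intro c _ hc
        simp [hc]
      · simp
    · rw [sum_range_two (d := d) (hν0 ▸ hB 0)]
      · have h1 := vertSum_sub hq B m x hν hB hκ (c := d) (by omega)
        rw [hν0] at h1
        have h2 := mul_headWt_pred hq x d (κ 0)
        simp only [true_or, or_true, if_true, map_one, Nat.sub_self, pow_zero,
          Nat.add_sub_cancel_left, pow_one, one_mul]
        linear_combination (headWt q 0 x (d + 1) (κ 0)) * h1 - vertSum q B m x ν κ d * h2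
      · intro c h1 h2
        simp [h1, h2]
  · have z : ∀ c, c = ν 0 ∨ c + 1 = ν 0 → headWt q 0 x c (κ 0) = 0 := fun c hc =>
      if_neg (by omega)
    rw [z _ (Or.inl rfl), Finset.sum_eq_zero]
    · simp
    · intro c _
      split_ifs with hc
      · rw [z _ hc]; simp
      · simp

/-- Rescaling one variable by `q`, in terms of removing vertical strips. -/
theorem branchPoly_vertical {q : K} (hq : ∀ n, qPoch q q n ≠ 0) (B m : ℕ) (x : R) (y : Fin m → R)
    {ν : ℕ → ℕ} (hν : Antitone ν) (hB : ∀ i, ν i ≤ B) :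
    branchPoly q B (m + 1) 0 (Fin.cons (algebraMap K R q * x) y : Fin (m + 1) → R) ν =
      ∑ μ ∈ seqBox B (m + 1), algebraMap K R (vertCoeff q m ν μ) *
        (-x) ^ (∑ i ∈ Finset.range (m + 1), (ν i - μ i)) *
          branchPoly q B (m + 1) 0 (Fin.cons x y : Fin (m + 1) → R) μ := by
  simp only [branchPoly, Fin.cons_zero, Fin.cons_succ, Finset.mul_sum]
  rw [Finset.sum_comm]
  refine Finset.sum_congr rfl fun κ _ => ?_
  rw [← rowWt_vertical hq B m x hν hB, Finset.sum_mul]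
  refine Finset.sum_congr rfl fun μ _ => ?_
  ring

theorem seqBox_subset_succ (B m : ℕ) : seqBox B m ⊆ seqBox B (m + 1) := fun f hf =>
  mem_seqBox.mpr ⟨(mem_seqBox.mp hf).1, fun i hi => (mem_seqBox.mp hf).2 i (by omega)⟩

/-- Empty rows lose no box and carry the factor 1. This keeps the strip expansion independent of the
number of variables, as a lift to symmetric functions requires. -/
theorem sum_vertCoeff_stable {M : Type*} [AddCommMonoid M] [Module K M] (q : K) (B : ℕ) {ν : ℕ → ℕ}
    {m m' : ℕ} (hm : m ≤ m') (hν : ∀ i, m < i → ν i = 0) (F : (ℕ → ℕ) → M) :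
    ∑ μ ∈ seqBox B (m' + 1), vertCoeff q m' ν μ • F μ =
      ∑ μ ∈ seqBox B (m + 1), vertCoeff q m ν μ • F μ := by
  induction m', hm using Nat.le_induction with
  | base => rfl
  | succ k hk ih =>
    rw [← ih, ← Finset.sum_subset (seqBox_subset_succ B (k + 1))]
    · refine Finset.sum_congr rfl fun μ hμ => ?_
      have h0 : vertEdge q (ν k) (μ k) (ν (k + 1)) (μ (k + 1)) = 1 := by
        rw [hν (k + 1) (by omega), (mem_seqBox.mp hμ).2 (k + 1) le_rfl]; exact if_pos rfl
      rw [vertCoeff, Finset.prod_range_succ, h0, mul_one]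
      rfl
    · intro μ hμ hμ'
      rw [show vertCoeff q (k + 1) ν μ = 0 from ?_, zero_smul]
      by_contra hne
      refine hμ' (mem_seqBox.mpr ⟨(mem_seqBox.mp hμ).1, fun i hi => ?_⟩)
      rcases hi.eq_or_lt with rfl | hi
      · have := vertCoeff_ne_zero hne (i := k + 1) le_rfl
        rw [hν (k + 1) (by omega)] at this
        omega
      · exact (mem_seqBox.mp hμ).2 i hi

end VerticalStrips

/-! ### Dominance of exponents -/

section Dominance

variable {K : Type*} [Field K] {n : ℕ}

/-- The sum of the first `k` entries of an exponent. -/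
def prefixSum (m : Fin n →₀ ℕ) (k : ℕ) : ℕ := ∑ i : Fin n, if (i : ℕ) < k then m i else 0

theorem prefixSum_add (m m' : Fin n →₀ ℕ) (k : ℕ) :
    prefixSum (m + m') k = prefixSum m k + prefixSum m' k := by
  rw [prefixSum, prefixSum, prefixSum, ← Finset.sum_add_distrib]
  refine Finset.sum_congr rfl fun i _ => ?_
  split_ifs <;> simp

theorem prefixSum_seqExponent (μ : ℕ → ℕ) {k : ℕ} (hk : k ≤ n) :
    prefixSum (seqExponent n μ) k = ∑ i ∈ Finset.range k, μ i := by
  have e := Finset.sum_range (n := n) (fun i => if i < k then μ i else 0)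
  rw [prefixSum]
  simp only [seqExponent_apply]
  rw [← e, ← Finset.sum_filter]
  congr 1
  ext i
  simp only [Finset.mem_filter, Finset.mem_range]
  omega

theorem prefixSum_succ (m : Fin n →₀ ℕ) (i : Fin n) :
    prefixSum m (i + 1) = prefixSum m i + m i := by
  have : m i = ∑ j : Fin n, if j = i then m j else 0 := by simp
  rw [this, prefixSum, prefixSum, ← Finset.sum_add_distrib]
  refine Finset.sum_congr rfl fun j _ => ?_
  rcases lt_trichotomy j i with h | rfl | h
  · have h' : (j : ℕ) < i := h
    rw [if_pos (by omega), if_pos h', if_neg h.ne, add_zero]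
  · simp
  · have h' : (i : ℕ) < j := h
    rw [if_neg (by omega), if_neg (by omega), if_neg h.ne']

theorem eq_of_prefixSum_eq {m m' : Fin n →₀ ℕ} (h : ∀ k ≤ n, prefixSum m k = prefixSum m' k) :
    m = m' := by
  ext i
  have h1 := h (i + 1) i.2
  have h2 := h i i.2.le
  rw [prefixSum_succ, prefixSum_succ, h2] at h1
  omega

/-- All exponents of `F` are dominated by `w`. -/
def DomBy (F : MvPolynomial (Fin n) K) (w : ℕ → ℕ) : Prop :=
  ∀ m, coeff m F ≠ 0 → ∀ k ≤ n, prefixSum m k ≤ ∑ i ∈ Finset.range k, w i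

theorem DomBy.mono {F : MvPolynomial (Fin n) K} {w w' : ℕ → ℕ} (h : DomBy F w)
    (hw : ∀ k ≤ n, ∑ i ∈ Finset.range k, w i ≤ ∑ i ∈ Finset.range k, w' i) : DomBy F w' :=
  fun m hm k hk => (h m hm k hk).trans (hw k hk)

theorem DomBy.sum {ι : Type*} {s : Finset ι} {F : ι → MvPolynomial (Fin n) K} {w : ℕ → ℕ}
    (h : ∀ i ∈ s, DomBy (F i) w) : DomBy (∑ i ∈ s, F i) w := by
  intro m hm
  rw [coeff_sum] at hm
  obtain ⟨i, hi, hne⟩ := Finset.exists_ne_zero_of_sum_ne_zero hm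
  exact h i hi m hne

theorem DomBy.zero (w : ℕ → ℕ) : DomBy (0 : MvPolynomial (Fin n) K) w :=
  fun m hm => absurd (coeff_zero m) hm

theorem DomBy.one : DomBy (1 : MvPolynomial (Fin n) K) 0 := by
  classical
  intro m hm k _
  rw [coeff_one] at hm
  have : (0 : Fin n →₀ ℕ) = m := by by_contra h; exact hm (if_neg h)
  simp [← this, prefixSum]

theorem DomBy.mul {F G : MvPolynomial (Fin n) K} {w v : ℕ → ℕ} (hF : DomBy F w) (hG : DomBy G v) :
    DomBy (F * G) (w + v) := by
  classical
  intro m hm k hk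
  rw [coeff_mul] at hm
  obtain ⟨p, hp, hne⟩ := Finset.exists_ne_zero_of_sum_ne_zero hm
  rw [← Finset.HasAntidiagonal.mem_antidiagonal.mp hp, prefixSum_add]
  simp only [Pi.add_apply, Finset.sum_add_distrib]
  exact add_le_add (hF _ (left_ne_zero_of_mul hne) k hk) (hG _ (right_ne_zero_of_mul hne) k hk)

/-- If two dominated exponents add up to w + v, all their prefix sums attain the bounds, so the pair
is (w, v). -/
theorem DomBy.coeff_mul {F G : MvPolynomial (Fin n) K} {w v : ℕ → ℕ} (hF : DomBy F w)
    (hG : DomBy G v) : coeff (seqExponent n (w + v)) (F * G) =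
      coeff (seqExponent n w) F * coeff (seqExponent n v) G := by
  classical
  have hadd : seqExponent n (w + v) = seqExponent n w + seqExponent n v := by ext i; simp
  rw [MvPolynomial.coeff_mul, Finset.sum_eq_single (seqExponent n w, seqExponent n v)]
  · rintro ⟨m, m'⟩ hp hne
    by_contra hne0
    refine hne ?_
    have hp' := Finset.HasAntidiagonal.mem_antidiagonal.mp hp
    have key : ∀ k ≤ n, prefixSum m k = prefixSum (seqExponent n w) k ∧
        prefixSum m' k = prefixSum (seqExponent n v) k := by
      intro k hk
      have h1 := hF _ (left_ne_zero_of_mul hne0) k hk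
      have h2 := hG _ (right_ne_zero_of_mul hne0) k hk
      have h3 := congrArg (prefixSum · k) (hp'.trans hadd)
      simp only [prefixSum_add] at h3
      rw [← prefixSum_seqExponent w hk] at h1
      rw [← prefixSum_seqExponent v hk] at h2
      dsimp only at h1 h2
      omega
    rw [eq_of_prefixSum_eq fun k hk => (key k hk).1, eq_of_prefixSum_eq fun k hk => (key k hk).2]
  · intro h
    exact absurd (Finset.HasAntidiagonal.mem_antidiagonal.mpr hadd.symm) h

/-- The exponent of the leading monomial of an elementary symmetric polynomial. -/
def column (r i : ℕ) : ℕ := if i < r then 1 else 0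

theorem sum_range_column (r k : ℕ) : ∑ i ∈ Finset.range k, column r i = min k r := by
  induction k with
  | zero => simp
  | succ k ih => rw [Finset.sum_range_succ, ih, column]; split_ifs <;> omega

theorem sum_single_apply (t : Finset (Fin n)) (i : Fin n) :
    (∑ j ∈ t, Finsupp.single j 1 : Fin n →₀ ℕ) i = if i ∈ t then 1 else 0 := by
  classical
  rw [Finsupp.finsetSum_apply]
  simp [Finsupp.single_apply]

theorem domBy_esymm (r : ℕ) : DomBy (esymm (Fin n) K r) (column r) := by
  classical
  rw [esymm_eq_sum_monomial]
  refine DomBy.sum fun t ht m hm k hk => ?_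
  rw [coeff_monomial] at hm
  obtain rfl : _ = m := by by_contra h; exact hm (if_neg h)
  rw [sum_range_column, prefixSum]
  simp only [sum_single_apply]
  have e : ∀ i : Fin n, (if (i : ℕ) < k then if i ∈ t then 1 else 0 else 0) =
      if (i : ℕ) < k ∧ i ∈ t then 1 else 0 := fun i => by split_ifs <;> tauto
  simp only [e, Finset.sum_boole, Nat.cast_id]
  refine le_min ?_ ?_
  · calc _ ≤ ((Finset.univ : Finset (Fin n)).filter fun i : Fin n => (i : ℕ) < k).card :=
        Finset.card_le_card fun i hi => by
          simp only [Finset.mem_filter] at hi ⊢; exact ⟨hi.1, hi.2.1⟩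
      _ ≤ (Finset.range k).card := Finset.card_le_card_of_injOn Fin.val
          (fun i hi => by simpa using hi) Fin.val_injective.injOn
      _ = k := Finset.card_range k
  · rw [← (Finset.mem_powersetCard.mp ht).2]
    exact Finset.card_le_card fun i hi => (Finset.mem_filter.mp hi).2.2

theorem coeff_esymm_column {r : ℕ} (hr : r ≤ n) :
    coeff (seqExponent n (column r)) (esymm (Fin n) K r) = 1 := by
  classical
  rw [esymm_eq_sum_monomial, coeff_sum,
    Finset.sum_eq_single ((Finset.univ : Finset (Fin n)).filter fun i : Fin n => (i : ℕ) < r)]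
  · rw [coeff_monomial, if_pos]
    ext i
    rw [sum_single_apply]
    simp [column]
  · intro t _ hne
    rw [coeff_monomial, if_neg]
    intro h
    refine hne ?_
    ext i
    have := DFunLike.congr_fun h i
    rw [sum_single_apply, seqExponent_apply, column] at this
    simp only [Finset.mem_filter, Finset.mem_univ, true_and]
    split_ifs at this <;> simp_all
  · intro h
    refine absurd (Finset.mem_powersetCard.mpr ⟨Finset.subset_univ _, ?_⟩) h
    have : ((Finset.univ : Finset (Fin n)).filter fun i : Fin n => (i : ℕ) < r).map
        Fin.valEmbedding = Finset.range r := by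
      ext i
      simp only [Finset.mem_map, Finset.mem_filter, Finset.mem_univ, true_and,
        Fin.valEmbedding_apply, Finset.mem_range]
      constructor
      · rintro ⟨j, hj, rfl⟩; exact hj
      · intro hi; exact ⟨⟨i, by omega⟩, hi, rfl⟩
    rw [← Finset.card_map Fin.valEmbedding, this, Finset.card_range]

end Dominance

/-! ### Leading terms of the homogeneous branching polynomials -/

section LeadingTerm

variable {K : Type*} [Field K]

theorem rowWt_zero_eq {R : Type*} [CommRing R] [Algebra K R] (q : K) (m : ℕ) (x : R) (ν κ : ℕ → ℕ) :
    rowWt q m 0 x ν κ = algebraMap K R (rowWt q m 0 1 ν κ) *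
      x ^ ∑ i ∈ Finset.range (m + 1), (ν i - κ i) := by
  have h1 : ∀ n₀ k₀, headWt q 0 x n₀ k₀ = algebraMap K R (headWt q 0 1 n₀ k₀) * x ^ (n₀ - k₀) := by
    intro n₀ k₀
    unfold headWt
    split_ifs
    · simp [shiftPow_zero_left]
    · simp
  have h2 : ∀ k₀ n₁ k₁, edgeWt q 0 x k₀ n₁ k₁ =
      algebraMap K R (edgeWt q 0 1 k₀ n₁ k₁) * x ^ (n₁ - k₁) := by
    intro k₀ n₁ k₁
    unfold edgeWt
    split_ifs
    · simp [shiftPow_zero_left, qBin]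
    · simp
  rw [rowWt, rowWt, tailWt, tailWt, Finset.sum_range_succ', pow_add, map_mul, map_prod]
  simp only [Pi.zero_apply]
  rw [h1, Finset.prod_congr rfl fun s _ => h2 _ _ _, Finset.prod_mul_distrib,
    Finset.prod_pow_eq_pow_sum]
  ring

theorem interpPoly_zero_succ (q : K) (B n : ℕ) (ν : ℕ → ℕ) :
    interpPoly q 0 B (n + 1) ν = ∑ κ ∈ seqBox B n,
      (C (rowWt q n 0 1 ν κ) * X 0 ^ ∑ i ∈ Finset.range (n + 1), (ν i - κ i)) *
        rename Fin.succ (interpPoly q 0 B n κ) := by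
  have e0 : (fun i => C ((0 : ℕ → K) i)) = (0 : ℕ → MvPolynomial (Fin (n + 1)) K) := by
    funext i; simp
  rw [interpPoly, branchPoly, e0]
  refine Finset.sum_congr rfl fun κ _ => ?_
  rw [rowWt_zero_eq, algebraMap_eq, interpPoly, map_branchPoly]
  congr 2
  · funext i; simp
  · funext i; simp

theorem domBy_C_mul_X_pow (n d : ℕ) (c : K) :
    DomBy (C c * X 0 ^ d : MvPolynomial (Fin (n + 1)) K) (consSeq d 0) := by
  classical
  intro m hm k _
  rw [coeff_C_mul, coeff_X_pow] at hm
  obtain rfl : _ = m := by by_contra h; exact hm (by rw [if_neg h, mul_zero])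
  cases k with
  | zero => simp [prefixSum]
  | succ k =>
    rw [Finset.sum_range_succ', prefixSum, Fin.sum_univ_succ]
    simp

theorem coeff_C_mul_X_pow_consSeq (n d : ℕ) (c : K) :
    coeff (seqExponent (n + 1) (consSeq d 0)) (C c * X 0 ^ d : MvPolynomial (Fin (n + 1)) K) = c := by
  classical
  rw [coeff_C_mul, coeff_X_pow, if_pos, mul_one]
  ext i
  refine Fin.cases ?_ (fun j => ?_) i
  · simp
  · simp

theorem mapDomain_succ (n : ℕ) (m : Fin n →₀ ℕ) : m.mapDomain Fin.succ = m.cons 0 := by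
  ext i
  refine Fin.cases ?_ (fun j => ?_) i
  · rw [Finsupp.mapDomain_of_notMem_range]
    · simp
    · rintro ⟨j, hj⟩; exact Fin.succ_ne_zero j hj
  · rw [Finsupp.mapDomain_apply (Fin.succ_injective n)]
    simp

theorem DomBy.rename_succ {n : ℕ} {F : MvPolynomial (Fin n) K} {w : ℕ → ℕ} (h : DomBy F w) :
    DomBy (rename Fin.succ F) (consSeq 0 w) := by
  intro m hm k hk
  obtain ⟨m', rfl, hm'⟩ := coeff_rename_ne_zero _ _ _ hm
  cases k with
  | zero => simp [prefixSum]
  | succ k =>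
    rw [mapDomain_succ, prefixSum, Fin.sum_univ_succ, Finset.sum_range_succ']
    simpa [prefixSum] using h m' hm' k (by omega)

theorem coeff_rename_succ {n : ℕ} (F : MvPolynomial (Fin n) K) (w : ℕ → ℕ) :
    coeff (seqExponent (n + 1) (consSeq 0 w)) (rename Fin.succ F) = coeff (seqExponent n w) F := by
  have : seqExponent (n + 1) (consSeq 0 w) = (seqExponent n w).mapDomain Fin.succ := by
    rw [mapDomain_succ]
    ext i
    refine Fin.cases ?_ (fun j => ?_) i <;> simp
  rw [this, coeff_rename_mapDomain _ (Fin.succ_injective n)]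

theorem sum_consSeq_add (d k : ℕ) (κ : ℕ → ℕ) :
    ∑ i ∈ Finset.range (k + 1), (consSeq d 0 + consSeq 0 κ : ℕ → ℕ) i =
      d + ∑ i ∈ Finset.range k, κ i := by
  rw [Finset.sum_range_succ']
  simp [add_comm]

/-- Measures how far the exponent (|ν| - |κ|, κ₀, κ₁, …) falls short of ν in its first k + 1
entries. The defect is a sum of non-negative κ_i - ν_{i+1}: this gives domination, and shows that
the leading term comes only from κ equal to the tail of ν. -/
theorem sum_range_sub_add_eq {n : ℕ} {ν κ : ℕ → ℕ} (h1 : ∀ i ≤ n, κ i ≤ ν i)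
    (h2 : ∀ i < n, ν (i + 1) ≤ κ i) (hκ : κ n = 0) {k : ℕ} (hk : k ≤ n) :
    ∑ i ∈ Finset.range (n + 1), (ν i - κ i) + ∑ i ∈ Finset.range k, κ i +
      ∑ i ∈ Finset.Ico k n, (κ i - ν (i + 1)) = ∑ i ∈ Finset.range (k + 1), ν i := by
  induction n, hk using Nat.le_induction generalizing κ with
  | base =>
    have e : ∑ i ∈ Finset.range k, κ i = ∑ i ∈ Finset.range (k + 1), κ i := by
      rw [Finset.sum_range_succ, hκ, add_zero]
    rw [e, Finset.Ico_self, Finset.sum_empty, add_zero, ← Finset.sum_add_distrib]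
    exact Finset.sum_congr rfl fun i hi => Nat.sub_add_cancel
      (h1 i (Nat.lt_succ_iff.mp (Finset.mem_range.mp hi)))
  | succ n hk ih =>
    -- The induction hypothesis wants a zero at index n, so the entry κ n is cut off and accounted
    -- for separately.
    have ih' := ih (κ := fun i => if i < n then κ i else 0) (fun i hi => by
      split_ifs; exacts [h1 i (by omega), Nat.zero_le _]) (fun i hi => by
      rw [if_pos hi]; exact h2 i (by omega)) (if_neg (lt_irrefl n))
    rw [← ih', Finset.sum_range_succ, Finset.sum_range_succ, Finset.sum_Ico_succ_top hk,
      Finset.sum_range_succ _ n, hκ, if_neg (lt_irrefl n)]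
    have e1 : ∑ i ∈ Finset.range n, (ν i - if i < n then κ i else 0) =
        ∑ i ∈ Finset.range n, (ν i - κ i) := Finset.sum_congr rfl fun i hi => by
      rw [if_pos (Finset.mem_range.mp hi)]
    have e2 : ∑ i ∈ Finset.range k, (if i < n then κ i else 0) = ∑ i ∈ Finset.range k, κ i :=
      Finset.sum_congr rfl fun i hi => by
        have := Finset.mem_range.mp hi
        rw [if_pos (by omega)]
    have e3 : ∑ i ∈ Finset.Ico k n, ((if i < n then κ i else 0) - ν (i + 1)) =
        ∑ i ∈ Finset.Ico k n, (κ i - ν (i + 1)) := Finset.sum_congr rfl fun i hi => by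
      have := Finset.mem_Ico.mp hi
      rw [if_pos (by omega)]
    rw [e1, e2, e3]
    have := h1 n (by omega)
    have := h2 n (by omega)
    omega

theorem domBy_interpPoly (q : K) (B n : ℕ) (ν : ℕ → ℕ) : DomBy (interpPoly q 0 B n ν) ν := by
  induction n generalizing ν with
  | zero => exact DomBy.one.mono fun k hk => by simp
  | succ n ih =>
    rw [interpPoly_zero_succ]
    refine DomBy.sum fun κ hκ => ?_
    by_cases h0 : rowWt q n 0 (1 : K) ν κ = 0
    · rw [h0, C_0, zero_mul, zero_mul]; exact .zero _
    obtain ⟨h1, h2⟩ := rowWt_ne_zero h0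
    refine ((domBy_C_mul_X_pow _ _ _).mul (ih κ).rename_succ).mono fun k hk => ?_
    cases k with
    | zero => simp
    | succ k =>
      have h3 := sum_range_sub_add_eq h1 h2 ((mem_seqBox.mp hκ).2 n le_rfl) (k := k) (by omega)
      rw [sum_consSeq_add, ← h3]
      exact Nat.le_add_right _ _

/-- Only κ equal to the tail of ν reaches the leading exponent, and its row weight at a = 0, x = 1
is 1/(q;q)_{ν₀-ν₁}. -/
theorem coeff_interpPoly_self {q : K} (hq : ∀ n, qPoch q q n ≠ 0) (B n : ℕ) {ν : ℕ → ℕ}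
    (hν : Antitone ν) (hB : ∀ i, ν i ≤ B) (hn : ∀ i, n ≤ i → ν i = 0) :
    coeff (seqExponent n ν) (interpPoly q 0 B n ν) =
      (∏ i ∈ Finset.range n, qPoch q q (ν i - ν (i + 1)))⁻¹ := by
  induction n generalizing ν with
  | zero =>
    have : seqExponent 0 ν = 0 := Subsingleton.elim _ _
    simp [this, interpPoly, branchPoly]
  | succ n ih =>
    have htail : tailSeq ν ∈ seqBox B n :=
      mem_seqBox.mpr ⟨fun i => hB _, fun i hi => hn _ (by omega)⟩
    have hw : ∀ κ : ℕ → ℕ, (∑ i ∈ Finset.range (n + 1), (ν i - κ i)) = ν 0 → κ = tailSeq ν →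
        consSeq (∑ i ∈ Finset.range (n + 1), (ν i - κ i)) 0 + consSeq 0 κ = ν := by
      rintro κ h0 rfl
      funext i
      cases i with
      | zero => simpa using h0
      | succ i => simp
    rw [interpPoly_zero_succ, coeff_sum, Finset.sum_eq_single (tailSeq ν)]
    · have hd : ∑ i ∈ Finset.range (n + 1), (ν i - tailSeq ν i) = ν 0 := by
        have := sum_range_sub_add_of_antitone hν (n + 1)
        rw [hn (n + 1) le_rfl, add_zero] at this
        exact this
      have h := (domBy_C_mul_X_pow n (∑ i ∈ Finset.range (n + 1), (ν i - tailSeq ν i))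
        (rowWt q n 0 1 ν (tailSeq ν))).coeff_mul (domBy_interpPoly q B n (tailSeq ν)).rename_succ
      rw [hw _ hd rfl, coeff_C_mul_X_pow_consSeq, coeff_rename_succ,
        ih (tailSeq_antitone hν) (fun i => hB _) (fun i hi => hn _ (by omega))] at h
      rw [h, rowWt_tailSeq hq _ _ _ _ hν, Finset.prod_range_succ', mul_inv]
      simp [shiftPow_zero_left, mul_comm]
    · intro κ hκ hne
      by_contra h0
      have h00 : rowWt q n 0 (1 : K) ν κ ≠ 0 := by
        intro h; rw [h, C_0, zero_mul, zero_mul, coeff_zero] at h0; exact h0 rfl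
      obtain ⟨h1, h2⟩ := rowWt_ne_zero h00
      refine hne (funext fun i => ?_)
      rcases lt_or_ge i n with hi | hi
      · have h3 := ((domBy_C_mul_X_pow _ _ _).mul (domBy_interpPoly q B n κ).rename_succ) _ h0
          (i + 1) (by omega)
        rw [prefixSum_seqExponent _ (by omega), sum_consSeq_add] at h3
        have h4 := sum_range_sub_add_eq h1 h2 ((mem_seqBox.mp hκ).2 n le_rfl) (k := i) hi.le
        have h5 : κ i - ν (i + 1) ≤ ∑ j ∈ Finset.Ico i n, (κ j - ν (j + 1)) :=
          Finset.single_le_sum (f := fun j => κ j - ν (j + 1)) (fun _ _ => Nat.zero_le _)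
            (Finset.mem_Ico.mpr ⟨le_rfl, hi⟩)
        have h6 := h2 i hi
        rw [tailSeq_apply]
        omega
      · rw [(mem_seqBox.mp hκ).2 i hi, tailSeq_apply, hn _ (by omega)]
    · exact fun h => absurd htail h

end LeadingTerm

/-! ### The symmetric functions attached to the homogeneous branching polynomials -/

section SymQ

variable {K : Type*} [Field K]

/-- Interlacing with any κ forces ν to decrease. The strip sums range over all sequences, and
`vertCoeff` may be non-zero on a sequence that is not a partition; such terms disappear for this
reason. -/
theorem branchPoly_eq_zero_of_not_antitone {R : Type*} [CommRing R] [Algebra K R] (q : K) (B n : ℕ)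
    (a : ℕ → R) (x : Fin (n + 1) → R) {ν : ℕ → ℕ} (hn : ∀ i, n + 1 ≤ i → ν i = 0)
    (hν : ¬ Antitone ν) : branchPoly q B (n + 1) a x ν = 0 := by
  refine Finset.sum_eq_zero fun κ _ => ?_
  by_cases h0 : rowWt q n a (x 0) ν κ = 0
  · rw [h0, zero_mul]
  obtain ⟨h1, h2⟩ := rowWt_ne_zero h0
  refine absurd (antitone_nat_of_succ_le fun i => ?_) hν
  rcases lt_or_ge i n with hi | hi
  · exact (h2 i hi).trans (h1 i hi.le)
  · rw [hn (i + 1) (by omega)]; exact Nat.zero_le _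

/-- Setting the first variable to zero kills every κ smaller than ν; the term κ = ν has row weight
1. -/
theorem dropFirst_interpPoly {q : K} (hq : ∀ n, qPoch q q n ≠ 0) (B n : ℕ) {ν : ℕ → ℕ}
    (hν : Antitone ν) (hB : ∀ i, ν i ≤ B) (hn : ∀ i, n ≤ i → ν i = 0) :
    dropFirst K n (interpPoly q 0 B (n + 1) ν) = interpPoly q 0 B n ν := by
  rw [interpPoly_zero_succ, map_sum, Finset.sum_eq_single ν]
  · have h1 : rowWt q n 0 (1 : K) ν ν = 1 := by
      rw [rowWt, headWt, if_pos le_rfl, tailWt, Finset.prod_eq_one]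
      · simp [qPoch_zero, shiftPow_zero]
      · intro s _
        rw [edgeWt, if_pos ⟨le_rfl, hν (Nat.le_succ s)⟩]
        simp [qBin_zero_right hq, shiftPow_zero]
    have h2 : (dropFirst K n).comp (rename Fin.succ) = AlgHom.id K _ := by
      ext i : 1
      simp [dropFirst]
    have h3 := DFunLike.congr_fun h2 (interpPoly q 0 B n ν)
    rw [AlgHom.comp_apply, AlgHom.id_apply] at h3
    simp [h1, h3]
  · intro κ hκ hne
    by_cases h0 : rowWt q n 0 (1 : K) ν κ = 0
    · rw [h0, C_0, zero_mul, zero_mul, map_zero]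
    obtain ⟨h1, h2⟩ := rowWt_ne_zero h0
    have : ∑ i ∈ Finset.range (n + 1), (ν i - κ i) ≠ 0 := by
      intro hs
      refine hne (funext fun i => ?_)
      rcases lt_or_ge i n with hi | hi
      · have h3 := Finset.sum_eq_zero_iff.mp hs i (Finset.mem_range.mpr (by omega))
        have := h1 i hi.le
        omega
      · rw [hn i hi, (mem_seqBox.mp hκ).2 i hi]
    simp [dropFirst, this]
  · exact fun h => absurd (mem_seqBox.mpr ⟨hB, hn⟩) h

/-- `g` is a symmetric function with the restrictions `interpPoly q 0 B n ν`. -/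
def IsSymQ (q : K) (B : ℕ) (ν : ℕ → ℕ) (g : SymFun K) : Prop :=
  ∀ n, (∀ i, n ≤ i → ν i = 0) →
    IsWeightedHomogeneous psumWeight g (∑ i ∈ Finset.range n, ν i) ∧
      inVarsHom K n g = interpPoly q 0 B n ν

theorem sum_range_eq_of_le {ν : ℕ → ℕ} {m n : ℕ} (hmn : m ≤ n) (hm : ∀ i, m ≤ i → ν i = 0) :
    ∑ i ∈ Finset.range n, ν i = ∑ i ∈ Finset.range m, ν i := by
  refine (Finset.sum_subset (Finset.range_mono hmn) fun i _ hi => ?_).symm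
  exact hm i (by simpa using hi)

theorem exists_isSymQ [CharZero K] {q : K} (hq : ∀ n, qPoch q q n ≠ 0) (B : ℕ) {ν : ℕ → ℕ}
    (hν : Antitone ν) (hB : ∀ i, ν i ≤ B) {N : ℕ} (hN : ∀ i, N ≤ i → ν i = 0) :
    ∃ g, IsSymQ q B ν g := by
  classical
  -- `IsSymQ` speaks of every number of variables not below the length of ν, so the stable range has
  -- to start at the exact length.
  have hex : ∃ M, ν M = 0 := ⟨N, hN N le_rfl⟩
  have hM : ∀ i, Nat.find hex ≤ i → ν i = 0 := fun i hi =>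
    Nat.le_zero.mp ((hν hi).trans (Nat.find_spec hex).le)
  obtain ⟨g, hg, hg'⟩ := exists_symFun_of_stable (N := Nat.find hex)
    (d := ∑ i ∈ Finset.range (Nat.find hex), ν i) (F := fun n => interpPoly q 0 B n ν)
    (fun n => interpPoly_isSymmetric hq 0 n hB)
    (fun n hn => by
      rw [← sum_range_eq_of_le hn hM]
      exact (topPart_interpPoly q 0 B n ν).1)
    (fun n hn => dropFirst_interpPoly hq B n hν hB fun i hi => hM i (hn.trans hi))
  refine ⟨g, fun n hn => ?_⟩
  have hn' : Nat.find hex ≤ n := Nat.find_le (hn n le_rfl)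
  exact ⟨by rw [sum_range_eq_of_le hn' hM]; exact hg, hg' n hn'⟩

open Classical in
/-- The symmetric function with the restrictions `interpPoly q 0 B n ν`; it is `0` if `ν` is not a
partition. -/
noncomputable def symQ (q : K) (B : ℕ) (ν : ℕ → ℕ) : SymFun K :=
  if h : Antitone ν ∧ ∃ g, IsSymQ q B ν g then h.2.choose else 0

variable {q : K} {B N : ℕ} {ν : ℕ → ℕ}

theorem symQ_eq_zero (hν : ¬ Antitone ν) : symQ q B ν = 0 := dif_neg fun h => hν h.1

variable [CharZero K]

theorem isSymQ_symQ (hq : ∀ n, qPoch q q n ≠ 0) (h : ν ∈ seqBox B N) (hν : Antitone ν) :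
    IsSymQ q B ν (symQ q B ν) := by
  have hex : Antitone ν ∧ ∃ g, IsSymQ q B ν g :=
    ⟨hν, exists_isSymQ hq B hν (mem_seqBox.mp h).1 (mem_seqBox.mp h).2⟩
  rw [symQ, dif_pos hex]
  exact hex.2.choose_spec

theorem isWeightedHomogeneous_symQ (hq : ∀ n, qPoch q q n ≠ 0) (h : ν ∈ seqBox B N) :
    IsWeightedHomogeneous psumWeight (symQ q B ν) (∑ i ∈ Finset.range N, ν i) := by
  by_cases hν : Antitone ν
  · exact (isSymQ_symQ hq h hν N (mem_seqBox.mp h).2).1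
  · rw [symQ_eq_zero hν]; exact isWeightedHomogeneous_zero _ _ _

theorem inVarsHom_symQ (hq : ∀ n, qPoch q q n ≠ 0) {n : ℕ} (h : ν ∈ seqBox B (n + 1)) :
    inVarsHom K (n + 1) (symQ q B ν) = interpPoly q 0 B (n + 1) ν := by
  by_cases hν : Antitone ν
  · exact (isSymQ_symQ hq h hν (n + 1) (mem_seqBox.mp h).2).2
  · rw [symQ_eq_zero hν, map_zero, interpPoly,
      branchPoly_eq_zero_of_not_antitone _ _ _ _ _ (mem_seqBox.mp h).2 hν]

theorem symQ_zero (hq : ∀ n, qPoch q q n ≠ 0) (B : ℕ) : symQ q B 0 = 1 := by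
  have h0 : (0 : ℕ → ℕ) ∈ seqBox B 0 := mem_seqBox.mpr ⟨fun _ => Nat.zero_le _, fun _ _ => rfl⟩
  have h1 := (isSymQ_symQ hq h0 (fun _ _ _ => le_rfl) 0 fun _ _ => rfl)
  rw [← sub_eq_zero]
  refine inVarsHom_eq_zero (d := 0) (h1.1.sub (isWeightedHomogeneous_one K _)) le_rfl ?_
  rw [map_sub, h1.2, map_one, interpPoly, branchPoly, sub_self]

end SymQ

section Skewing

open scoped Polynomial

variable {K : Type*} [Field K]

/-! ### Plethystic shifts -/

/-- The substitution `p_k ↦ p_k + c_k u^k`. -/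
noncomputable def shiftHom (c : ℕ → K) : SymFun K →ₐ[K] (SymFun K)[X] :=
  aeval fun r => Polynomial.C (X r) + Polynomial.C (C (c (r + 1))) * Polynomial.X ^ (r + 1)

theorem shiftHom_X (c : ℕ → K) (r : ℕ) : shiftHom c (X r) =
    Polynomial.C (X r) + Polynomial.C (C (c (r + 1))) * Polynomial.X ^ (r + 1) := aeval_X _ _

/-- Shifts compose additively, so the shift by -1 undoes the adjunction of a variable u. -/
theorem eval₂_shiftHom (c d : ℕ → K) (f : SymFun K) :
    (shiftHom d f).eval₂ (shiftHom c : SymFun K →+* (SymFun K)[X]) Polynomial.X =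
      shiftHom (c + d) f := by
  have h : (Polynomial.eval₂RingHom (shiftHom c : SymFun K →+* (SymFun K)[X]) Polynomial.X).comp
      (shiftHom d : SymFun K →+* (SymFun K)[X]) = (shiftHom (c + d) : SymFun K →+* _) := by
    refine MvPolynomial.ringHom_ext (fun a => ?_) fun r => ?_
    · have : ∀ e : ℕ → K, shiftHom e (C a) = Polynomial.C (C a) := fun e =>
        (shiftHom e).commutes a
      simp [this]
    · have : ∀ a : K, shiftHom c (C a) = Polynomial.C (C a) := fun a => (shiftHom c).commutes a
      simp only [RingHom.comp_apply, RingHom.coe_coe, shiftHom_X, Polynomial.coe_eval₂RingHom,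
        Polynomial.eval₂_mul, Polynomial.eval₂_C, Polynomial.eval₂_X_pow,
        this, Pi.add_apply, map_add]
      ring
  exact DFunLike.congr_fun h f

theorem shiftHom_zero (f : SymFun K) : shiftHom 0 f = Polynomial.C f := by
  have : shiftHom (0 : ℕ → K) = (Polynomial.CAlgHom : SymFun K →ₐ[SymFun K] _).restrictScalars K := by
    ext r : 1
    rw [shiftHom_X]
    simp
  rw [this]
  rfl

/-- A new variable su adds s^k u^k to each p_k. -/
theorem map_shiftHom_pow (s : K) (n : ℕ) (f : SymFun K) :
    Polynomial.mapAlgHom (inVarsHom K n) (shiftHom (fun k => s ^ k) f) =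
      aeval (Fin.cons (algebraMap K _ s * Polynomial.X) fun i => Polynomial.C (X i) :
        Fin (n + 1) → (MvPolynomial (Fin n) K)[X]) (inVarsHom K (n + 1) f) := by
  have h : (Polynomial.mapAlgHom (inVarsHom K n)).comp (shiftHom fun k => s ^ k) =
      (aeval (Fin.cons (algebraMap K _ s * Polynomial.X) fun i => Polynomial.C (X i) :
        Fin (n + 1) → (MvPolynomial (Fin n) K)[X])).comp (inVarsHom K (n + 1)) := by
    ext r : 1
    have hC : ∀ a : K, inVarsHom K n (C a) = C a := fun a => (inVarsHom K n).commutes a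
    have ha : ∀ a : K, algebraMap K (MvPolynomial (Fin n) K)[X] a = Polynomial.C (C a) :=
      fun a => rfl
    simp only [AlgHom.comp_apply, shiftHom_X, inVarsHom_X, psum, map_sum, map_pow, aeval_X,
      Fin.sum_univ_succ, Fin.cons_zero, Fin.cons_succ, map_add, map_mul,
      Polynomial.coe_mapAlgHom, Polynomial.map_C, Polynomial.map_X, RingHom.coe_coe, hC, ha]
    ring
  exact DFunLike.congr_fun h f

theorem polynomial_eq_zero_of_inVarsHom [CharZero K] {F : (SymFun K)[X]} (N : ℕ)
    (h : ∀ n, N ≤ n → Polynomial.mapAlgHom (inVarsHom K n) F = 0) : F = 0 := by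
  ext1 r
  refine eq_zero_of_inVarsHom N fun n hn => ?_
  have := congrArg (fun G => Polynomial.coeff G r) (h n hn)
  simpa using this

/-- This is `branchPoly_vertical` with the rescaled variable adjoined as u, verified after
restriction to n variables for every n ≥ m. -/
theorem shiftHom_symQ [CharZero K] {q : K} (hq : ∀ n, qPoch q q n ≠ 0) {B m : ℕ} {ν : ℕ → ℕ}
    (h : ν ∈ seqBox B (m + 1)) (hν : Antitone ν) :
    shiftHom (fun k => q ^ k) (symQ q B ν) = ∑ μ ∈ seqBox B (m + 1), vertCoeff q m ν μ •
      ((-Polynomial.X) ^ (∑ i ∈ Finset.range (m + 1), (ν i - μ i)) *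
        shiftHom (fun k => 1 ^ k) (symQ q B μ)) := by
  rw [← sub_eq_zero]
  refine polynomial_eq_zero_of_inVarsHom m fun n hn => ?_
  have hbox : ν ∈ seqBox B (n + 1) :=
    mem_seqBox.mpr ⟨(mem_seqBox.mp h).1, fun i hi => (mem_seqBox.mp h).2 i (by omega)⟩
  have key : ∀ (s : K) (μ : ℕ → ℕ), μ ∈ seqBox B (n + 1) →
      Polynomial.mapAlgHom (inVarsHom K n) (shiftHom (fun k => s ^ k) (symQ q B μ)) =
      branchPoly q B (n + 1) 0 (Fin.cons (algebraMap K _ s * Polynomial.X)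
        fun i => Polynomial.C (X i) : Fin (n + 1) → (MvPolynomial (Fin n) K)[X]) μ := by
    intro s μ hμ
    rw [map_shiftHom_pow, inVarsHom_symQ hq hμ, interpPoly, map_branchPoly]
    congr 1
    · funext i; simp
    · funext i; rw [aeval_X]
  have hexp : ∀ μ : ℕ → ℕ, ∑ i ∈ Finset.range (n + 1), (ν i - μ i) =
      ∑ i ∈ Finset.range (m + 1), (ν i - μ i) := fun μ =>
    sum_range_eq_of_le (ν := fun i => ν i - μ i) (by omega) fun i hi => by
      rw [(mem_seqBox.mp h).2 i hi, Nat.zero_sub]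
  rw [← sum_vertCoeff_stable q B hn fun i hi => (mem_seqBox.mp h).2 i hi, map_sub, sub_eq_zero,
    key q ν hbox, branchPoly_vertical hq B n _ _ hν (mem_seqBox.mp h).1, map_sum]
  refine Finset.sum_congr rfl fun μ hμ => ?_
  have h1 := key 1 μ hμ
  rw [map_one, one_mul] at h1
  rw [map_smul, map_mul, h1, hexp, Algebra.smul_def, mul_assoc]
  simp

/-- The coefficients of the substitution `p_k ↦ p_k - (1 - q^k) u^k`. -/
noncomputable def skewCoeff (q : K) (r : ℕ) : SymFun K →ₗ[K] SymFun K :=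
  (Polynomial.lcoeff (SymFun K) r).restrictScalars K ∘ₗ
    (shiftHom fun k => -(1 - q ^ k)).toLinearMap

theorem skewCoeff_apply (q : K) (r : ℕ) (f : SymFun K) :
    skewCoeff q r f = (shiftHom (fun k => -(1 - q ^ k)) f).coeff r := rfl

/-- A further shift by -1 applied to `shiftHom_symQ` turns the shift by q^k into the one by -(1 -
q^k) and the shift by 1 into the identity; then compare coefficients of u^r. -/
theorem skewCoeff_symQ [CharZero K] {q : K} (hq : ∀ n, qPoch q q n ≠ 0) {B m : ℕ} {ν : ℕ → ℕ}
    (h : ν ∈ seqBox B (m + 1)) (hν : Antitone ν) (r : ℕ) :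
    skewCoeff q r (symQ q B ν) = ∑ μ ∈ seqBox B (m + 1),
      if ∑ i ∈ Finset.range (m + 1), (ν i - μ i) = r then
        ((-1) ^ r * vertCoeff q m ν μ) • symQ q B μ else 0 := by
  have h1 := congrArg (Polynomial.eval₂ (shiftHom (fun _ => -1 : ℕ → K) : SymFun K →+* (SymFun K)[X])
    Polynomial.X) (shiftHom_symQ hq h hν)
  rw [eval₂_shiftHom, Polynomial.eval₂_finsetSum] at h1
  have e1 : ((fun _ => -1 : ℕ → K) + fun k => q ^ k) = fun k => -(1 - q ^ k) := by
    funext k; simp [sub_eq_add_neg, add_comm]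
  have e2 : ((fun _ => -1 : ℕ → K) + fun k => 1 ^ k) = 0 := by funext k; simp
  rw [skewCoeff_apply, ← e1, h1, Polynomial.finsetSum_coeff]
  refine Finset.sum_congr rfl fun μ _ => ?_
  have e3 : ∀ a : K, (shiftHom (fun _ => -1 : ℕ → K)) (C a) = Polynomial.C (C a) := fun a =>
    (shiftHom _).commutes a
  have e4 : ∀ (a : K) (F : (SymFun K)[X]), a • F = Polynomial.C (C a) * F := fun a F => by
    rw [Algebra.smul_def]; rfl
  have e5 : ∀ d : ℕ, ((-Polynomial.X : (SymFun K)[X]) ^ d).coeff r =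
      if d = r then (-1) ^ r else 0 := by
    intro d
    have : (-Polynomial.X : (SymFun K)[X]) ^ d =
        Polynomial.C ((-1) ^ d) * Polynomial.X ^ d := by
      rw [neg_pow (Polynomial.X : (SymFun K)[X]) d, map_pow, map_neg, map_one]
    rw [this, Polynomial.coeff_C_mul, Polynomial.coeff_X_pow]
    split_ifs with h1 h2 h2
    · rw [h1, mul_one]
    · exact absurd h1.symm h2
    · exact absurd h2.symm h1
    · exact mul_zero _
  rw [e4, Polynomial.eval₂_mul, Polynomial.eval₂_mul, eval₂_shiftHom, e2, shiftHom_zero,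
    Polynomial.eval₂_C, Polynomial.eval₂_pow, Polynomial.eval₂_neg, Polynomial.eval₂_X,
    RingHom.coe_coe, e3, Polynomial.coeff_C_mul, Polynomial.coeff_mul_C, e5]
  split_ifs
  · rw [MvPolynomial.smul_eq_C_mul, C_mul, C_pow, C_neg, C_1]
    ring
  · simp

/-- The shift is the exponential of ∑ c_k u^k ∂/∂p_k; applying u d/du and reading off the
coefficient of u^s gives the recursion. -/
theorem nat_mul_coeff_shiftHom (c : ℕ → K) (f : SymFun K) (s : ℕ) :
    (s : SymFun K) * (shiftHom c f).coeff s = ∑ i ∈ Finset.range s,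
      C (((i + 1 : ℕ) : K) * c (i + 1)) * pderiv i ((shiftHom c f).coeff (s - 1 - i)) := by
  induction f using MvPolynomial.induction_on generalizing s with
  | C a =>
    have e : shiftHom c (C a) = Polynomial.C (C a) := (shiftHom c).commutes a
    rw [e]
    rw [Finset.sum_eq_zero]
    · rcases Nat.eq_zero_or_pos s with rfl | hs
      · simp
      · rw [Polynomial.coeff_C, if_neg hs.ne', mul_zero]
    · intro i _
      rw [Polynomial.coeff_C]
      split_ifs <;> simp
  | add f g hf hg =>
    simp only [map_add, Polynomial.coeff_add, mul_add, hf, hg, Finset.sum_add_distrib]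
  | mul_X f j hf =>
    have e : ∀ s, (shiftHom c (f * X j)).coeff s = (shiftHom c f).coeff s * X j +
        (if j + 1 ≤ s then C (c (j + 1)) * (shiftHom c f).coeff (s - (j + 1)) else 0) := by
      intro s
      rw [map_mul, shiftHom_X, mul_add, Polynomial.coeff_add, Polynomial.coeff_mul_C]
      rw [← mul_assoc, Polynomial.coeff_mul_X_pow']
      simp only [Polynomial.coeff_mul_C]
      split_ifs
      · ring
      · rfl
    have hp : ∀ i, pderiv i (X j : SymFun K) = if i = j then 1 else 0 := by
      intro i
      split_ifs with h
      · rw [h, pderiv_X_self]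
      · exact pderiv_X_of_ne (Ne.symm h)
    simp only [e, map_add, pderiv_mul, hp]
    have split : ∀ i, C (((i + 1 : ℕ) : K) * c (i + 1)) *
        (pderiv i ((shiftHom c f).coeff (s - 1 - i)) * X j +
          (shiftHom c f).coeff (s - 1 - i) * (if i = j then 1 else 0) +
          pderiv i (if j + 1 ≤ s - 1 - i then
            C (c (j + 1)) * (shiftHom c f).coeff (s - 1 - i - (j + 1)) else 0)) =
        C (((i + 1 : ℕ) : K) * c (i + 1)) * pderiv i ((shiftHom c f).coeff (s - 1 - i)) * X j +
        (if i = j then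
          C (((j + 1 : ℕ) : K) * c (j + 1)) * (shiftHom c f).coeff (s - 1 - j) else 0) +
        (if j + 1 ≤ s - 1 - i then C (c (j + 1)) * (C (((i + 1 : ℕ) : K) * c (i + 1)) *
          pderiv i ((shiftHom c f).coeff (s - 1 - i - (j + 1)))) else 0) := by
      intro i
      by_cases h1 : i = j
      · subst h1
        simp only [if_true]
        split_ifs
        · rw [pderiv_C_mul]; ring
        · rw [map_zero]; ring
      · split_ifs
        · rw [pderiv_C_mul]; ring
        · simp; ring
    rw [Finset.sum_congr rfl fun i _ => split i, Finset.sum_add_distrib, Finset.sum_add_distrib,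
      ← Finset.sum_mul, ← hf s, mul_add, Finset.sum_ite_eq', add_assoc, mul_assoc]
    congr 1
    by_cases hjs : j + 1 ≤ s
    · obtain ⟨t, rfl⟩ := Nat.exists_eq_add_of_le hjs
      rw [if_pos hjs, if_pos (Finset.mem_range.mpr (by omega)), show j + 1 + t - (j + 1) = t by omega,
        show j + 1 + t - 1 - j = t by omega,
        ← Finset.sum_subset (Finset.range_mono (show t ≤ j + 1 + t by omega))]
      · have e2 : ∀ i ∈ Finset.range t, (if j + 1 ≤ j + 1 + t - 1 - i then
            C (c (j + 1)) * (C (((i + 1 : ℕ) : K) * c (i + 1)) *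
              pderiv i ((shiftHom c f).coeff (j + 1 + t - 1 - i - (j + 1)))) else 0) =
            C (c (j + 1)) * (C (((i + 1 : ℕ) : K) * c (i + 1)) *
              pderiv i ((shiftHom c f).coeff (t - 1 - i))) := by
          intro i hi
          have := Finset.mem_range.mp hi
          rw [if_pos (by omega), show j + 1 + t - 1 - i - (j + 1) = t - 1 - i by omega]
        rw [Finset.sum_congr rfl e2, ← Finset.mul_sum, ← hf t, C_mul, map_natCast]
        push_cast
        ring
      · intro i _ hi
        rw [Finset.mem_range] at hi
        rw [if_neg (by omega)]
    · rw [if_neg hjs, if_neg (by rw [Finset.mem_range]; omega), mul_zero, zero_add,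
        Finset.sum_eq_zero]
      intro i _
      rw [if_neg (by omega)]

end Skewing

/-! ### Elementary symmetric functions -/

section Elementary

variable {K : Type*} [Field K]

/-- The elementary symmetric functions, by the Newton recursion. -/
noncomputable def elemFun (K : Type*) [Field K] : ℕ → SymFun K
  | 0 => 1
  | r + 1 => C (((r + 1 : ℕ) : K)⁻¹) *
      ∑ i : Fin (r + 1), (-1) ^ (i : ℕ) * elemFun K (r - i) * X (i : ℕ)

theorem elemFun_succ (r : ℕ) : elemFun K (r + 1) = C (((r + 1 : ℕ) : K)⁻¹) *
    ∑ i ∈ Finset.range (r + 1), (-1) ^ i * elemFun K (r - i) * X i := by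
  rw [elemFun, Finset.sum_range]

theorem inVarsHom_elemFun [CharZero K] (n r : ℕ) :
    inVarsHom K n (elemFun K r) = esymm (Fin n) K r := by
  induction r using Nat.strong_induction_on with
  | _ r ih =>
    cases r with
    | zero => simp [elemFun]
    | succ r =>
      have key := mul_esymm_eq_sum (Fin n) K (r + 1)
      have hC : (C (((r + 1 : ℕ) : K)⁻¹) : MvPolynomial (Fin n) K) *
          ((r + 1 : ℕ) : MvPolynomial (Fin n) K) = 1 := by
        rw [← map_natCast (C : K →+* MvPolynomial (Fin n) K), ← C_mul,
          inv_mul_cancel₀ (Nat.cast_ne_zero.mpr (Nat.succ_ne_zero r)), C_1]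
      have he : esymm (Fin n) K (r + 1) = C (((r + 1 : ℕ) : K)⁻¹) *
          (((r + 1 : ℕ) : MvPolynomial (Fin n) K) * esymm (Fin n) K (r + 1)) := by
        rw [← mul_assoc, hC, one_mul]
      rw [he, key, elemFun_succ, map_mul, algHom_C, algebraMap_eq]
      congr 1
      rw [Finset.sum_filter, Finset.Nat.sum_antidiagonal_eq_sum_range_succ_mk,
        Finset.sum_range_succ _ (r + 1), if_neg (lt_irrefl _), add_zero, map_sum, Finset.mul_sum,
        ← Finset.sum_range_reflect]
      refine Finset.sum_congr rfl fun i hi => ?_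
      have hi' := Finset.mem_range.mp hi
      rw [if_pos hi', map_mul, map_mul, inVarsHom_X, show r - (r + 1 - 1 - i) = i by omega,
        ih i (by omega), show r + 1 - 1 - i + 1 = r + 1 - i by omega, map_pow, map_neg, map_one]
      have : ((-1 : MvPolynomial (Fin n) K)) ^ (r + 1 - 1 - i) = (-1) ^ (r + 1 + 1) * (-1) ^ i := by
        rw [← pow_add, show r + 1 + 1 + i = (r + 1 - 1 - i) + 2 * (i + 1) by omega, pow_add,
          pow_mul]
        simp
      rw [this]
      ring

end Elementary

/-! ### The scalar product and its values on products of elementary symmetric functions -/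

section Scalar

variable {K : Type*} [Field K]

/-- The squared norm of a product of power sums. -/
noncomputable def zWt (q t : K) (m : ℕ →₀ ℕ) : K :=
  ∏ r ∈ m.support, (((r + 1 : ℕ) : K) ^ m r * ((m r).factorial : K)
    * ((1 - q ^ (r + 1)) / (1 - t ^ (r + 1))) ^ m r)

theorem zWt_eq_prod (q t : K) {m : ℕ →₀ ℕ} {s : Finset ℕ} (h : m.support ⊆ s) :
    zWt q t m = ∏ r ∈ s, (((r + 1 : ℕ) : K) ^ m r * ((m r).factorial : K)
      * ((1 - q ^ (r + 1)) / (1 - t ^ (r + 1))) ^ m r) := by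
  refine Finset.prod_subset h fun r _ hr => ?_
  simp [Finsupp.notMem_support_iff.mp hr]

theorem zWt_add_single (q t : K) (m : ℕ →₀ ℕ) (i : ℕ) :
    zWt q t (m + Finsupp.single i 1) = zWt q t m *
      (((i + 1 : ℕ) : K) * ((m i + 1 : ℕ) : K) * ((1 - q ^ (i + 1)) / (1 - t ^ (i + 1)))) := by
  classical
  have h1 : m.support ⊆ insert i m.support := Finset.subset_insert _ _
  have h2 : (m + Finsupp.single i 1).support ⊆ insert i m.support := by
    intro r hr
    by_contra h
    rw [Finset.mem_insert, not_or, Finsupp.notMem_support_iff] at h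
    rw [Finsupp.mem_support_iff] at hr
    exact hr (by simp [h.2, Ne.symm h.1])
  rw [zWt_eq_prod q t h1, zWt_eq_prod q t h2,
    ← Finset.mul_prod_erase _ _ (Finset.mem_insert_self i m.support),
    ← Finset.mul_prod_erase _ _ (Finset.mem_insert_self i m.support)]
  have e : ∀ r ∈ (insert i m.support).erase i, (m + Finsupp.single i 1 : ℕ →₀ ℕ) r = m r := by
    intro r hr
    simp [Finset.ne_of_mem_erase hr]
  rw [Finset.prod_congr rfl fun r hr => by rw [e r hr]]
  simp only [Finsupp.add_apply, Finsupp.single_eq_same, Nat.factorial_succ, pow_succ,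
    Nat.cast_mul]
  ring

theorem scalar_eq_sum (q t : K) (f g : SymFun K) {s : Finset (ℕ →₀ ℕ)} (h : f.support ⊆ s) :
    SymFun.scalar q t f g = ∑ m ∈ s, f.coeff m * g.coeff m * zWt q t m := by
  refine Finset.sum_subset h fun m _ hm => ?_
  rw [notMem_support_iff.mp hm, zero_mul, zero_mul]

/-- Macdonald's scalar product as a bilinear map. -/
noncomputable def pairing (q t : K) : SymFun K →ₗ[K] SymFun K →ₗ[K] K :=
  LinearMap.mk₂ K (SymFun.scalar q t)
    (fun f f' g => by
      classical
      rw [scalar_eq_sum q t (f + f') g (s := f.support ∪ f'.support) support_add,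
        scalar_eq_sum q t f g Finset.subset_union_left,
        scalar_eq_sum q t f' g Finset.subset_union_right, ← Finset.sum_add_distrib]
      refine Finset.sum_congr rfl fun m _ => ?_
      rw [coeff_add]; ring)
    (fun c f g => by
      rw [scalar_eq_sum q t (c • f) g (s := f.support) support_smul, SymFun.scalar, smul_eq_mul,
        Finset.mul_sum]
      refine Finset.sum_congr rfl fun m _ => ?_
      rw [coeff_smul, smul_eq_mul, zWt]; ring)
    (fun f g g' => by
      rw [SymFun.scalar, SymFun.scalar, SymFun.scalar, ← Finset.sum_add_distrib]
      refine Finset.sum_congr rfl fun m _ => ?_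
      rw [coeff_add]; ring)
    (fun c f g => by
      rw [SymFun.scalar, SymFun.scalar, smul_eq_mul, Finset.mul_sum]
      refine Finset.sum_congr rfl fun m _ => ?_
      rw [coeff_smul, smul_eq_mul]; ring)

theorem pairing_apply (q t : K) (f g : SymFun K) : pairing q t f g = SymFun.scalar q t f g := rfl

theorem pairing_comm (q t : K) (f g : SymFun K) : pairing q t f g = pairing q t g f := by
  classical
  rw [pairing_apply, pairing_apply, scalar_eq_sum q t f g Finset.subset_union_left (s := _ ∪ g.support),
    scalar_eq_sum q t g f Finset.subset_union_right]
  refine Finset.sum_congr rfl fun m _ => ?_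
  ring

theorem pairing_monomial (q t : K) (m : ℕ →₀ ℕ) (c : K) (f : SymFun K) :
    pairing q t (monomial m c) f = c * f.coeff m * zWt q t m := by
  classical
  rw [pairing_apply, scalar_eq_sum q t _ f support_monomial_subset, Finset.sum_singleton,
    coeff_monomial, if_pos rfl]

theorem pairing_one (q t : K) (f : SymFun K) : pairing q t 1 f = f.coeff 0 := by
  have : (1 : SymFun K) = monomial 0 1 := rfl
  rw [this, pairing_monomial]
  simp [zWt]

/-- One more part i + 1 multiplies the norm of a monomial by (i+1)(m_i+1)(1 - q^{i+1})/(1 -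
t^{i+1}), and m_i + 1 is the factor produced by the derivative. -/
theorem pairing_X_mul (q t : K) (i : ℕ) (h f : SymFun K) :
    pairing q t (X i * h) f = pairing q t h
      (C (((i + 1 : ℕ) : K) * ((1 - q ^ (i + 1)) / (1 - t ^ (i + 1)))) * pderiv i f) := by
  induction h using MvPolynomial.induction_on' with
  | monomial m c =>
    have e : (X i * monomial m c : SymFun K) = monomial (m + Finsupp.single i 1) c := by
      rw [X, monomial_mul, one_mul, add_comm]
    rw [e, pairing_monomial, pairing_monomial, zWt_add_single, coeff_C_mul, coeff_pderiv]
    push_cast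
    ring
  | add a b ha hb => rw [mul_add, map_add, map_add, LinearMap.add_apply, LinearMap.add_apply, ha, hb]

/-- At t = 0 multiplication by p_i is adjoint to i(1 - q^i)∂/∂p_i. Newton's recursion for e_r thus
turns, up to sign, into the recursion `nat_mul_coeff_shiftHom` of the shift by -(1 - q^k). -/
theorem pairing_elemFun_mul [CharZero K] (q : K) (r : ℕ) (h f : SymFun K) :
    pairing q 0 (elemFun K r * h) f = (-1) ^ r * pairing q 0 h (skewCoeff q r f) := by
  induction r using Nat.strong_induction_on generalizing h with
  | _ r ih =>
    cases r with
    | zero =>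
      have h0 : skewCoeff q 0 f = f := by
        have : ((Polynomial.constantCoeff : _ →+* SymFun K).comp
            (shiftHom (fun k => -(1 - q ^ k)) : SymFun K →+* _)) = RingHom.id _ := by
          refine MvPolynomial.ringHom_ext (fun a => ?_) fun i => ?_
          · have : shiftHom (fun k => -(1 - q ^ k)) (C a) = Polynomial.C (C a) :=
              (shiftHom _).commutes a
            simp
          · simp [shiftHom_X]
        exact DFunLike.congr_fun this f
      rw [h0, elemFun, pow_zero, one_mul, one_mul]
    | succ r =>
      have hr : ((r + 1 : ℕ) : K) ≠ 0 := Nat.cast_ne_zero.mpr (Nat.succ_ne_zero r)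
      have e1 : elemFun K (r + 1) * h = ((r + 1 : ℕ) : K)⁻¹ •
          ∑ i ∈ Finset.range (r + 1), (-1 : K) ^ i • (elemFun K (r - i) * (X i * h)) := by
        rw [elemFun_succ, MvPolynomial.smul_eq_C_mul, mul_assoc, Finset.sum_mul]
        congr 1
        refine Finset.sum_congr rfl fun i _ => ?_
        rw [MvPolynomial.smul_eq_C_mul, C_pow, C_neg, C_1]
        ring
      have e2 := nat_mul_coeff_shiftHom (fun k => -(1 - q ^ k)) f (r + 1)
      have e3 : skewCoeff q (r + 1) f = ((r + 1 : ℕ) : K)⁻¹ • ∑ i ∈ Finset.range (r + 1),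
          C (((i + 1 : ℕ) : K) * -(1 - q ^ (i + 1))) * pderiv i (skewCoeff q (r - i) f) := by
        rw [eq_inv_smul_iff₀ hr, MvPolynomial.smul_eq_C_mul, map_natCast]
        exact e2
      rw [e1, e3, map_smul, LinearMap.smul_apply, map_sum, LinearMap.sum_apply, map_smul,
        map_sum, smul_eq_mul, smul_eq_mul, mul_left_comm]
      congr 1
      rw [Finset.mul_sum]
      refine Finset.sum_congr rfl fun i hi => ?_
      have hi' := Finset.mem_range.mp hi
      rw [map_smul, LinearMap.smul_apply, ih (r - i) (by omega), pairing_X_mul]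
      have e4 : C (((i + 1 : ℕ) : K) * ((1 - q ^ (i + 1)) / (1 - 0 ^ (i + 1)))) *
          pderiv i (skewCoeff q (r - i) f) = (-1 : K) •
          (C (((i + 1 : ℕ) : K) * -(1 - q ^ (i + 1))) * pderiv i (skewCoeff q (r - i) f)) := by
        rw [MvPolynomial.smul_eq_C_mul, ← mul_assoc, ← C_mul, zero_pow (Nat.succ_ne_zero i), sub_zero,
          div_one]
        congr 2
        ring
      rw [e4, map_smul, smul_eq_mul, smul_eq_mul, ← mul_assoc, ← mul_assoc, ← pow_add,
        Nat.add_sub_cancel' (by omega : i ≤ r), ← pow_succ]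

/-- The product of the elementary symmetric functions of the given degrees. -/
noncomputable def elemProd (K : Type*) [Field K] (l : List ℕ) : SymFun K := (l.map (elemFun K)).prod

/-- The sequence with columns of the given lengths. -/
def colSum (l : List ℕ) (i : ℕ) : ℕ := (l.map fun r => column r i).sum

theorem elemProd_cons (r : ℕ) (l : List ℕ) : elemProd K (r :: l) = elemFun K r * elemProd K l := by
  simp [elemProd]

theorem colSum_cons (r : ℕ) (l : List ℕ) : colSum (r :: l) = column r + colSum l := by
  funext i; simp [colSum]

theorem antitone_column (r : ℕ) : Antitone (column r) := by
  intro i j hij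
  unfold column
  split_ifs <;> omega

theorem antitone_colSum (l : List ℕ) : Antitone (colSum l) := by
  induction l with
  | nil => exact fun _ _ _ => le_rfl
  | cons r l ih => rw [colSum_cons]; exact (antitone_column r).add ih

/-- A strip takes at most one box from each row and |ν/μ| boxes in all, so the first k rows lose at
most min(k, |ν/μ|). -/
theorem sum_range_sub_le_of_vertCoeff_ne_zero {q : K} {m : ℕ} {ν μ : ℕ → ℕ}
    (h : vertCoeff q m ν μ ≠ 0) {k : ℕ} (hk : k ≤ m + 1) :
    ∑ i ∈ Finset.range k, ν i ≤ ∑ i ∈ Finset.range k, column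
      (∑ i ∈ Finset.range (m + 1), (ν i - μ i)) i + ∑ i ∈ Finset.range k, μ i := by
  have h1 : ∀ i ∈ Finset.range k, ν i = (ν i - μ i) + μ i := fun i hi => by
    have := vertCoeff_ne_zero h (i := i) (by have := Finset.mem_range.mp hi; omega)
    omega
  rw [Finset.sum_congr rfl h1, Finset.sum_add_distrib]
  refine Nat.add_le_add_right ?_ _
  rw [sum_range_column]
  refine le_min ?_ ?_
  · calc _ ≤ ∑ i ∈ Finset.range k, 1 := Finset.sum_le_sum fun i hi => by
          have := vertCoeff_ne_zero h (i := i) (by have := Finset.mem_range.mp hi; omega)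
          omega
      _ = k := by simp
  · exact Finset.sum_le_sum_of_subset (Finset.range_mono hk)

theorem pairing_elemProd_cons [CharZero K] {q : K} (hq : ∀ n, qPoch q q n ≠ 0) {B m : ℕ}
    {ν : ℕ → ℕ} (hν : ν ∈ seqBox B (m + 1)) (ha : Antitone ν) (r : ℕ) (l : List ℕ) :
    pairing q 0 (elemProd K (r :: l)) (symQ q B ν) = ∑ μ ∈ seqBox B (m + 1),
      if ∑ i ∈ Finset.range (m + 1), (ν i - μ i) = r then
        vertCoeff q m ν μ * pairing q 0 (elemProd K l) (symQ q B μ) else 0 := by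
  rw [elemProd_cons, pairing_elemFun_mul, skewCoeff_symQ hq hν ha, map_sum, Finset.mul_sum]
  refine Finset.sum_congr rfl fun μ _ => ?_
  split_ifs
  · have : ((-1 : K) ^ r) * (-1) ^ r = 1 := by rw [← mul_pow]; simp
    rw [map_smul, smul_eq_mul, ← mul_assoc, ← mul_assoc, this, one_mul]
  · rw [map_zero, mul_zero]

/-- Each e_r strips off a vertical strip of size r, which costs at most a full column in dominance;
what remains at the end pairs with 1 and must have weight 0. -/
theorem sum_le_of_pairing_ne_zero [CharZero K] {q : K} (hq : ∀ n, qPoch q q n ≠ 0) {B m : ℕ}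
    {ν : ℕ → ℕ} (hν : ν ∈ seqBox B (m + 1)) (l : List ℕ)
    (h : pairing q 0 (elemProd K l) (symQ q B ν) ≠ 0) {k : ℕ} (hk : k ≤ m + 1) :
    ∑ i ∈ Finset.range k, ν i ≤ ∑ i ∈ Finset.range k, colSum l i := by
  have anti : ∀ (ν : ℕ → ℕ) (l : List ℕ), pairing q 0 (elemProd K l) (symQ q B ν) ≠ 0 →
      Antitone ν := by
    intro ν l h
    by_contra h0
    exact h (by rw [symQ_eq_zero h0, map_zero])
  induction l generalizing ν with
  | nil =>
    rw [elemProd, List.map_nil, List.prod_nil, pairing_one] at h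
    have h1 := isWeightedHomogeneous_symQ hq hν h
    rw [map_zero] at h1
    refine (Finset.sum_le_sum_of_subset (Finset.range_mono hk)).trans ?_
    rw [← h1]
    exact Nat.zero_le _
  | cons r l ih =>
    rw [pairing_elemProd_cons hq hν (anti _ _ h)] at h
    obtain ⟨μ, hμ, hne⟩ := Finset.exists_ne_zero_of_sum_ne_zero h
    obtain ⟨hr, hne⟩ := ite_ne_right_iff.mp hne
    have h1 := sum_range_sub_le_of_vertCoeff_ne_zero (left_ne_zero_of_mul hne) hk
    have h2 := ih hμ (right_ne_zero_of_mul hne)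
    rw [colSum_cons]
    simp only [Pi.add_apply, Finset.sum_add_distrib]
    rw [hr] at h1
    omega

theorem eq_of_sum_range_eq {μ ν : ℕ → ℕ} {n : ℕ}
    (h : ∀ k ≤ n, ∑ i ∈ Finset.range k, μ i = ∑ i ∈ Finset.range k, ν i) {i : ℕ} (hi : i < n) :
    μ i = ν i := by
  have h1 := h (i + 1) hi
  rw [Finset.sum_range_succ, Finset.sum_range_succ, h i hi.le] at h1
  omega

theorem vertCoeff_column_add (q : K) (m r : ℕ) (μ : ℕ → ℕ) :
    vertCoeff q m (column r + μ) μ = 1 := by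
  rw [vertCoeff, if_pos, one_mul]
  · refine Finset.prod_eq_one fun s _ => ?_
    have h1 : (column r + μ) s = column r s + μ s := rfl
    have h2 : (column r + μ) (s + 1) = column r (s + 1) + μ (s + 1) := rfl
    have h3 : column r (s + 1) = 0 ∨ (column r (s + 1) = 1 ∧ column r s = 1) := by
      unfold column; split_ifs <;> omega
    rw [h1, h2]
    unfold vertEdge
    rcases h3 with h3 | ⟨h3, h4⟩
    · rw [h3, zero_add, if_pos rfl]
    · rw [h3, h4, if_neg (by omega), if_pos (by omega), if_neg (by omega)]
  · simp only [Pi.add_apply, column]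
    split_ifs <;> omega

/-- Equality in the dominance bound leaves one chain of strips, each a full column. Their
coefficients are 1, since a row that loses a box lies below another row that loses one, unless it is
the first. -/
theorem pairing_elemProd_colSum [CharZero K] {q : K} (hq : ∀ n, qPoch q q n ≠ 0) {B m : ℕ}
    (l : List ℕ) (hl : colSum l ∈ seqBox B (m + 1)) :
    pairing q 0 (elemProd K l) (symQ q B (colSum l)) = 1 := by
  induction l with
  | nil =>
    have : colSum [] = 0 := rfl
    rw [this, symQ_zero hq, elemProd, List.map_nil, List.prod_nil, pairing_one, coeff_zero_one]
  | cons r l ih =>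
    obtain ⟨h1, h2⟩ := mem_seqBox.mp hl
    rw [colSum_cons] at h1 h2
    have hl' : colSum l ∈ seqBox B (m + 1) := mem_seqBox.mpr
      ⟨fun i => (Nat.le_add_left _ _).trans (h1 i), fun i hi => (Nat.add_eq_zero_iff.mp (h2 i hi)).2⟩
    have hr : r ≤ m + 1 := by
      have := (Nat.add_eq_zero_iff.mp (h2 (m + 1) le_rfl)).1
      unfold column at this
      split_ifs at this
      omega
    have hsum : ∑ i ∈ Finset.range (m + 1), (colSum (r :: l) i - colSum l i) = r := by
      rw [colSum_cons]
      simp only [Pi.add_apply, Nat.add_sub_cancel]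
      rw [sum_range_column]
      exact min_eq_right hr
    rw [pairing_elemProd_cons hq hl (antitone_colSum _), Finset.sum_eq_single (colSum l)]
    · rw [if_pos hsum, ih hl', mul_one, colSum_cons, vertCoeff_column_add]
    · intro μ hμ hne
      by_contra h0
      obtain ⟨hr', h0⟩ := ite_ne_right_iff.mp h0
      refine hne (funext fun i => ?_)
      rcases lt_or_ge i (m + 1) with hi | hi
      · refine eq_of_sum_range_eq (fun k hk => le_antisymm
          (sum_le_of_pairing_ne_zero hq hμ l (right_ne_zero_of_mul h0) hk) ?_) hi
        have h3 := sum_range_sub_le_of_vertCoeff_ne_zero (left_ne_zero_of_mul h0) hk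
        rw [hr', colSum_cons] at h3
        simp only [Pi.add_apply, Finset.sum_add_distrib] at h3
        omega
      · rw [(mem_seqBox.mp hμ).2 i hi, (mem_seqBox.mp hl').2 i hi]
    · exact fun h => absurd hl' h

/-- Peel off the first column, whose length is the index of the first zero part. -/
theorem exists_colSum_eq {μ : ℕ → ℕ} (hμ : Antitone μ) {n : ℕ} (hn : ∀ i, n ≤ i → μ i = 0) :
    ∃ l : List ℕ, colSum l = μ := by
  induction hd : ∑ i ∈ Finset.range n, μ i using Nat.strong_induction_on generalizing μ with
  | _ d ih =>
    classical
    by_cases h0 : μ 0 = 0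
    · refine ⟨[], funext fun i => ?_⟩
      exact (Nat.le_zero.mp ((hμ (Nat.zero_le i)).trans h0.le)).symm
    have hex : ∃ M, μ M = 0 := ⟨n, hn n le_rfl⟩
    set r := Nat.find hex with hr
    have hpos : ∀ i, i < r → 0 < μ i := fun i hi => Nat.pos_of_ne_zero (Nat.find_min hex hi)
    have hzero : ∀ i, r ≤ i → μ i = 0 := fun i hi =>
      Nat.le_zero.mp ((hμ hi).trans (Nat.find_spec hex).le)
    have hcol : ∀ i, μ i = column r i + (μ i - column r i) := by
      intro i
      unfold column
      split_ifs with h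
      · have := hpos i h; omega
      · omega
    have hr0 : 0 < r := by
      rcases Nat.eq_zero_or_pos r with h | h
      · exact absurd (hzero 0 h.le) h0
      · exact h
    have hrn : r ≤ n := Nat.find_le (hn n le_rfl)
    obtain ⟨l, hl⟩ := ih (∑ i ∈ Finset.range n, (μ i - column r i)) (by
        have h1 : ∑ i ∈ Finset.range n, μ i = ∑ i ∈ Finset.range n, column r i +
            ∑ i ∈ Finset.range n, (μ i - column r i) := by
          rw [← Finset.sum_add_distrib]
          exact Finset.sum_congr rfl fun i _ => hcol i
        rw [sum_range_column] at h1
        have : 0 < min n r := lt_min (by omega) hr0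
        omega) (μ := fun i => μ i - column r i) (by
        intro i j hij
        have h1 := hμ hij
        dsimp only
        unfold column
        split_ifs with h2 h3
        · omega
        · omega
        · have := hzero j (by omega); omega
        · omega) (fun i hi => by rw [hn i hi, Nat.zero_sub]) rfl
    refine ⟨r :: l, ?_⟩
    rw [colSum_cons, hl]
    funext i
    exact (hcol i).symm

end Scalar

/-! ### Finiteness and antisymmetry of the dominance order -/

namespace Partn

theorem sum_range_le_weight (μ : Partn) (k : ℕ) : ∑ i ∈ Finset.range k, μ i ≤ μ.weight := by
  rw [weight_eq_sum (n := max k μ.length) (le_max_right _ _)]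
  exact Finset.sum_le_sum_of_subset (Finset.range_mono (le_max_left _ _))

theorem length_le_weight (μ : Partn) : μ.length ≤ μ.weight := by
  rw [length, weight, Finset.card_eq_sum_ones]
  exact Finset.sum_le_sum fun i hi => Nat.one_le_iff_ne_zero.mpr (Finsupp.mem_support_iff.mp hi)

theorem le_weight (μ : Partn) (i : ℕ) : μ i ≤ μ.weight :=
  (Finset.single_le_sum (f := fun i => μ i) (fun _ _ => Nat.zero_le _)
    (Finset.self_mem_range_succ i)).trans (μ.sum_range_le_weight (i + 1))

theorem mem_seqBox_of_weight {μ : Partn} {d n : ℕ} (h : μ.weight = d) (hn : d ≤ n) :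
    (μ : ℕ → ℕ) ∈ seqBox d n :=
  mem_seqBox.mpr ⟨fun i => h ▸ μ.le_weight i, fun _ hi =>
    eq_zero_of_length_le (μ.length_le_weight.trans (h.le.trans hn)) hi⟩

theorem finite_weight (d : ℕ) : {μ : Partn | μ.weight = d}.Finite := by
  refine Set.Finite.of_finite_image (f := fun μ : Partn => (μ : ℕ → ℕ))
    ((seqBox d d).finite_toSet.subset ?_) coe_injective.injOn
  rintro _ ⟨μ, hμ, rfl⟩
  exact mem_seqBox_of_weight hμ le_rfl

/-- A statistic that is strictly monotone for the dominance order on partitions of `d`. -/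
def rank (d : ℕ) (μ : Partn) : ℕ := ∑ k ∈ Finset.range (d + 1), ∑ i ∈ Finset.range k, μ i

theorem DomLE.trans {μ ν ρ : Partn} (h : μ.DomLE ν) (h' : ν.DomLE ρ) : μ.DomLE ρ :=
  ⟨h.1.trans h'.1, fun k => (h.2 k).trans (h'.2 k)⟩

theorem DomLE.rank_le {μ ν : Partn} (h : μ.DomLE ν) (d : ℕ) : μ.rank d ≤ ν.rank d :=
  Finset.sum_le_sum fun k _ => h.2 k

theorem DomLE.eq_of_rank_eq {μ ν : Partn} {d : ℕ} (h : μ.DomLE ν) (hd : μ.weight = d)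
    (hr : μ.rank d = ν.rank d) : μ = ν := by
  have h1 := (Finset.sum_eq_sum_iff_of_le (s := Finset.range (d + 1)) fun k _ => h.2 k).mp hr
  refine coe_injective (funext fun i => ?_)
  rcases lt_or_ge i d with hi | hi
  · exact eq_of_sum_range_eq (fun k hk => h1 k (Finset.mem_range.mpr (by omega))) hi
  · change μ i = ν i
    rw [(mem_seqBox.mp (mem_seqBox_of_weight hd le_rfl)).2 i hi,
      (mem_seqBox.mp (mem_seqBox_of_weight (h.1.symm.trans hd) le_rfl)).2 i hi]

theorem DomLE.antisymm {μ ν : Partn} (h : μ.DomLE ν) (h' : ν.DomLE μ) : μ = ν :=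
  h.eq_of_rank_eq rfl (le_antisymm (h.rank_le _) (h'.rank_le _))

end Partn

/-! ### Identification with the Macdonald functions at t = 0 -/

section Macdonald

variable {K : Type*} [Field K]

/-- The coefficient of a monomial symmetric function, as a linear form. -/
noncomputable def mCoeffHom (K : Type*) [Field K] (μ : Partn) : SymFun K →ₗ[K] K :=
  lcoeff K (seqExponent μ.length μ) ∘ₗ (inVarsHom K μ.length).toLinearMap

theorem mCoeffHom_apply (μ : Partn) (f : SymFun K) : mCoeffHom K μ f = f.mCoeff μ := rfl

theorem mCoeffHom_eq (μ : Partn) (f : SymFun K) {N : ℕ} (hN : μ.length ≤ N) :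
    mCoeffHom K μ f = coeff (seqExponent N μ) (inVarsHom K N f) := mCoeff_eq μ f hN

theorem eq_zero_of_mCoeff [CharZero K] {f : SymFun K} (h : ∀ μ, mCoeffHom K μ f = 0) : f = 0 := by
  refine eq_zero_of_inVarsHom 0 fun n _ => isSymmetric_eq_zero (inVarsHom_isSymmetric n f)
    fun μ h1 h2 => ?_
  rw [← h (Partn.ofSeq μ h1 n h2), mCoeffHom_eq _ _ (Partn.length_ofSeq_le μ h1 n h2)]
  rfl

theorem weight_eq_of_mCoeff_ne_zero {f : SymFun K} {d : ℕ} {μ : Partn}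
    (hf : ∀ n, (inVarsHom K n f).IsHomogeneous d) (h : mCoeffHom K μ f ≠ 0) : μ.weight = d := by
  rw [mCoeffHom_eq μ f le_rfl] at h
  have := hf _ h
  rw [Partn.weight_eq_sum le_rfl, ← degree_seqExponent, Finsupp.degree_eq_weight_one (R := ℕ)]
  exact this

theorem sum_le_of_domBy {f : SymFun K} {w : ℕ → ℕ} {μ : Partn} {N : ℕ}
    (hf : ∀ n, N ≤ n → DomBy (inVarsHom K n f) w) (h : mCoeffHom K μ f ≠ 0) (k : ℕ) :
    ∑ i ∈ Finset.range k, μ i ≤ ∑ i ∈ Finset.range k, w i := by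
  rw [mCoeffHom_eq μ f (N := max N (max k μ.length)) (by omega)] at h
  have := hf _ (le_max_left _ _) _ h k (by omega)
  rwa [prefixSum_seqExponent _ (by omega)] at this

theorem isHomogeneous_esymm (n r : ℕ) : (esymm (Fin n) K r).IsHomogeneous r := by
  refine IsHomogeneous.sum _ _ _ fun t ht => ?_
  have := IsHomogeneous.prod t (fun i => (X i : MvPolynomial (Fin n) K)) (fun _ => 1)
    fun i _ => isHomogeneous_X K i
  rwa [Finset.sum_const, (Finset.mem_powersetCard.mp ht).2, smul_eq_mul, mul_one] at this

variable [CharZero K]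

theorem domLE_of_mCoeff_symQ {q : K} (hq : ∀ n, qPoch q q n ≠ 0) {μ ν : Partn} {d : ℕ}
    (hν : ν.weight = d) (h : mCoeffHom K μ (symQ q d ν) ≠ 0) : μ.DomLE ν := by
  have hbox := Partn.mem_seqBox_of_weight hν le_rfl
  refine ⟨weight_eq_of_mCoeff_ne_zero (fun n => ?_) h, sum_le_of_domBy (N := d) (fun n hn => ?_) h⟩
  · rw [Partn.weight_eq_sum (ν.length_le_weight.trans hν.le)]
    exact IsWeightedHomogeneous.inVarsHom (isWeightedHomogeneous_symQ hq hbox) n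
  · rw [(isSymQ_symQ hq hbox ν.antitone n fun i hi => (mem_seqBox.mp hbox).2 i (hn.trans hi)).2]
    exact domBy_interpPoly _ _ _ _

theorem mCoeff_symQ_self {q : K} (hq : ∀ n, qPoch q q n ≠ 0) {ν : Partn} {d n : ℕ}
    (hν : ν.weight = d) (hn : ν.length ≤ n) :
    mCoeffHom K ν (symQ q d ν) = (∏ i ∈ Finset.range n, qPoch q q (ν.diff i))⁻¹ := by
  have hbox := Partn.mem_seqBox_of_weight hν le_rfl
  rw [mCoeffHom_eq _ _ hn,
    (isSymQ_symQ hq hbox ν.antitone n fun i hi => Partn.eq_zero_of_length_le hn hi).2,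
    coeff_interpPoly_self hq d n ν.antitone (mem_seqBox.mp hbox).1
      fun i hi => Partn.eq_zero_of_length_le hn hi]
  rfl

theorem isHomogeneous_elemProd (n : ℕ) (l : List ℕ) :
    (inVarsHom K n (elemProd K l)).IsHomogeneous l.sum := by
  induction l with
  | nil => simpa [elemProd] using isHomogeneous_one (Fin n) K
  | cons r l ih =>
    rw [elemProd_cons, map_mul, inVarsHom_elemFun, List.sum_cons]
    exact (isHomogeneous_esymm n r).mul ih

theorem domBy_elemProd (n : ℕ) (l : List ℕ) : DomBy (inVarsHom K n (elemProd K l)) (colSum l) := by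
  induction l with
  | nil =>
    rw [elemProd, List.map_nil, List.prod_nil, map_one]
    exact DomBy.one
  | cons r l ih =>
    rw [elemProd_cons, map_mul, inVarsHom_elemFun, colSum_cons]
    exact (domBy_esymm r).mul ih

theorem coeff_elemProd (n : ℕ) (l : List ℕ) (hl : ∀ i, n ≤ i → colSum l i = 0) :
    coeff (seqExponent n (colSum l)) (inVarsHom K n (elemProd K l)) = 1 ∧
      ∑ i ∈ Finset.range n, colSum l i = l.sum := by
  induction l with
  | nil =>
    have : seqExponent n (colSum []) = 0 := by ext i; rfl
    rw [this, elemProd, List.map_nil, List.prod_nil, map_one]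
    simp [colSum]
  | cons r l ih =>
    rw [colSum_cons] at hl ⊢
    have hr : r ≤ n := by
      have := (Nat.add_eq_zero_iff.mp (hl n le_rfl)).1
      unfold column at this
      split_ifs at this
      omega
    obtain ⟨h1, h2⟩ := ih fun i hi => (Nat.add_eq_zero_iff.mp (hl i hi)).2
    constructor
    · rw [elemProd_cons, map_mul, inVarsHom_elemFun, (domBy_esymm r).coeff_mul (domBy_elemProd n l),
        coeff_esymm_column hr, h1, one_mul]
    · simp only [Pi.add_apply, Finset.sum_add_distrib, List.sum_cons]
      rw [h2, sum_range_column, min_eq_right hr]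

/-- A product of elementary symmetric functions with leading term `m_μ`. -/
theorem exists_leadingProd (μ : Partn) : ∃ l : List ℕ, colSum l = μ ∧
    mCoeffHom K μ (elemProd K l) = 1 ∧ ∀ ρ, mCoeffHom K ρ (elemProd K l) ≠ 0 → ρ.DomLE μ := by
  obtain ⟨l, hl⟩ := exists_colSum_eq μ.antitone (n := μ.length)
    fun i hi => Partn.eq_zero_of_length_le le_rfl hi
  obtain ⟨h1, h2⟩ := coeff_elemProd (K := K) μ.length l fun i hi => by
    rw [hl]; exact Partn.eq_zero_of_length_le le_rfl hi
  refine ⟨l, hl, ?_, fun ρ hρ => ⟨?_, ?_⟩⟩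
  · rw [mCoeffHom_eq μ _ le_rfl, ← h1, hl]
  · rw [weight_eq_of_mCoeff_ne_zero (fun n => isHomogeneous_elemProd n l) hρ, ← h2, hl,
      Partn.weight_eq_sum le_rfl]
  · have := sum_le_of_domBy (N := 0) (fun n _ => domBy_elemProd n l) hρ
    rwa [hl] at this

theorem domLE_of_pairing_ne_zero {q : K} (hq : ∀ n, qPoch q q n ≠ 0) {ν ρ : Partn} {d : ℕ}
    (hν : ν.weight = d) (hρ : ρ.weight = d) {l : List ℕ} (hl : colSum l = ρ)
    (h : pairing q 0 (elemProd K l) (symQ q d ν) ≠ 0) : ν.DomLE ρ := by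
  refine ⟨hν.trans hρ.symm, fun k => ?_⟩
  have hbox := Partn.mem_seqBox_of_weight hν (Nat.le_succ d)
  rcases le_total k (d + 1) with hk | hk
  · have := sum_le_of_pairing_ne_zero hq hbox l h hk
    rwa [hl] at this
  · refine (ν.sum_range_le_weight k).trans ?_
    rw [hν, ← hρ]
    exact (Partn.weight_eq_sum (n := k)
      (ρ.length_le_weight.trans (hρ.le.trans (by omega)))).le

/-- The products of elementary functions are triangular in the m_ρ, and the set of ρ not dominating
ν is closed downwards. So g is a combination of products with leading partition in this set, each of
which pairs to zero. -/
theorem pairing_eq_zero {q : K} (hq : ∀ n, qPoch q q n ≠ 0) {ν : Partn} {d : ℕ}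
    (hν : ν.weight = d) {g : SymFun K}
    (hg : ∀ ρ, mCoeffHom K ρ g ≠ 0 → ρ.weight = d ∧ ¬ ν.DomLE ρ) :
    pairing q 0 g (symQ q d ν) = 0 := by
  classical
  choose l hl hl1 hl2 using exists_leadingProd (K := K)
  -- Elimination from the top: subtracting the leading products of rank t lowers the bound on the
  -- rank of the support.
  have main : ∀ (t : ℕ) (g : SymFun K), (∀ ρ, mCoeffHom K ρ g ≠ 0 →
      ρ.weight = d ∧ ¬ ν.DomLE ρ ∧ ρ.rank d < t) → pairing q 0 g (symQ q d ν) = 0 := by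
    intro t
    induction t with
    | zero =>
      intro g hg
      have : g = 0 := eq_zero_of_mCoeff fun μ => by
        by_contra h; exact Nat.not_lt_zero _ (hg μ h).2.2
      rw [this, map_zero, LinearMap.zero_apply]
    | succ t ih =>
      intro g hg
      set S := (Partn.finite_weight d).toFinset.filter fun ρ => ρ.rank d = t with hS
      have memS : ∀ ρ : Partn, ρ ∈ S ↔ ρ.weight = d ∧ ρ.rank d = t := fun ρ => by
        rw [hS, Finset.mem_filter, Set.Finite.mem_toFinset]; rfl
      have hgS : g = (g - ∑ ρ ∈ S, mCoeffHom K ρ g • elemProd K (l ρ)) +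
          ∑ ρ ∈ S, mCoeffHom K ρ g • elemProd K (l ρ) := by rw [sub_add_cancel]
      rw [hgS, map_add, LinearMap.add_apply, ih, zero_add, map_sum, LinearMap.sum_apply]
      · refine Finset.sum_eq_zero fun ρ hρ => ?_
        rw [map_smul, LinearMap.smul_apply, smul_eq_mul, mul_eq_zero]
        by_contra h
        obtain ⟨h1, h2⟩ := not_or.mp h
        exact (hg ρ h1).2.1 (domLE_of_pairing_ne_zero hq hν ((memS ρ).mp hρ).1 (hl ρ) h2)
      · intro σ hσ
        rw [map_sub, map_sum] at hσ
        simp only [map_smul, smul_eq_mul] at hσ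
        by_cases hσS : σ ∈ S
        · refine absurd ?_ hσ
          -- Distinct partitions of d of equal rank are incomparable, so no other product of rank t
          -- contains m_σ.
          rw [Finset.sum_eq_single σ, hl1, mul_one, sub_self]
          · intro ρ hρ hne
            by_contra h
            have hd := hl2 ρ σ (right_ne_zero_of_mul h)
            exact hne (hd.eq_of_rank_eq ((memS σ).mp hσS).1
              (((memS σ).mp hσS).2.trans ((memS ρ).mp hρ).2.symm)).symm
          · exact fun h => absurd hσS h
        · have key : σ.weight = d ∧ ¬ ν.DomLE σ ∧ σ.rank d < t + 1 := by
            by_cases h0 : mCoeffHom K σ g = 0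
            · rw [h0, zero_sub, neg_ne_zero] at hσ
              obtain ⟨ρ, hρ, hne⟩ := Finset.exists_ne_zero_of_sum_ne_zero hσ
              have h1 := hl2 ρ σ (right_ne_zero_of_mul hne)
              have h2 := hg ρ (left_ne_zero_of_mul hne)
              exact ⟨h1.1.trans h2.1, fun h => h2.2.1 (h.trans h1),
                (h1.rank_le d).trans_lt h2.2.2⟩
            · exact hg σ h0
          refine ⟨key.1, key.2.1, ?_⟩
          have : σ.rank d ≠ t := fun h => hσS ((memS σ).mpr ⟨key.1, h⟩)
          have := key.2.2
          omega
  obtain ⟨t, ht⟩ : ∃ t, ∀ ρ : Partn, ρ.weight = d → ρ.rank d < t := by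
    refine ⟨(Partn.finite_weight d).toFinset.sup (fun ρ => ρ.rank d) + 1, fun ρ hρ => ?_⟩
    exact Nat.lt_succ_of_le (Finset.le_sup (f := fun ρ : Partn => ρ.rank d)
      ((Set.Finite.mem_toFinset _).mpr hρ))
  exact main t g fun ρ hρ => ⟨(hg ρ hρ).1, (hg ρ hρ).2, ht ρ (hg ρ hρ).1⟩

theorem pairing_leadingProd {q : K} (hq : ∀ n, qPoch q q n ≠ 0) {ν : Partn} {d : ℕ}
    (hν : ν.weight = d) {l : List ℕ} (hl : colSum l = ν) :
    pairing q 0 (elemProd K l) (symQ q d ν) = 1 := by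
  rw [← hl]
  exact pairing_elemProd_colSum hq l (hl ▸ Partn.mem_seqBox_of_weight hν (Nat.le_succ d))

theorem isMacdonald_symQ {q : K} (hq : ∀ n, qPoch q q n ≠ 0) {ν : Partn} {d n : ℕ}
    (hν : ν.weight = d) (hn : ν.length ≤ n) :
    IsMacdonald q 0 ν ((∏ i ∈ Finset.range n, qPoch q q (ν.diff i)) • symQ q d ν) := by
  have hc : ∏ i ∈ Finset.range n, qPoch q q (ν.diff i) ≠ 0 :=
    Finset.prod_ne_zero_iff.mpr fun i _ => hq _
  refine ⟨?_, fun μ h => ?_, fun g hg => ?_⟩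
  · rw [← mCoeffHom_apply, map_smul, mCoeff_symQ_self hq hν hn, smul_eq_mul, mul_inv_cancel₀ hc]
  · rw [← mCoeffHom_apply, map_smul, smul_eq_mul] at h
    exact domLE_of_mCoeff_symQ hq hν (right_ne_zero_of_mul h)
  · rw [← pairing_apply, pairing_comm, map_smul, pairing_eq_zero hq hν, smul_zero]
    intro ρ hρ
    obtain ⟨h1, h2⟩ := hg ρ hρ
    exact ⟨h1.1.trans hν, fun h => h2 (h1.antisymm h)⟩

/-- Let μ have maximal rank in the support of the difference D. As μ < ν, the function Q_μ lies
strictly below ν and is orthogonal to D; yet the pairing of D with Q_μ is the coefficient of m_μ in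
D, since the leading product of μ pairs to 1. -/
theorem IsMacdonald.unique {q : K} (hq : ∀ n, qPoch q q n ≠ 0) {ν : Partn} {P P' : SymFun K}
    (hP : IsMacdonald q 0 ν P) (hP' : IsMacdonald q 0 ν P') : P = P' := by
  by_contra hne
  set D := P - P' with hD
  have hsupp : ∀ μ, mCoeffHom K μ D ≠ 0 → μ.DomLE ν ∧ μ ≠ ν := by
    intro μ h
    rw [hD, map_sub] at h
    refine ⟨?_, ?_⟩
    · by_cases h0 : mCoeffHom K μ P = 0
      · rw [h0, zero_sub, neg_ne_zero] at h
        exact hP'.2.1 μ h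
      · exact hP.2.1 μ h0
    · rintro rfl
      exact h (by rw [mCoeffHom_apply, mCoeffHom_apply, hP.1, hP'.1, sub_self])
  have hex : {μ | mCoeffHom K μ D ≠ 0}.Nonempty := by
    by_contra h
    rw [Set.not_nonempty_iff_eq_empty, Set.eq_empty_iff_forall_notMem] at h
    exact hne (sub_eq_zero.mp (eq_zero_of_mCoeff fun μ => not_not.mp (h μ)))
  obtain ⟨μ, hμ, hmax⟩ := Set.exists_max_image {μ | mCoeffHom K μ D ≠ 0}
    (fun μ => μ.rank ν.weight)
    ((Partn.finite_weight ν.weight).subset fun μ h => (hsupp μ h).1.1) hex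
  have hw : μ.weight = ν.weight := (hsupp μ hμ).1.1
  have hQ : ∀ ρ, (symQ q ν.weight μ).mCoeff ρ ≠ 0 → ρ.DomLE ν ∧ ρ ≠ ν := by
    intro ρ hρ
    have h1 := domLE_of_mCoeff_symQ hq hw hρ
    refine ⟨h1.trans (hsupp μ hμ).1, ?_⟩
    rintro rfl
    exact (hsupp μ hμ).2 ((hsupp μ hμ).1.antisymm h1)
  have h0 : pairing q 0 D (symQ q ν.weight μ) = 0 := by
    rw [hD, map_sub, LinearMap.sub_apply, pairing_apply, pairing_apply, hP.2.2 _ hQ,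
      hP'.2.2 _ hQ, sub_self]
  obtain ⟨l, hl, hl1, hl2⟩ := exists_leadingProd (K := K) μ
  -- Without its leading term at μ, the support contains no partition dominating μ, by maximality of
  -- the rank.
  have h1 : pairing q 0 (D - mCoeffHom K μ D • elemProd K l) (symQ q ν.weight μ) = 0 := by
    refine pairing_eq_zero hq hw fun ρ hρ => ?_
    rw [map_sub, map_smul, smul_eq_mul] at hρ
    have hρμ : ρ ≠ μ := by
      rintro rfl
      exact hρ (by rw [hl1, mul_one, sub_self])
    by_cases hρD : mCoeffHom K ρ D = 0
    · rw [hρD, zero_sub, neg_ne_zero] at hρ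
      have h2 := hl2 ρ (right_ne_zero_of_mul hρ)
      exact ⟨h2.1.trans hw, fun h => hρμ (h2.antisymm h)⟩
    · exact ⟨(hsupp ρ hρD).1.1, fun h => hρμ
        (h.eq_of_rank_eq hw (le_antisymm (h.rank_le _) (hmax ρ hρD))).symm⟩
  rw [map_sub, LinearMap.sub_apply, h0, map_smul, LinearMap.smul_apply,
    pairing_leadingProd hq hw hl, smul_eq_mul, mul_one, zero_sub, neg_eq_zero] at h1
  exact hμ h1

theorem qWhittaker_eq {q : K} (hq : ∀ n, qPoch q q n ≠ 0) {ν : Partn} {n : ℕ}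
    (hn : ν.length ≤ n) : qWhittaker q n ν =
      C (∏ i ∈ Finset.range n, qPoch q q (ν.diff i)) * interpPoly q 0 ν.weight n ν := by
  have hM := isMacdonald_symQ hq (rfl : ν.weight = ν.weight) hn
  have hex : ∃ P, IsMacdonald q 0 ν P := ⟨_, hM⟩
  have e : macdonaldP q 0 ν = (∏ i ∈ Finset.range n, qPoch q q (ν.diff i)) •
      symQ q ν.weight ν := by
    rw [macdonaldP, dif_pos hex]
    exact hex.choose_spec.unique hq hM
  rw [qWhittaker, e, ← inVarsHom_apply, map_smul, MvPolynomial.smul_eq_C_mul,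
    (isSymQ_symQ hq (Partn.mem_seqBox_of_weight rfl le_rfl) ν.antitone n
      fun i hi => Partn.eq_zero_of_length_le hn hi).2]

end Macdonald

/-! ### The two characterizations for generic parameters -/

section Characterization

variable {K : Type*} [Field K] {q : K} {a : ℕ → K}

theorem interpPoint_eq (q : K) (a : ℕ → K) (n : ℕ) (μ : Partn) :
    interpPoint q a n μ = seqPoint q a n μ := rfl

theorem interpValue_eq (q : K) (a : ℕ → K) (n : ℕ) (μ : Partn) :
    interpValue q a n μ = seqValue q a n μ := rfl

theorem eq_zero_of_eval_interpPoint (hg : GenericParams q a) {n d : ℕ}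
    {f : MvPolynomial (Fin n) K} (hf : f.IsSymmetric) (hd : f.totalDegree ≤ d)
    (hv : ∀ μ : Partn, μ.length ≤ n → μ.weight ≤ d → eval (interpPoint q a n μ) f = 0) : f = 0 := by
  refine interpolation_unique hg hf hd fun μ h1 h2 h3 => ?_
  have hl := Partn.length_ofSeq_le μ h1 n h2
  exact hv (Partn.ofSeq μ h1 n h2) hl (by rw [Partn.weight_eq_sum hl]; exact h3)

theorem interpWhittaker_isSymmetric (hg : GenericParams q a) {n : ℕ} {lam : Partn}
    (hlam : lam.length ≤ n) : (interpWhittaker q a n lam).IsSymmetric := by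
  rw [interpWhittaker_eq q hg.qPoch_ne a lam.weight n lam hlam (lam.le_weight 0)]
  exact interpPoly_isSymmetric hg.qPoch_ne a n lam.le_weight

theorem topPart_interpWhittaker (hg : GenericParams q a) {n : ℕ} {lam : Partn}
    (hlam : lam.length ≤ n) :
    TopPart lam.weight (interpWhittaker q a n lam) (interpPoly q 0 lam.weight n lam) := by
  rw [interpWhittaker_eq q hg.qPoch_ne a lam.weight n lam hlam (lam.le_weight 0)]
  exact (topPart_interpPoly q a lam.weight n lam).congr_degree (Partn.weight_eq_sum hlam).symm

theorem eval_interpWhittaker_eq_zero (hg : GenericParams q a) {n : ℕ} {lam μ : Partn}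
    (hlam : lam.length ≤ n) (hμ : μ.length ≤ n) (hw : μ.weight ≤ lam.weight) (hne : μ ≠ lam) :
    eval (interpPoint q a n μ) (interpWhittaker q a n lam) = 0 := by
  by_contra h
  rw [interpWhittaker_eq q hg.qPoch_ne a lam.weight n lam hlam (lam.le_weight 0),
    eval_interpPoly, interpPoint_eq] at h
  have h1 := le_of_branchPoly_ne_zero q _ n a μ lam μ.antitone h
  refine hne (Partn.coe_injective (funext fun i => ?_))
  change μ i = lam i
  rcases lt_or_ge i n with hi | hi
  · rw [Partn.weight_eq_sum hμ, Partn.weight_eq_sum hlam] at hw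
    refine ((Finset.sum_eq_sum_iff_of_le fun i hi => h1 i (Finset.mem_range.mp hi)).mp ?_ i
      (Finset.mem_range.mpr hi)).symm
    exact le_antisymm (Finset.sum_le_sum fun i hi => h1 i (Finset.mem_range.mp hi)) hw
  · rw [Partn.eq_zero_of_length_le hμ hi, Partn.eq_zero_of_length_le hlam hi]

theorem eval_interpWhittaker_self (hg : GenericParams q a) {n : ℕ} {lam : Partn}
    (hlam : lam.length ≤ n) :
    eval (interpPoint q a n lam) (interpWhittaker q a n lam) = interpValue q a n lam := by
  rw [interpWhittaker_eq q hg.qPoch_ne a lam.weight n lam hlam (lam.le_weight 0),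
    eval_interpPoly, interpPoint_eq, interpValue_eq]
  exact branchPoly_seqPoint_self hg _ n lam lam.antitone lam.le_weight
    fun i hi => Partn.eq_zero_of_length_le hlam hi

theorem eq_interpWhittaker_iff_eval (hg : GenericParams q a) {n : ℕ} {lam : Partn}
    (hlam : lam.length ≤ n) (f : MvPolynomial (Fin n) K) :
    ((f.IsSymmetric ∧ f.totalDegree ≤ lam.weight) ∧
      (∀ μ : Partn, μ.length ≤ n → μ.weight ≤ lam.weight → μ ≠ lam →
        eval (interpPoint q a n μ) f = 0) ∧
      eval (interpPoint q a n lam) f = interpValue q a n lam) ↔ f = interpWhittaker q a n lam := by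
  constructor
  · rintro ⟨⟨hs, hd⟩, hv, hval⟩
    refine sub_eq_zero.mp (eq_zero_of_eval_interpPoint hg (d := lam.weight)
      (hs.sub (interpWhittaker_isSymmetric hg hlam))
      ((totalDegree_sub _ _).trans (max_le hd (topPart_interpWhittaker hg hlam).totalDegree_le))
      fun μ h1 h2 => ?_)
    rw [map_sub]
    by_cases hμ : μ = lam
    · rw [hμ, hval, eval_interpWhittaker_self hg hlam, sub_self]
    · rw [hv μ h1 h2 hμ, eval_interpWhittaker_eq_zero hg hlam h1 h2 hμ, sub_self]
  · rintro rfl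
    exact ⟨⟨interpWhittaker_isSymmetric hg hlam, (topPart_interpWhittaker hg hlam).totalDegree_le⟩,
      fun μ h1 h2 h3 => eval_interpWhittaker_eq_zero hg hlam h1 h2 h3,
      eval_interpWhittaker_self hg hlam⟩

theorem totalDegree_lt_of_homogeneousComponent_eq_zero {σ : Type*} {f : MvPolynomial σ K} {d : ℕ}
    (hd : f.totalDegree ≤ d) (h : homogeneousComponent d f = 0) (h0 : f ≠ 0) :
    f.totalDegree < d := by
  refine lt_of_le_of_ne hd fun he => h0 ?_
  by_contra hf
  obtain ⟨m, hm, hmd⟩ := Finset.exists_mem_eq_sup f.support (support_nonempty.mpr hf)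
    fun m => m.sum fun _ e => e
  have h1 : coeff m (homogeneousComponent d f) = coeff m f := by
    rw [coeff_homogeneousComponent, if_pos]
    rw [← he]
    exact hmd.symm
  rw [h, coeff_zero] at h1
  exact mem_support_iff.mp hm h1.symm

/-- The difference of two solutions has no component of degree |λ|, so vanishing at the points with
|μ| < |λ| already suffices to make it zero. -/
theorem eq_interpWhittaker_iff_topComponent [CharZero K] (hg : GenericParams q a) {n : ℕ}
    {lam : Partn} (hlam : lam.length ≤ n) (f : MvPolynomial (Fin n) K) :
    ((f.IsSymmetric ∧ f.totalDegree ≤ lam.weight) ∧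
      (∀ μ : Partn, μ.length ≤ n → μ.weight < lam.weight →
        eval (interpPoint q a n μ) f = 0) ∧
      (f.totalDegree = lam.weight ∧ homogeneousComponent lam.weight f =
        C (∏ i ∈ Finset.range n, qPoch q q (lam.diff i))⁻¹ * qWhittaker q n lam)) ↔
      f = interpWhittaker q a n lam := by
  have hc : ∏ i ∈ Finset.range n, qPoch q q (lam.diff i) ≠ 0 :=
    Finset.prod_ne_zero_iff.mpr fun i _ => hg.qPoch_ne _
  have hQ : C (∏ i ∈ Finset.range n, qPoch q q (lam.diff i))⁻¹ * qWhittaker q n lam =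
      interpPoly q 0 lam.weight n lam := by
    rw [qWhittaker_eq hg.qPoch_ne hlam, ← mul_assoc, ← C_mul, inv_mul_cancel₀ hc, C_1, one_mul]
  have htop := topPart_interpWhittaker hg hlam
  rw [hQ]
  constructor
  · rintro ⟨⟨hs, hd⟩, hv, -, hcomp⟩
    by_contra hne
    set g := f - interpWhittaker q a n lam with hgdef
    have hg0 : g ≠ 0 := fun h => hne (sub_eq_zero.mp h)
    have hlt : g.totalDegree < lam.weight := by
      refine totalDegree_lt_of_homogeneousComponent_eq_zero
        ((totalDegree_sub _ _).trans (max_le hd htop.totalDegree_le)) ?_ hg0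
      rw [hgdef, map_sub, hcomp, htop.homogeneousComponent, sub_self]
    refine hg0 (eq_zero_of_eval_interpPoint hg (hs.sub (interpWhittaker_isSymmetric hg hlam))
      (Nat.le_sub_one_of_lt hlt) fun μ h1 h2 => ?_)
    have hw : μ.weight < lam.weight := by omega
    rw [map_sub, hv μ h1 hw, eval_interpWhittaker_eq_zero hg hlam h1 hw.le, sub_self]
    rintro rfl
    exact lt_irrefl _ hw
  · rintro rfl
    refine ⟨⟨interpWhittaker_isSymmetric hg hlam, htop.totalDegree_le⟩, fun μ h1 h2 => ?_, ?_,
      htop.homogeneousComponent⟩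
    · refine eval_interpWhittaker_eq_zero hg hlam h1 h2.le ?_
      rintro rfl
      exact lt_irrefl _ h2
    -- The degree is exactly |λ| because the coefficient of x^λ in the top component is an inverse
    -- of a non-zero product.
    · refine le_antisymm htop.totalDegree_le (not_lt.mp fun hlt => ?_)
      have h0 := htop.homogeneousComponent
      rw [homogeneousComponent_eq_zero _ _ hlt] at h0
      have h1 := coeff_interpPoly_self hg.qPoch_ne lam.weight n lam.antitone lam.le_weight
        fun i hi => Partn.eq_zero_of_length_le hlam hi
      rw [← h0, coeff_zero] at h1
      exact inv_ne_zero hc h1.symm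

end Characterization

/-! ### Genericity of the formal variables -/

theorem algebraMap_QA_injective :
    Function.Injective (algebraMap (MvPolynomial (Option ℕ) ℂ) QA) :=
  IsFractionRing.injective _ _

theorem algebraMap_QA_ne_zero {p : MvPolynomial (Option ℕ) ℂ} (x : Option ℕ → ℂ)
    (h : eval x p ≠ 0) : algebraMap (MvPolynomial (Option ℕ) ℂ) QA p ≠ 0 := by
  intro h0
  rw [(map_eq_zero_iff _ algebraMap_QA_injective).mp h0, map_zero] at h
  exact h rfl

theorem genericParams_QA : GenericParams qVar aVar where
  qPoch_ne n := by
    refine Finset.prod_ne_zero_iff.mpr fun i _ => ?_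
    have : 1 - qVar * qVar ^ i =
        algebraMap (MvPolynomial (Option ℕ) ℂ) QA (1 - X none * X none ^ i) := by
      simp [qVar]
    rw [this]
    exact algebraMap_QA_ne_zero (fun _ => 0) (by simp)
  q_ne := algebraMap_QA_ne_zero (fun _ => 1) (by simp)
  a_ne i := algebraMap_QA_ne_zero (fun _ => 1) (by simp)
  sep i j hij d e := by
    rw [← sub_ne_zero]
    have : aVar i * qVar ^ d - aVar j * qVar ^ e = algebraMap (MvPolynomial (Option ℕ) ℂ) QA
        (X (some i) * X none ^ d - X (some j) * X none ^ e) := by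
      simp [qVar, aVar]
    rw [this]
    -- Setting a_j = 0 and all other variables equal to 1 gives the value 1.
    exact algebraMap_QA_ne_zero (fun o => if o = some j then 0 else 1) (by simp [hij])

end InterpWhittaker

open InterpWhittaker

theorem proposition5p12 (n : ℕ) (lam : Partn) (hlam : lam.length ≤ n) :
    (∀ f : MvPolynomial (Fin n) QA,
      ((f.IsSymmetric ∧ f.totalDegree ≤ lam.weight) ∧
        (∀ μ : Partn, μ.length ≤ n → μ.weight ≤ lam.weight → μ ≠ lam →
          MvPolynomial.eval (interpPoint qVar aVar n μ) f = 0) ∧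
        MvPolynomial.eval (interpPoint qVar aVar n lam) f = interpValue qVar aVar n lam)
      ↔ f = interpWhittaker qVar aVar n lam) ∧
    (∀ f : MvPolynomial (Fin n) QA,
      ((f.IsSymmetric ∧ f.totalDegree ≤ lam.weight) ∧
        (∀ μ : Partn, μ.length ≤ n → μ.weight < lam.weight →
          MvPolynomial.eval (interpPoint qVar aVar n μ) f = 0) ∧
        (f.totalDegree = lam.weight ∧
          MvPolynomial.homogeneousComponent lam.weight f =
            MvPolynomial.C (∏ i ∈ Finset.range n, qPoch qVar qVar (lam.diff i))⁻¹
              * qWhittaker qVar n lam))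
      ↔ f = interpWhittaker qVar aVar n lam) :=
  ⟨eq_interpWhittaker_iff_eval genericParams_QA hlam,
    eq_interpWhittaker_iff_topComponent genericParams_QA hlam⟩
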